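/- Let $\mathbb T=\mathbb R/2\pi\mathbb Z$ and let $\dot H^4(\mathbb T)$ be the space of real functions in $H^4(\mathbb T)$ with $\int_{\mathbb T}v=0$, with the $H^4$ norm $\|v\|_{\dot H^4}^2=\sum_{i=0}^{4}\|\partial^i v\|_{L^2}^2$ (equivalent to $\|\partial^4 v\|_{L^2}^2$ on this space). For $c>0$ put, with weak derivatives, $$L(v)=-c^3(\partial^2 v+\partial^4 v),\qquad \bar R(v)=-\partial\big((v^3+3c^2v+3cv^2)(\partial v+\partial^3 v)\big),\qquad R(v)=-\partial\Big(\frac{v^2}{2}\Big)+\bar R(v),$$ which map $\dot H^4(\mathbb T)$ to $L^2(\mathbb T)$. Let $N\in\{R,\bar R\}$. For an interval $I=[0,T]$ or $I=[0,T)$, a solution on $I$ is a function $v\in C(I;\dot H^4(\mathbb T))\cap C^1(I\setminus\{0\};\dot H^4(\mathbb T))$ with $\frac{dv}{dt}=L(v)+N(v)$ for all $t\in I\setminus\{0\}$; it is called positive if $h=c+v$ satisfies $\inf_{t\in I}\inf_{\mathbb T}h(\cdot,t)>0$. Then for every $c>0$ and each choice of $N$: (a) There exist $\delta_0>0$, $T\in(0,1)$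 and $C$, depending only on $c$ (and the choice of $N$), such that for every $v_{in}\in\dot H^4(\mathbb T)$ with $\|v_{in}\|_{\dot H^4}\le\delta_0$ there is a positive solution $v$ on $[0,T]$ with $v(\cdot,0)=v_{in}$ and $$\sup_{0\le t\le T}\|v(\cdot,t)\|_{\dot H^4}\le C\|v_{in}\|_{\dot H^4}.$$ (b) The solution can be extended as long as $h$ stays positive: if $\|v_{in}\|_{\dot H^4}\le\delta_0$, $S>0$ and $v$ is a positive solution on $[0,S)$ with $v(\cdot,0)=v_{in}$ (positive as defined above, so $\inf_{0\le t<S}\inf_{\mathbb T}h(\cdot,t)>0$; this holds in particular if $\sup_{0\le t<S}\|v(\cdot,t)\|_{L^\infty(\mathbb T)}<c$), then there are $S'>S$ and a positive solution on $[0,S']$ that coincides with $v$ on $[0,S)$. (c) Uniqueness: for every $S>0$, two positive solutions on $[0,S]$ with the same initial value coincide on $[0,S]$. -/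

import Mathlib

open MeasureTheory Set
open scoped ContDiff

noncomputable section

namespace ThinFilm

/-- The circle `ℝ / 2πℤ`; its `volume` has total mass `2π`. -/
abbrev Circ : Type := AddCircle (2 * Real.pi)

instance factTwoPiPos : Fact (0 < 2 * Real.pi) := ⟨Real.two_pi_pos⟩

/-- The real Hilbert space `L²(𝕋)`. -/
abbrev L2 : Type := Lp ℝ 2 (volume : Measure Circ)

/-- `g` is the weak derivative of `f` on the circle: `∫ f φ' = - ∫ g φ` for every smooth
`2π`-periodic test function `φ` (here `ψ = φ'`). -/
def HasWeakDeriv (f g : Circ → ℝ) : Prop :=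
  Integrable f ∧ Integrable g ∧
    ∀ φ ψ : C(Circ, ℝ), ContDiff ℝ ∞ (fun y : ℝ => φ (y : Circ)) →
      (∀ x : ℝ, HasDerivAt (fun y : ℝ => φ (y : Circ)) (ψ (x : Circ)) x) →
        ∫ x, f x * ψ x = -∫ x, g x * φ x

theorem integrable_mul_continuousMap {f : Circ → ℝ} (hf : Integrable f) (φ : C(Circ, ℝ)) :
    Integrable (fun x => f x * φ x) := by
  refine hf.mul_bdd (c := ‖φ‖) φ.continuous.aestronglyMeasurable ?_
  exact Filter.Eventually.of_forall fun x => φ.norm_coe_le_norm x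

theorem HasWeakDeriv.congr {f g f' g' : Circ → ℝ} (h : HasWeakDeriv f g)
    (hf : f =ᵐ[volume] f') (hg : g =ᵐ[volume] g') : HasWeakDeriv f' g' := by
  refine ⟨h.1.congr hf, h.2.1.congr hg, fun φ ψ hφ hψ => ?_⟩
  have h1 : ∫ x, f' x * ψ x = ∫ x, f x * ψ x :=
    integral_congr_ae (by filter_upwards [hf] with x hx; rw [hx])
  have h2 : ∫ x, g' x * φ x = ∫ x, g x * φ x :=
    integral_congr_ae (by filter_upwards [hg] with x hx; rw [hx])
  rw [h1, h2]
  exact h.2.2 φ ψ hφ hψ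

theorem HasWeakDeriv.zero : HasWeakDeriv (0 : Circ → ℝ) 0 :=
  ⟨integrable_zero _ _ _, integrable_zero _ _ _, by simp⟩

theorem HasWeakDeriv.add {f g f' g' : Circ → ℝ} (h : HasWeakDeriv f g)
    (h' : HasWeakDeriv f' g') : HasWeakDeriv (f + f') (g + g') := by
  refine ⟨h.1.add h'.1, h.2.1.add h'.2.1, fun φ ψ hφ hψ => ?_⟩
  simp only [Pi.add_apply, add_mul]
  rw [integral_add (integrable_mul_continuousMap h.1 ψ) (integrable_mul_continuousMap h'.1 ψ),
    integral_add (integrable_mul_continuousMap h.2.1 φ) (integrable_mul_continuousMap h'.2.1 φ),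
    h.2.2 φ ψ hφ hψ, h'.2.2 φ ψ hφ hψ, neg_add]

theorem HasWeakDeriv.const_smul {f g : Circ → ℝ} (a : ℝ) (h : HasWeakDeriv f g) :
    HasWeakDeriv (a • f) (a • g) := by
  refine ⟨h.1.smul a, h.2.1.smul a, fun φ ψ hφ hψ => ?_⟩
  simp only [Pi.smul_apply, smul_eq_mul, mul_assoc]
  rw [integral_const_mul, integral_const_mul, h.2.2 φ ψ hφ hψ, mul_neg]

theorem L2.integrable (f : L2) : Integrable (f : Circ → ℝ) :=
  (Lp.memLp f).integrable (by norm_num)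

/-- The mean-zero Sobolev space `Ḣᵏ(𝕋)`. An element is stored as the tuple
`(v, ∂v, …, ∂ᵏv)` of `L²` functions, each the weak derivative of the previous one, with
`∫ v = 0`; the tuple is determined by `v`. The norm inherited from the `ℓ²` product is the
Hilbert norm `‖v‖² = ∑ i ≤ k, ‖∂ⁱv‖²_{L²}` of `Hᵏ(𝕋)`. -/
def HDot (k : ℕ) : Submodule ℝ (PiLp 2 (fun _ : Fin (k + 1) => L2)) where
  carrier := {v | (∀ i : Fin k, HasWeakDeriv (v i.castSucc) (v i.succ)) ∧
    ∫ x, (v 0 : L2) x = 0}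
  zero_mem' := by
    refine ⟨fun i => HasWeakDeriv.zero.congr ?_ ?_, ?_⟩
    · exact (Lp.coeFn_zero ℝ 2 (volume : Measure Circ)).symm
    · exact (Lp.coeFn_zero ℝ 2 (volume : Measure Circ)).symm
    · exact (integral_congr_ae (Lp.coeFn_zero ℝ 2 (volume : Measure Circ))).trans (by simp)
  add_mem' := by
    rintro u v ⟨hu, hu0⟩ ⟨hv, hv0⟩
    refine ⟨fun i => ((hu i).add (hv i)).congr ?_ ?_, ?_⟩
    · exact (Lp.coeFn_add (u i.castSucc) (v i.castSucc)).symm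
    · exact (Lp.coeFn_add (u i.succ) (v i.succ)).symm
    · refine (integral_congr_ae (Lp.coeFn_add (u 0) (v 0))).trans ?_
      simp only [Pi.add_apply]
      rw [integral_add (L2.integrable _) (L2.integrable _), hu0, hv0, add_zero]
  smul_mem' := by
    rintro a v ⟨hv, hv0⟩
    refine ⟨fun i => ((hv i).const_smul a).congr ?_ ?_, ?_⟩
    · exact (Lp.coeFn_smul a (v i.castSucc)).symm
    · exact (Lp.coeFn_smul a (v i.succ)).symm
    · refine (integral_congr_ae (Lp.coeFn_smul a (v 0))).trans ?_
      simp only [Pi.smul_apply, smul_eq_mul]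
      rw [integral_const_mul, hv0, mul_zero]

/-- The weak derivative `∂ⁱ v` of `v ∈ Ḣ⁴(𝕋)`; `D 0 v` is `v` itself, seen in `L²(𝕋)`. -/
def D (i : Fin 5) (v : HDot 4) : L2 := (v : PiLp 2 (fun _ : Fin 5 => L2)) i

/-- The linear operator `L v = -c³ (∂²v + ∂⁴v)`. -/
def opL (c : ℝ) (v : HDot 4) : L2 := -(c ^ 3) • (D 2 v + D 4 v)

/-- The function `(v³ + 3c²v + 3cv²) (∂v + ∂³v)`. -/
def flux (c : ℝ) (v : HDot 4) (x : Circ) : ℝ :=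
  ((D 0 v x) ^ 3 + 3 * c ^ 2 * D 0 v x + 3 * c * (D 0 v x) ^ 2) * (D 1 v x + D 3 v x)

/-- `r = R(v) = -∂(v²/2) - ∂((v³ + 3c²v + 3cv²)(∂v + ∂³v))` in `L²(𝕋)`. -/
def IsR (c : ℝ) (v : HDot 4) (r : L2) : Prop :=
  ∃ r₁ r₂ : L2, HasWeakDeriv (fun x => (D 0 v x) ^ 2 / 2) r₁ ∧
    HasWeakDeriv (flux c v) r₂ ∧ r = -r₁ - r₂

/-- `r = R̄(v) = -∂((v³ + 3c²v + 3cv²)(∂v + ∂³v))` in `L²(𝕋)`. -/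
def IsRbar (c : ℝ) (v : HDot 4) (r : L2) : Prop :=
  ∃ r₂ : L2, HasWeakDeriv (flux c v) r₂ ∧ r = -r₂

/-- `v ∈ C(I; Ḣ⁴) ∩ C¹(I ∖ {0}; Ḣ⁴)` solves `dv/dt = L v + N(v)` on `I ∖ {0}`, where the
nonlinear operator `N` is given through its graph. It is used for the time intervals
`I = [0, T]` and `I = [0, T)`. -/
def IsSolution (c : ℝ) (N : HDot 4 → L2 → Prop) (I : Set ℝ) (v : ℝ → HDot 4) : Prop :=
  ContinuousOn v I ∧
    ∃ w : ℝ → HDot 4, ContinuousOn w (I \ {0}) ∧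
      ∀ t ∈ I \ {0}, HasDerivWithinAt v (w t) I t ∧
        ∃ r : L2, N (v t) r ∧ D 0 (w t) = opL c (v t) + r

/-- The film height `h = c + v` is bounded below by a positive constant, uniformly for times
in `I`: `inf_{t ∈ I} inf_𝕋 h(·, t) > 0`. -/
def FilmPositiveOn (c : ℝ) (I : Set ℝ) (v : ℝ → HDot 4) : Prop :=
  ∃ m : ℝ, 0 < m ∧ ∀ t ∈ I, ∀ᵐ x : Circ, m ≤ c + D 0 (v t) x

end ThinFilm

end

open ThinFilm

/-!
In divergence form, the equation is `∂ₜv + ∂(θ v²/2 + h³(∂v + ∂³v)) = 0` with the height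
`h = c + v`, where `θ = 1` for `R` and `θ = 0` for `R̄` (`exists_isNonlinearity`).
All estimates are proved for smooth periodic functions, which form the algebra `Per` with derivation
`der`; the space `Ḣ⁴` is reached by truncating the expansion in the orthogonal basis of the real
Hartley functions `cos kx + sin kx`.

As long as `h ≥ m > 0`, the equation is parabolic, and three estimates hold. First, the energies
`‖∂ᵏv‖²` with `k ≥ 2` grow at most exponentially, at a rate that depends on a bound for `∂ᵏ⁻¹v`
(`exists_energy_bound`): integration by parts produces `-m³ ‖∂ᵏ⁺²v‖²`, and the remaining terms are
absorbed by interpolation. Second, the `L²` distance of two solutions that are bounded in `H⁴` grows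
at most exponentially (`exists_difference_bound`). Third, `‖∂v‖² - ‖v‖²` grows, up to an additive
constant, at most exponentially (`first_energy_le`); because `h` is nonnegative with fixed mass,
`‖v‖²` is bounded by a constant plus `‖∂v‖² / 4`, so that this quantity controls `‖∂v‖²` although it
is not positive definite for the low modes (`norm_toL2_sq_le_quarter`).

Local existence: Galerkin solutions exist on an interval that depends only on the `H⁴` bound and on
the lower bound of `h` (`exists_galerkin`). The difference estimate makes them a Cauchy sequence in
`L²` (`exists_galerkin_difference`), and parabolic smoothing bounds all their derivatives away from
`t = 0` (`exists_smoothing_bound`); interpolation gives a limit that is smooth for `t > 0`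
(`exists_galerkin_limit`). At `t = 0` the limit is continuous in `L²`, and its `H⁴` norm does not
jump up, which gives continuity in `Ḣ⁴` (`tendsto_of_norm_D_four_le`).

Uniqueness is the difference estimate, carried over to solutions in `Ḣ⁴` by density
(`IsNonlinearity.eqOn`). It implies that every positive solution coincides with smooth ones for
`t > 0`, so that the energy estimates of order one to four apply to it in turn and bound it in `Ḣ⁴`
up to the end of its interval of existence (`IsNonlinearity.exists_bound`). Restarting shortly before
that time continues it (`IsNonlinearity.exists_continuation`).
-/

noncomputable section

namespace ThinFilm

/-! ### Smooth periodic functions -/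

/-- The algebra of smooth `2π`-periodic functions on the line. -/
def smoothPeriodic : Subalgebra ℝ (ℝ → ℝ) where
  carrier := {f | ContDiff ℝ ∞ f ∧ Function.Periodic f (2 * Real.pi)}
  mul_mem' := fun hf hg => ⟨hf.1.mul hg.1, hf.2.mul hg.2⟩
  add_mem' := fun hf hg => ⟨hf.1.add hg.1, hf.2.add hg.2⟩
  algebraMap_mem' := fun _ => ⟨contDiff_const, fun _ => rfl⟩

/-- Smooth `2π`-periodic functions, as a type. -/
def Per : Type := smoothPeriodic

instance : CommRing Per := inferInstanceAs (CommRing smoothPeriodic)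

instance : Algebra ℝ Per := inferInstanceAs (Algebra ℝ smoothPeriodic)

instance : CoeFun Per (fun _ => ℝ → ℝ) := ⟨Subtype.val⟩

namespace Per

theorem contDiff (f : Per) : ContDiff ℝ ∞ (f : ℝ → ℝ) := f.2.1

theorem periodic (f : Per) : Function.Periodic (f : ℝ → ℝ) (2 * Real.pi) := f.2.2

theorem continuous (f : Per) : Continuous (f : ℝ → ℝ) := f.contDiff.continuous

@[ext] theorem ext {f g : Per} (h : ∀ x, f x = g x) : f = g := Subtype.ext (funext h)

@[simp] theorem add_apply (f g : Per) (x : ℝ) : (f + g) x = f x + g x := rfl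
@[simp] theorem sub_apply (f g : Per) (x : ℝ) : (f - g) x = f x - g x := rfl
@[simp] theorem mul_apply (f g : Per) (x : ℝ) : (f * g) x = f x * g x := rfl
@[simp] theorem smul_apply (a : ℝ) (f : Per) (x : ℝ) : (a • f) x = a * f x := rfl
@[simp] theorem one_apply (x : ℝ) : (1 : Per) x = 1 := rfl
@[simp] theorem algebraMap_apply (a x : ℝ) : (algebraMap ℝ Per a) x = a := rfl

theorem differentiable (f : Per) : Differentiable ℝ (f : ℝ → ℝ) :=
  f.contDiff.differentiable (by simp)

/-- Differentiation of smooth periodic functions. -/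
def der : Module.End ℝ Per where
  toFun f := ⟨deriv f, (contDiff_infty_iff_deriv.1 f.contDiff).2, fun x => by
    rw [← deriv_comp_add_const]
    congr 1
    exact funext f.periodic⟩
  map_add' f g := by
    ext x
    exact deriv_add (f.differentiable x) (g.differentiable x)
  map_smul' a f := by
    ext x
    exact deriv_const_mul a (f.differentiable x)

theorem der_apply (f : Per) (x : ℝ) : der f x = deriv f x := rfl

theorem hasDerivAt (f : Per) (x : ℝ) : HasDerivAt (f : ℝ → ℝ) (der f x) x :=
  (f.differentiable x).hasDerivAt

theorem der_eq {f g : Per} (h : ∀ x, HasDerivAt (f : ℝ → ℝ) (g x) x) : der f = g := by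
  ext x
  exact (h x).deriv

theorem der_mul (f g : Per) : der (f * g) = der f * g + f * der g :=
  der_eq fun x => (f.hasDerivAt x).mul (g.hasDerivAt x)

@[simp] theorem der_algebraMap (a : ℝ) : der (algebraMap ℝ Per a) = 0 :=
  der_eq fun x => hasDerivAt_const x a

theorem pow_der_succ (k : ℕ) (f : Per) : (der ^ (k + 1)) f = der ((der ^ k) f) := by
  rw [pow_succ']; rfl

theorem pow_der_succ' (k : ℕ) (f : Per) : (der ^ (k + 1)) f = (der ^ k) (der f) := by
  rw [pow_succ]; rfl

theorem pow_der_add (j k : ℕ) (f : Per) : (der ^ (j + k)) f = (der ^ j) ((der ^ k) f) := by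
  rw [pow_add]; rfl

@[simp] theorem pow_der_zero (f : Per) : (der ^ 0) f = f := rfl

@[simp] theorem pow_der_one (f : Per) : (der ^ 1) f = der f := by rw [pow_one]

/-- A smooth periodic function as a continuous function on the circle. -/
def toC : Per →ₐ[ℝ] C(Circ, ℝ) where
  toFun f := ⟨f.periodic.lift, continuous_coinduced_dom.mpr f.continuous⟩
  map_one' := by ext x; induction x using QuotientAddGroup.induction_on; rfl
  map_mul' f g := by ext x; induction x using QuotientAddGroup.induction_on; rfl
  map_zero' := by ext x; induction x using QuotientAddGroup.induction_on; rfl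
  map_add' f g := by ext x; induction x using QuotientAddGroup.induction_on; rfl
  commutes' r := by ext x; induction x using QuotientAddGroup.induction_on; rfl

@[simp] theorem toC_coe (f : Per) (x : ℝ) : toC f (x : Circ) = f x := rfl

/-- A smooth periodic function as an element of `L²(𝕋)`. -/
def toL2 : Per →ₗ[ℝ] L2 :=
  (ContinuousMap.toLp (E := ℝ) 2 (volume : Measure Circ) ℝ).toLinearMap ∘ₗ toC.toLinearMap

theorem toL2_eq (f : Per) : toL2 f = ContinuousMap.toLp (E := ℝ) 2 (volume : Measure Circ) ℝ (toC f) :=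
  rfl

theorem coeFn_toL2 (f : Per) : (toL2 f : Circ → ℝ) =ᵐ[volume] toC f :=
  ContinuousMap.coeFn_toLp _ _

/-- The integral over one period. -/
def integ : Per →ₗ[ℝ] ℝ where
  toFun f := ∫ x in (0 : ℝ)..(2 * Real.pi), f x
  map_add' f g := intervalIntegral.integral_add (f.continuous.intervalIntegrable _ _)
    (g.continuous.intervalIntegrable _ _)
  map_smul' _ _ := intervalIntegral.integral_const_mul _ _

theorem integ_eq (f : Per) : integ f = ∫ x in (0 : ℝ)..(2 * Real.pi), f x := rfl

theorem integral_toC (f : Per) : ∫ x, toC f x = integ f := by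
  have := AddCircle.intervalIntegral_preimage (2 * Real.pi) 0 (fun x => toC f x)
  rw [zero_add] at this
  exact this.symm

theorem integ_mono {f g : Per} (h : ∀ x, f x ≤ g x) : integ f ≤ integ g :=
  intervalIntegral.integral_mono (by positivity) (f.continuous.intervalIntegrable _ _)
    (g.continuous.intervalIntegrable _ _) h

theorem integ_nonneg {f : Per} (h : ∀ x, 0 ≤ f x) : 0 ≤ integ f := by
  have := integ_mono (f := 0) (g := f) h
  simpa using this

@[simp] theorem integ_der (f : Per) : integ (der f) = 0 := by
  rw [integ_eq, intervalIntegral.integral_eq_sub_of_hasDerivAt (fun x _ => f.hasDerivAt x)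
    ((der f).continuous.intervalIntegrable _ _)]
  have := f.periodic 0
  rw [zero_add] at this
  rw [this, sub_self]

@[simp] theorem integ_pow_der (k : ℕ) (f : Per) : integ ((der ^ (k + 1)) f) = 0 := by
  rw [pow_der_succ, integ_der]

theorem integ_algebraMap (a : ℝ) : integ (algebraMap ℝ Per a) = 2 * Real.pi * a := by
  simp [integ_eq]

theorem inner_toL2 (f g : Per) : inner ℝ (toL2 f) (toL2 g) = integ (f * g) := by
  rw [toL2_eq, toL2_eq, ContinuousMap.inner_toLp, ← integral_toC]
  simp [mul_comm]

theorem norm_toL2_sq (f : Per) : ‖toL2 f‖ ^ 2 = integ (f * f) := by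
  rw [← inner_toL2, real_inner_self_eq_norm_sq]

/-- Integration by parts. -/
theorem integ_der_mul (f g : Per) : integ (der f * g) = -integ (f * der g) := by
  have := integ_der (f * g)
  rw [der_mul, map_add] at this
  linarith

theorem integ_mul_der (f g : Per) : integ (f * der g) = -integ (der f * g) := by
  rw [integ_der_mul, neg_neg]

theorem integ_mul_pow_der (k : ℕ) (f g : Per) :
    integ (f * (der ^ k) g) = (-1) ^ k * integ ((der ^ k) f * g) := by
  induction k generalizing f with
  | zero => simp
  | succ k ih => rw [pow_der_succ, integ_mul_der, ih, ← pow_der_succ']; ring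

theorem abs_integ_mul_le (f g : Per) : |integ (f * g)| ≤ ‖toL2 f‖ * ‖toL2 g‖ := by
  rw [← inner_toL2]
  exact abs_real_inner_le_norm _ _

theorem integ_mul_le (f g : Per) : integ (f * g) ≤ ‖toL2 f‖ * ‖toL2 g‖ :=
  (le_abs_self _).trans (abs_integ_mul_le f g)

theorem abs_apply_le (f : Per) (x : ℝ) : |f x| ≤ ‖toC f‖ := (toC f).norm_coe_le_norm (x : Circ)

theorem norm_toC_le {f : Per} {A : ℝ} (h : ∀ x, |f x| ≤ A) : ‖toC f‖ ≤ A := by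
  have hA : 0 ≤ A := (abs_nonneg _).trans (h 0)
  rw [ContinuousMap.norm_le _ hA]
  intro x
  induction x using QuotientAddGroup.induction_on with
  | H x => exact h x

theorem exists_abs_eq_norm_toC (f : Per) : ∃ x : ℝ, |f x| = ‖toC f‖ := by
  obtain ⟨x, -, hx⟩ := isCompact_univ.exists_isMaxOn (univ_nonempty (α := Circ))
    (continuous_abs.comp (toC f).continuous).continuousOn
  induction x using QuotientAddGroup.induction_on with
  | H x => exact ⟨x, (abs_apply_le f x).antisymm (norm_toC_le fun y => hx (mem_univ (y : Circ)))⟩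

theorem norm_toL2_mul_le (f g : Per) : ‖toL2 (f * g)‖ ≤ ‖toC f‖ * ‖toL2 g‖ := by
  refine abs_le_of_sq_le_sq' ?_ (by positivity) |>.2
  rw [mul_pow, norm_toL2_sq, norm_toL2_sq, ← smul_eq_mul (‖toC f‖ ^ 2), ← map_smul]
  refine integ_mono fun x => ?_
  simp only [mul_apply, smul_apply]
  have h := abs_apply_le f x
  have : f x ^ 2 ≤ ‖toC f‖ ^ 2 := sq_le_sq' (by linarith [neg_abs_le (f x)]) (by linarith [le_abs_self (f x)])
  nlinarith [mul_self_nonneg (g x)]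

theorem norm_toL2_mul_le' (f g : Per) : ‖toL2 (f * g)‖ ≤ ‖toL2 f‖ * ‖toC g‖ := by
  rw [mul_comm f g, mul_comm (‖toL2 f‖)]
  exact norm_toL2_mul_le g f

theorem norm_toL2_le_toC (f : Per) : ‖toL2 f‖ ^ 2 ≤ 2 * Real.pi * ‖toC f‖ ^ 2 := by
  rw [norm_toL2_sq, ← integ_algebraMap]
  refine integ_mono fun x => ?_
  simp only [mul_apply, algebraMap_apply]
  have h := abs_apply_le f x
  nlinarith [abs_mul_abs_self (f x), abs_nonneg (f x)]

/-! ### Sobolev inequalities -/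

theorem exists_apply_eq_zero {f : Per} (h : integ f = 0) : ∃ x, f x = 0 := by
  by_contra! hne
  have hpos : (∀ x, 0 < f x) ∨ (∀ x, f x < 0) := by
    by_contra! hcon
    obtain ⟨⟨x, hx⟩, ⟨y, hy⟩⟩ := hcon
    obtain ⟨z, hz⟩ := mem_range_of_exists_le_of_exists_ge f.continuous ⟨x, hx⟩ ⟨y, hy⟩
    exact hne z hz
  rcases hpos with hp | hp
  · have : 0 < integ f := intervalIntegral.intervalIntegral_pos_of_pos
      (f.continuous.intervalIntegrable _ _) hp (by positivity)
    linarith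
  · have : 0 < integ (-f) := intervalIntegral.intervalIntegral_pos_of_pos
      ((-f).continuous.intervalIntegrable _ _) (fun x => neg_pos.2 (hp x)) (by positivity)
    rw [map_neg] at this
    linarith

theorem intervalIntegral_le_norm_mul {f g : Per} {x y : ℝ} (hxy : x ≤ y)
    (hy : y ≤ x + 2 * Real.pi) :
    ∫ s in x..y, |f s * g s| ≤ ‖toL2 f‖ * ‖toL2 g‖ := by
  have hc : Continuous fun s => |f s * g s| := (f.continuous.mul g.continuous).abs
  have hper : Function.Periodic (fun s => |f s * g s|) (2 * Real.pi) := fun s => by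
    simp only [f.periodic s, g.periodic s]
  have h1 : ∫ s in x..y, |f s * g s| ≤ ∫ s in x..(x + 2 * Real.pi), |f s * g s| :=
    intervalIntegral.integral_mono_interval le_rfl hxy hy
      (Filter.Eventually.of_forall fun s => abs_nonneg _) (hc.intervalIntegrable _ _)
  have h2 : ∫ s in x..(x + 2 * Real.pi), |f s * g s| = ∫ s in (0:ℝ)..(2 * Real.pi), |f s * g s| := by
    have := hper.intervalIntegral_add_eq x 0
    rwa [zero_add] at this
  rw [h2] at h1
  refine h1.trans ?_
  -- weighted arithmetic–geometric mean inequality under the integral sign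
  have key : ∀ ε : ℝ, 0 < ε → ∫ s in (0:ℝ)..(2 * Real.pi), |f s * g s| ≤
      ε / 2 * ‖toL2 f‖ ^ 2 + 1 / (2 * ε) * ‖toL2 g‖ ^ 2 := by
    intro ε hε
    rw [norm_toL2_sq, norm_toL2_sq, ← smul_eq_mul (ε / 2), ← smul_eq_mul (1 / (2 * ε)), ← map_smul,
      ← map_smul, ← map_add, integ_eq]
    refine intervalIntegral.integral_mono (by positivity) (hc.intervalIntegrable _ _)
      (Per.continuous _ |>.intervalIntegrable _ _) fun s => ?_
    simp only [add_apply, smul_apply, mul_apply]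
    rw [abs_mul, ← abs_mul_abs_self (f s), ← abs_mul_abs_self (g s)]
    have : 0 ≤ (ε * |f s| - |g s|) ^ 2 / (2 * ε) := by positivity
    calc |f s| * |g s| ≤ |f s| * |g s| + (ε * |f s| - |g s|) ^ 2 / (2 * ε) := by linarith
      _ = _ := by field_simp; ring
  set A := ‖toL2 f‖
  set B := ‖toL2 g‖
  set J := ∫ s in (0:ℝ)..(2 * Real.pi), |f s * g s|
  have hA : 0 ≤ A := norm_nonneg _
  have hB : 0 ≤ B := norm_nonneg _
  refine le_of_forall_pos_le_add fun η hη => ?_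
  rcases eq_or_lt_of_le hA with hA0 | hA0
  · have hk := key ((B ^ 2 + 1) / (2 * η)) (by positivity)
    rw [← hA0] at hk ⊢
    refine hk.trans ?_
    have : 1 / (2 * ((B ^ 2 + 1) / (2 * η))) * B ^ 2 = η * (B ^ 2 / (B ^ 2 + 1)) := by field_simp
    rw [this]
    have h3 : B ^ 2 / (B ^ 2 + 1) ≤ 1 := by rw [div_le_one (by positivity)]; linarith
    nlinarith
  · rcases eq_or_lt_of_le hB with hB0 | hB0
    · have hk := key (2 * η / A ^ 2) (by positivity)
      rw [← hB0] at hk ⊢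
      refine hk.trans (le_of_eq ?_)
      field_simp
      ring
    · have hk := key (B / A) (by positivity)
      refine hk.trans (le_of_eq ?_ |>.trans (le_add_of_nonneg_right hη.le))
      field_simp
      ring

/-- Agmon's inequality on the circle. -/
theorem norm_toC_sq_le {f : Per} (h : integ f = 0) :
    ‖toC f‖ ^ 2 ≤ 2 * (‖toL2 f‖ * ‖toL2 (der f)‖) := by
  obtain ⟨x, hx⟩ := exists_apply_eq_zero h
  obtain ⟨y, hy⟩ := exists_abs_eq_norm_toC f
  obtain ⟨z, hz, hzy⟩ := f.periodic.exists_mem_Ico Real.two_pi_pos y x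
  rw [← hy, hzy, sq_abs]
  have h1 : ∫ s in x..z, (2 * (f s * der f s)) = f z ^ 2 - f x ^ 2 := by
    refine intervalIntegral.integral_eq_sub_of_hasDerivAt (f := fun s => f s ^ 2)
      (fun s _ => ?_) ?_
    · exact ((f.hasDerivAt s).pow 2).congr_deriv (by push_cast; ring)
    · exact (continuous_const.mul (f.continuous.mul (der f).continuous)).intervalIntegrable _ _
  rw [hx] at h1
  have h2 : f z ^ 2 = 2 * ∫ s in x..z, f s * der f s := by
    rw [← intervalIntegral.integral_const_mul, h1]; ring
  rw [h2]
  have h3 : ∫ s in x..z, f s * der f s ≤ ∫ s in x..z, |f s * der f s| :=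
    (le_abs_self _).trans (intervalIntegral.abs_integral_le_integral_abs hz.1)
  have := intervalIntegral_le_norm_mul (f := f) (g := der f) hz.1 hz.2.le
  linarith

/-- Poincaré's inequality. -/
theorem norm_toL2_le_der {f : Per} (h : integ f = 0) :
    ‖toL2 f‖ ≤ 4 * Real.pi * ‖toL2 (der f)‖ := by
  have h1 := norm_toC_sq_le h
  have h2 := norm_toL2_le_toC f
  have hA : 0 ≤ ‖toL2 f‖ := norm_nonneg _
  rcases eq_or_lt_of_le hA with h0 | h0
  · rw [← h0]; positivity
  · have h3 : ‖toL2 f‖ * ‖toL2 f‖ ≤ ‖toL2 f‖ * (4 * Real.pi * ‖toL2 (der f)‖) := by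
      nlinarith [Real.pi_pos]
    exact le_of_mul_le_mul_left h3 h0

theorem norm_toC_le_der {f : Per} (h : integ f = 0) :
    ‖toC f‖ ≤ 4 * Real.pi * ‖toL2 (der f)‖ := by
  have h1 := norm_toC_sq_le h
  have h2 := norm_toL2_le_der h
  refine abs_le_of_sq_le_sq' ?_ (by positivity) |>.2
  have hA : 0 ≤ ‖toL2 (der f)‖ := norm_nonneg _
  have := Real.pi_gt_three
  nlinarith [mul_le_mul_of_nonneg_right h2 hA, mul_nonneg hA hA]

theorem norm_toL2_pow_der_le {f : Per} (h : integ f = 0) {j k : ℕ} (hjk : j ≤ k) :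
    ‖toL2 ((der ^ j) f)‖ ≤ (4 * Real.pi) ^ (k - j) * ‖toL2 ((der ^ k) f)‖ := by
  induction k, hjk using Nat.le_induction with
  | base => simp
  | succ k hk ih =>
    have h0 : integ ((der ^ k) f) = 0 := by
      cases k with
      | zero => simpa using h
      | succ k => simp
    have := norm_toL2_le_der h0
    rw [← pow_der_succ] at this
    rw [Nat.succ_sub hk, pow_succ, mul_assoc]
    exact ih.trans (mul_le_mul_of_nonneg_left this (by positivity))

theorem norm_toC_pow_der_le {f : Per} (h : integ f = 0) {j k : ℕ} (hjk : j + 1 ≤ k) :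
    ‖toC ((der ^ j) f)‖ ≤ (4 * Real.pi) ^ (k - j) * ‖toL2 ((der ^ k) f)‖ := by
  have h0 : integ ((der ^ j) f) = 0 := by
    cases j with
    | zero => simpa using h
    | succ k => simp
  have h1 := norm_toC_le_der h0
  have h2 := norm_toL2_pow_der_le h hjk
  rw [← pow_der_succ] at h1
  refine h1.trans ((mul_le_mul_of_nonneg_left h2 (by positivity)).trans (le_of_eq ?_))
  rw [show k - j = (k - (j + 1)) + 1 by omega, pow_succ]; ring

/-- Interpolation between consecutive Sobolev norms. -/
theorem norm_toL2_der_sq_le (f : Per) :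
    ‖toL2 (der f)‖ ^ 2 ≤ ‖toL2 f‖ * ‖toL2 (der (der f))‖ := by
  rw [norm_toL2_sq, integ_der_mul]
  exact (neg_le_abs _).trans (abs_integ_mul_le _ _)

theorem integ_pow_der_eq_zero {f : Per} (h : integ f = 0) (j : ℕ) : integ ((der ^ j) f) = 0 := by
  cases j with
  | zero => simpa using h
  | succ k => simp

/-! ### Product estimates -/

theorem norm_toC_pow_der_mul_le {n : ℕ} {f g : Per} {A B : ℝ}
    (hf : ∀ j ≤ n, ‖toC ((der ^ j) f)‖ ≤ A) (hg : ∀ j ≤ n, ‖toC ((der ^ j) g)‖ ≤ B) :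
    ‖toC ((der ^ n) (f * g))‖ ≤ 2 ^ n * (A * B) := by
  have hA : 0 ≤ A := (norm_nonneg _).trans (hf 0 (Nat.zero_le _))
  induction n generalizing f g with
  | zero =>
    have h1 := hf 0 le_rfl
    have h2 := hg 0 le_rfl
    rw [pow_der_zero] at h1 h2
    rw [pow_der_zero, map_mul, pow_zero, one_mul]
    exact (norm_mul_le _ _).trans (mul_le_mul h1 h2 (norm_nonneg _) hA)
  | succ n ih =>
    rw [pow_der_succ', der_mul, map_add, map_add]
    have h1 := ih (f := der f) (g := g)
      (fun j hj => by rw [← pow_der_succ']; exact hf _ (by omega)) (fun j hj => hg j (by omega))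
    have h2 := ih (f := f) (g := der g) (fun j hj => hf j (by omega))
      (fun j hj => by rw [← pow_der_succ']; exact hg _ (by omega))
    refine (norm_add_le _ _).trans ((add_le_add h1 h2).trans (le_of_eq ?_))
    rw [pow_succ]; ring

theorem norm_toL2_pow_der_mul_le {n : ℕ} {f g : Per} {A B : ℝ}
    (hf : ∀ j ≤ n, ‖toL2 ((der ^ j) f)‖ ≤ A) (hg : ∀ j ≤ n, ‖toC ((der ^ j) g)‖ ≤ B) :
    ‖toL2 ((der ^ n) (f * g))‖ ≤ 2 ^ n * (A * B) := by
  have hA : 0 ≤ A := (norm_nonneg _).trans (hf 0 (Nat.zero_le _))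
  induction n generalizing f g with
  | zero =>
    have h1 := hf 0 le_rfl
    have h2 := hg 0 le_rfl
    rw [pow_der_zero] at h1 h2
    rw [pow_der_zero, pow_zero, one_mul]
    exact (norm_toL2_mul_le' _ _).trans (mul_le_mul h1 h2 (norm_nonneg _) hA)
  | succ n ih =>
    rw [pow_der_succ', der_mul, map_add, map_add]
    have h1 := ih (f := der f) (g := g)
      (fun j hj => by rw [← pow_der_succ']; exact hf _ (by omega)) (fun j hj => hg j (by omega))
    have h2 := ih (f := f) (g := der g) (fun j hj => hf j (by omega))
      (fun j hj => by rw [← pow_der_succ']; exact hg _ (by omega))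
    refine (norm_add_le _ _).trans ((add_le_add h1 h2).trans (le_of_eq ?_))
    rw [pow_succ]; ring

/-- The commutator of `∂ⁿ` with multiplication by `f` costs one derivative less on `g`. -/
theorem norm_toL2_commutator_le {n : ℕ} {f g : Per} {A B : ℝ} (hA : 0 ≤ A)
    (hf : ∀ j < n, ‖toL2 ((der ^ (j + 1)) f)‖ ≤ A) (hg : ∀ j < n, ‖toC ((der ^ j) g)‖ ≤ B)
    (hB : 0 ≤ B) :
    ‖toL2 ((der ^ n) (f * g) - f * (der ^ n) g)‖ ≤ 2 ^ n * (A * B) := by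
  induction n generalizing g with
  | zero => simp; positivity
  | succ n ih =>
    have h1 := norm_toL2_pow_der_mul_le (n := n) (f := der f) (g := g) (A := A) (B := B)
      (fun j hj => by rw [← pow_der_succ']; exact hf j (by omega)) (fun j hj => hg j (by omega))
    have h2 := ih (g := der g) (fun j hj => hf j (by omega))
      (fun j hj => by rw [← pow_der_succ']; exact hg _ (by omega))
    rw [pow_der_succ', der_mul, map_add, pow_der_succ', add_sub_assoc, map_add]
    refine (norm_add_le _ _).trans ((add_le_add h1 h2).trans (le_of_eq ?_))
    rw [pow_succ]; ring

/-- `f` is bounded by `A` in `Hⁿ`, and so are its derivatives of order below `n` uniformly. -/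
def SobolevBound (n : ℕ) (f : Per) (A : ℝ) : Prop :=
  (∀ j ≤ n, ‖toL2 ((der ^ j) f)‖ ≤ A) ∧ ∀ j < n, ‖toC ((der ^ j) f)‖ ≤ A

theorem SobolevBound.nonneg {n : ℕ} {f : Per} {A : ℝ} (h : SobolevBound n f A) : 0 ≤ A :=
  (norm_nonneg _).trans (h.1 0 (Nat.zero_le _))

theorem SobolevBound.add {n : ℕ} {f g : Per} {A B : ℝ} (hf : SobolevBound n f A)
    (hg : SobolevBound n g B) : SobolevBound n (f + g) (A + B) := by
  refine ⟨fun j hj => ?_, fun j hj => ?_⟩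
  · rw [map_add, map_add]
    exact (norm_add_le _ _).trans (add_le_add (hf.1 j hj) (hg.1 j hj))
  · rw [map_add, map_add]
    exact (norm_add_le _ _).trans (add_le_add (hf.2 j hj) (hg.2 j hj))

/-- The Sobolev algebra property. -/
theorem SobolevBound.mul {n : ℕ} {f g : Per} {A B : ℝ} (hn : 0 < n) (hf : SobolevBound n f A)
    (hg : SobolevBound n g B) : SobolevBound n (f * g) (2 ^ n * (A * B)) := by
  have hA := hf.nonneg
  have hB := hg.nonneg
  have hmono : ∀ j ≤ n, (2 : ℝ) ^ j * (A * B) ≤ 2 ^ n * (A * B) := fun j hj =>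
    mul_le_mul_of_nonneg_right (pow_le_pow_right₀ (by norm_num) hj) (by positivity)
  refine ⟨fun j hj => ?_, fun j hj => ?_⟩
  · cases j with
    | zero =>
      refine le_trans ?_ (hmono 0 hj)
      have h1 := hf.1 0 (Nat.zero_le _)
      have h2 := hg.2 0 hn
      rw [pow_der_zero] at h1 h2 ⊢
      rw [pow_zero, one_mul]
      exact (norm_toL2_mul_le' _ _).trans (mul_le_mul h1 h2 (norm_nonneg _) hA)
    | succ j =>
      refine le_trans ?_ (hmono _ hj)
      rw [pow_der_succ', der_mul, map_add, map_add, mul_comm f (der g)]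
      have h1 := norm_toL2_pow_der_mul_le (n := j) (f := der f) (g := g) (A := A) (B := B)
        (fun i hi => by rw [← pow_der_succ']; exact hf.1 _ (by omega))
        (fun i hi => hg.2 i (by omega))
      have h2 := norm_toL2_pow_der_mul_le (n := j) (f := der g) (g := f) (A := B) (B := A)
        (fun i hi => by rw [← pow_der_succ']; exact hg.1 _ (by omega))
        (fun i hi => hf.2 i (by omega))
      refine (norm_add_le _ _).trans ((add_le_add h1 h2).trans (le_of_eq ?_))
      rw [pow_succ]; ring
  · exact (norm_toC_pow_der_mul_le (fun i hi => hf.2 i (by omega))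
      (fun i hi => hg.2 i (by omega))).trans (hmono j hj.le)

theorem sobolevBound_algebraMap (n : ℕ) (c : ℝ) :
    SobolevBound n (algebraMap ℝ Per c) (2 * Real.pi * |c|) := by
  have hpi := Real.pi_gt_three
  have hC : ‖toC (algebraMap ℝ Per c)‖ ≤ |c| := norm_toC_le fun x => le_rfl
  have hL : ‖toL2 (algebraMap ℝ Per c)‖ ≤ 2 * Real.pi * |c| := by
    refine abs_le_of_sq_le_sq' ?_ (by positivity) |>.2
    have h2 : ‖toC (algebraMap ℝ Per c)‖ ^ 2 ≤ |c| ^ 2 := by gcongr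
    refine (norm_toL2_le_toC _).trans ((mul_le_mul_of_nonneg_left h2 (by positivity)).trans ?_)
    nlinarith [sq_nonneg |c|, mul_nonneg (sq_nonneg |c|) Real.pi_pos.le]
  refine ⟨fun j _ => ?_, fun j _ => ?_⟩
  · cases j with
    | zero => exact hL
    | succ j => rw [pow_der_succ', der_algebraMap]; simp; positivity
  · cases j with
    | zero => exact hC.trans (by nlinarith [abs_nonneg c])
    | succ j => rw [pow_der_succ', der_algebraMap]; simp; positivity

theorem one_le_four_pi : 1 ≤ 4 * Real.pi := by linarith [Real.pi_gt_three]

theorem norm_toL2_pow_der_le_uniform {f : Per} (h : integ f = 0) {j k n : ℕ} (hjk : j ≤ k)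
    (hn : k ≤ n) : ‖toL2 ((der ^ j) f)‖ ≤ (4 * Real.pi) ^ n * ‖toL2 ((der ^ k) f)‖ :=
  (norm_toL2_pow_der_le h hjk).trans (mul_le_mul_of_nonneg_right
    (pow_le_pow_right₀ one_le_four_pi (by omega)) (norm_nonneg _))

theorem norm_toC_pow_der_le_uniform {f : Per} (h : integ f = 0) {j k n : ℕ} (hjk : j + 1 ≤ k)
    (hn : k ≤ n) : ‖toC ((der ^ j) f)‖ ≤ (4 * Real.pi) ^ n * ‖toL2 ((der ^ k) f)‖ :=
  (norm_toC_pow_der_le h hjk).trans (mul_le_mul_of_nonneg_right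
    (pow_le_pow_right₀ one_le_four_pi (by omega)) (norm_nonneg _))

theorem sobolevBound_of_top {n : ℕ} {f : Per} (h : integ f = 0) {M : ℝ}
    (hM : ‖toL2 ((der ^ n) f)‖ ≤ M) : SobolevBound n f ((4 * Real.pi) ^ n * M) :=
  ⟨fun _ hj => (norm_toL2_pow_der_le_uniform h hj le_rfl).trans
      (mul_le_mul_of_nonneg_left hM (by positivity)),
    fun _ hj => (norm_toC_pow_der_le_uniform h hj le_rfl).trans
      (mul_le_mul_of_nonneg_left hM (by positivity))⟩

/-! ### The thin-film vector field on smooth functions -/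

/-- The film height `h = c + p`. -/
def height (c : ℝ) (p : Per) : Per := algebraMap ℝ Per c + p

@[simp] theorem height_apply (c : ℝ) (p : Per) (x : ℝ) : height c p x = c + p x := rfl

@[simp] theorem der_height (c : ℝ) (p : Per) : der (height c p) = der p := by
  simp [height]

/-- `∂p + ∂³p`. -/
def press : Per →ₗ[ℝ] Per := der + der ^ 3

theorem press_eq (p : Per) : press p = der p + (der ^ 3) p := rfl

theorem pow_der_press (k : ℕ) (p : Per) :
    (der ^ k) (press p) = (der ^ (k + 1)) p + (der ^ (k + 3)) p := by
  rw [press_eq, map_add, ← pow_der_succ', ← pow_der_add]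

/-- The total flux `θ p²/2 + h³ (∂p + ∂³p)`; `θ = 1` corresponds to the nonlinearity `R` and
`θ = 0` to `R̄`. -/
def totalFlux (c θ : ℝ) (p : Per) : Per := (θ / 2) • (p * p) + height c p ^ 3 * press p

/-- The right-hand side `-∂ (θ p²/2 + h³ (∂p + ∂³p))` of the evolution equation. -/
def vf (c θ : ℝ) (p : Per) : Per := -der (totalFlux c θ p)

@[simp] theorem integ_vf (c θ : ℝ) (p : Per) : integ (vf c θ p) = 0 := by simp [vf]

theorem norm_toC_height_le {c : ℝ} {p : Per} {A : ℝ} (h : ‖toC p‖ ≤ A) :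
    ‖toC (height c p)‖ ≤ |c| + A := by
  rw [height, map_add]
  exact (norm_add_le _ _).trans (add_le_add (norm_toC_le fun x => le_rfl) h)

theorem norm_toC_mul_le {f g : Per} {A B : ℝ} (hf : ‖toC f‖ ≤ A) (hg : ‖toC g‖ ≤ B) :
    ‖toC (f * g)‖ ≤ A * B := by
  rw [map_mul]
  exact (norm_mul_le _ _).trans
    (mul_le_mul hf hg (norm_nonneg _) ((norm_nonneg _).trans hf))

theorem norm_toC_pow_le {f : Per} {A : ℝ} (hf : ‖toC f‖ ≤ A) (n : ℕ) :
    ‖toC (f ^ n)‖ ≤ A ^ n := by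
  rw [map_pow]
  exact (norm_pow_le _ n).trans (pow_le_pow_left₀ (norm_nonneg _) hf n)

/-! ### Coercivity -/

theorem integ_coercive {a q : Per} {α : ℝ} (ha : ∀ x, α ≤ a x) :
    α * ‖toL2 q‖ ^ 2 ≤ integ (q * (a * q)) := by
  rw [norm_toL2_sq, ← smul_eq_mul, ← map_smul]
  refine integ_mono fun x => ?_
  simp only [smul_apply, mul_apply]
  nlinarith [ha x, mul_self_nonneg (q x)]

theorem integ_mul_mul_le (f a g : Per) :
    |integ (f * (a * g))| ≤ ‖toL2 f‖ * (‖toC a‖ * ‖toL2 g‖) :=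
  (abs_integ_mul_le _ _).trans
    (mul_le_mul_of_nonneg_left (norm_toL2_mul_le _ _) (norm_nonneg _))

theorem le_height_cube {c m : ℝ} (hm : 0 < m) {p : Per} (h : ∀ x, m ≤ c + p x) (x : ℝ) :
    m ^ 3 ≤ (height c p ^ 3) x :=
  pow_le_pow_left₀ hm.le (h x) 3

/-- Absorption of the lower-order terms by the dissipation. -/
theorem absorb {α c₁ c₂ K X Y W s : ℝ} (hα : 0 < α)
    (hW : W ^ 2 ≤ X * Y) (hs : s ^ 2 = K * (W * X)) :
    X * (c₁ * Y + c₂ * s) ≤ α / 2 * X ^ 2 +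
      (2 * c₁ ^ 2 / α + 2 * (2 * (2 * c₂ ^ 2 / α * K) ^ 2 / α) ^ 2 / α) * Y ^ 2 := by
  have young : ∀ κ a b : ℝ, κ * (a * b) ≤ α / 8 * a ^ 2 + 2 * κ ^ 2 / α * b ^ 2 := by
    intro κ a b
    have : 0 ≤ (α * a - 4 * κ * b) ^ 2 / (8 * α) := by positivity
    have e : (α * a - 4 * κ * b) ^ 2 / (8 * α)
        = α / 8 * a ^ 2 + 2 * κ ^ 2 / α * b ^ 2 - κ * (a * b) := by field_simp; ring
    linarith
  have h1 := young c₁ X Y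
  have h2 := young c₂ X s
  have h3 := young (2 * c₂ ^ 2 / α * K) X W
  have h4 := young (2 * (2 * c₂ ^ 2 / α * K) ^ 2 / α) X Y
  have h5 : 2 * (2 * c₂ ^ 2 / α * K) ^ 2 / α * W ^ 2 ≤
      2 * (2 * c₂ ^ 2 / α * K) ^ 2 / α * (X * Y) :=
    mul_le_mul_of_nonneg_left hW (by positivity)
  have h6 : 2 * c₂ ^ 2 / α * s ^ 2 = 2 * c₂ ^ 2 / α * K * (X * W) := by rw [hs]; ring
  rw [add_mul]
  linarith

/-- Writing the top-order energy production as a pairing of `∂^{l+4} p` with `∂^{l+1}` of the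
flux. -/
theorem integ_pow_der_mul_vf (c θ : ℝ) (l : ℕ) (p : Per) :
    (-1) ^ (l + 2) * integ ((der ^ (2 * (l + 2))) p * vf c θ p) =
      -integ ((der ^ (l + 4)) p * (der ^ (l + 1)) (totalFlux c θ p)) := by
  have h1 := integ_mul_pow_der (l + 1) ((der ^ (l + 4)) p) (totalFlux c θ p)
  rw [← pow_der_add] at h1
  have h2 := integ_mul_der ((der ^ (2 * (l + 2))) p) (totalFlux c θ p)
  rw [← pow_der_succ] at h2
  rw [h1, vf, mul_neg, map_neg, h2, show l + 1 + (l + 4) = 2 * (l + 2) + 1 by ring]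
  ring

/-- The energy inequality at the level of `Hᵏ`, `k = l + 2`: given a lower bound on the height and
a bound in `Hᵏ⁻¹`, the dissipation `‖∂ᵏ⁺²p‖²` absorbs all other terms up to `‖∂ᵏp‖²`. Every
commutator term is bounded through `sup |∂ⁱ(∂p + ∂³p)|`, `i ≤ k - 2`, which interpolates strictly
below the dissipation. -/
theorem exists_energy_bound (c θ m M : ℝ) (hm : 0 < m) (l : ℕ) :
    ∃ C : ℝ, 0 ≤ C ∧ ∀ p : Per, integ p = 0 → (∀ x, m ≤ c + p x) →
      ‖toL2 ((der ^ (l + 1)) p)‖ ≤ M →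
      (-1) ^ (l + 2) * integ ((der ^ (2 * (l + 2))) p * vf c θ p) ≤
        -(m ^ 3 / 2) * ‖toL2 ((der ^ (l + 4)) p)‖ ^ 2 + C * ‖toL2 ((der ^ (l + 2)) p)‖ ^ 2 := by
  set Q : ℝ := (4 * Real.pi) ^ (l + 4) with hQ
  have hQ0 : 0 < Q := by positivity
  -- bounds for `p`, the height and its cube in `H^{l+1}`
  set A₁ : ℝ := (4 * Real.pi) ^ (l + 1) * M with hA₁
  set A₂ : ℝ := 2 * Real.pi * |c| + A₁ with hA₂
  set A₃ : ℝ := 2 ^ (l + 1) * ((2 ^ (l + 1) * (A₂ * A₂)) * A₂) with hA₃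
  set c₁ : ℝ := |θ / 2| * (2 ^ (l + 1) * (A₁ * Q)) + A₃ with hc₁
  set c₂ : ℝ := 2 ^ (l + 1) * A₃ with hc₂
  refine ⟨2 * c₁ ^ 2 / m ^ 3 +
    2 * (2 * (2 * c₂ ^ 2 / m ^ 3 * (8 * Q ^ 2)) ^ 2 / m ^ 3) ^ 2 / m ^ 3, by positivity, ?_⟩
  intro p hp hpos hM
  set X := ‖toL2 ((der ^ (l + 4)) p)‖ with hX
  set W := ‖toL2 ((der ^ (l + 3)) p)‖ with hW
  set Y := ‖toL2 ((der ^ (l + 2)) p)‖ with hY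
  have hX0 : 0 ≤ X := norm_nonneg _
  have hW0 : 0 ≤ W := norm_nonneg _
  have hY0 : 0 ≤ Y := norm_nonneg _
  have hWXY : W ^ 2 ≤ X * Y := by
    have := norm_toL2_der_sq_le ((der ^ (l + 2)) p)
    rw [← pow_der_succ, ← pow_der_succ] at this
    linarith [mul_comm X Y]
  have hbp : SobolevBound (l + 1) p A₁ := sobolevBound_of_top hp hM
  have hbh : SobolevBound (l + 1) (height c p) A₂ := (sobolevBound_algebraMap _ c).add hbp
  have hba : SobolevBound (l + 1) (height c p ^ 3) A₃ := by
    rw [pow_succ, sq]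
    exact (hbh.mul (by omega) hbh).mul (by omega) hbh
  have hA₃0 : 0 ≤ A₃ := hba.nonneg
  have hA₁0 : 0 ≤ A₁ := hbp.nonneg
  set a := height c p ^ 3 with ha
  -- the capillary term
  set s := Real.sqrt (8 * Q ^ 2 * (W * X)) with hs
  have hs2 : s ^ 2 = 8 * Q ^ 2 * (W * X) := Real.sq_sqrt (by positivity)
  have hs0 : 0 ≤ s := Real.sqrt_nonneg _
  have hsup : ∀ j ≤ l + 3, ‖toC ((der ^ j) p)‖ ≤ s / 2 := by
    intro j hj
    refine abs_le_of_sq_le_sq' ?_ (by positivity) |>.2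
    have h1 := norm_toC_sq_le (integ_pow_der_eq_zero hp j)
    rw [← pow_der_succ] at h1
    have h2 : ‖toL2 ((der ^ j) p)‖ ≤ Q * W := norm_toL2_pow_der_le_uniform hp hj (by omega)
    have h3 : ‖toL2 ((der ^ (j + 1)) p)‖ ≤ Q * X :=
      norm_toL2_pow_der_le_uniform hp (by omega) le_rfl
    have h4 := mul_le_mul h2 h3 (norm_nonneg _) (by positivity)
    rw [div_pow, hs2]
    linarith
  have hb : ∀ j < l + 1, ‖toC ((der ^ j) (press p))‖ ≤ s := by
    intro j hj
    rw [pow_der_press, map_add]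
    refine (norm_add_le _ _).trans ?_
    linarith [hsup (j + 1) (by omega), hsup (j + 3) (by omega)]
  have hcomm := norm_toL2_commutator_le (n := l + 1) (f := a) (g := press p) hA₃0
    (fun j hj => hba.1 (j + 1) (by omega)) hb hs0
  -- the quadratic term
  have hquad : ‖toL2 ((der ^ (l + 1)) (p * p))‖ ≤ 2 ^ (l + 1) * (A₁ * (Q * Y)) :=
    norm_toL2_pow_der_mul_le (fun j hj => hbp.1 j hj)
      (fun j hj => norm_toC_pow_der_le_uniform hp (by omega) (by omega))
  have hdec : (der ^ (l + 1)) (totalFlux c θ p) = (θ / 2) • (der ^ (l + 1)) (p * p) +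
      (a * (der ^ (l + 2)) p + (a * (der ^ (l + 4)) p +
        ((der ^ (l + 1)) (a * press p) - a * (der ^ (l + 1)) (press p)))) := by
    rw [totalFlux, map_add, map_smul, pow_der_press]
    ring
  rw [integ_pow_der_mul_vf, hdec, mul_add, mul_add, mul_add, map_add, map_add, map_add]
  have t1 := neg_le_abs (integ ((der ^ (l + 4)) p * ((θ / 2) • (der ^ (l + 1)) (p * p))))
  have t1' := (abs_integ_mul_le ((der ^ (l + 4)) p) ((θ / 2) • (der ^ (l + 1)) (p * p)))
  rw [map_smul, norm_smul, Real.norm_eq_abs, ← hX] at t1'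
  have t1'' : X * (|θ / 2| * ‖toL2 ((der ^ (l + 1)) (p * p))‖) ≤
      X * (|θ / 2| * (2 ^ (l + 1) * (A₁ * (Q * Y)))) := by gcongr
  have t2 := neg_le_abs (integ ((der ^ (l + 4)) p * (a * (der ^ (l + 2)) p)))
  have t2' := integ_mul_mul_le ((der ^ (l + 4)) p) a ((der ^ (l + 2)) p)
  have t2'' : X * (‖toC a‖ * Y) ≤ X * (A₃ * Y) := by
    have := hba.2 0 (by omega)
    rw [pow_der_zero] at this
    gcongr
  have t3 := integ_coercive (a := a) (q := (der ^ (l + 4)) p) (le_height_cube hm hpos)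
  have t4 := neg_le_abs (integ ((der ^ (l + 4)) p *
    ((der ^ (l + 1)) (a * press p) - a * (der ^ (l + 1)) (press p))))
  have t4' := abs_integ_mul_le ((der ^ (l + 4)) p)
    ((der ^ (l + 1)) (a * press p) - a * (der ^ (l + 1)) (press p))
  have t4'' := mul_le_mul_of_nonneg_left hcomm hX0
  have habs := absorb (c₁ := c₁) (c₂ := c₂) (pow_pos hm 3) hWXY hs2
  have e1 : X * (c₁ * Y + c₂ * s) = X * (|θ / 2| * (2 ^ (l + 1) * (A₁ * (Q * Y)))) +
      X * (A₃ * Y) + X * (2 ^ (l + 1) * (A₃ * s)) := by rw [hc₁, hc₂]; ring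
  linarith

/-! ### Differences of solutions, and the first-order energy -/

theorem der_height_cube (c : ℝ) (p : Per) :
    der (height c p ^ 3) = (3 : ℝ) • (height c p * height c p * der p) := by
  rw [pow_succ, sq, der_mul, der_mul, der_height, Algebra.smul_def, map_ofNat]
  ring

theorem norm_toC_der_height_cube_le {c : ℝ} {p : Per} {A B : ℝ} (h : ‖toC p‖ ≤ A)
    (h' : ‖toC (der p)‖ ≤ B) : ‖toC (der (height c p ^ 3))‖ ≤ 3 * ((|c| + A) * (|c| + A) * B) := by
  rw [der_height_cube, map_smul, norm_smul, Real.norm_eq_abs, abs_of_pos (by norm_num : (0:ℝ) < 3)]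
  have h1 := norm_toC_height_le (c := c) h
  exact mul_le_mul_of_nonneg_left (norm_toC_mul_le (norm_toC_mul_le h1 h1) h') (by norm_num)

theorem exists_norm_vf_le (c θ M : ℝ) :
    ∃ C : ℝ, 0 ≤ C ∧ ∀ p : Per, integ p = 0 → ‖toL2 ((der ^ 4) p)‖ ≤ M →
      ‖toL2 (vf c θ p)‖ ≤ C := by
  set K : ℝ := (4 * Real.pi) ^ 4 * |M| with hK
  have hK0 : 0 ≤ K := by positivity
  refine ⟨|θ / 2| * (K * K + K * K) +
    (3 * ((|c| + K) * (|c| + K) * K) * (K + K) + (|c| + K) ^ 3 * (K + K)), by positivity, ?_⟩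
  intro p hp hM
  have hM' : ‖toL2 ((der ^ 4) p)‖ ≤ |M| := hM.trans (le_abs_self M)
  obtain ⟨hL, hS⟩ := sobolevBound_of_top hp hM'
  rw [← hK] at hL hS
  have e : vf c θ p = -((θ / 2) • (der p * p + p * der p) +
      (der (height c p ^ 3) * press p + height c p ^ 3 * der (press p))) := by
    rw [vf, totalFlux, map_add, map_smul, der_mul, der_mul]
  have hS0 : ‖toC p‖ ≤ K := hS 0 (by norm_num)
  have hS1 : ‖toC (der p)‖ ≤ K := by simpa using hS 1 (by norm_num)
  have hL0 : ‖toL2 p‖ ≤ K := hL 0 (by norm_num)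
  have hL1 : ‖toL2 (der p)‖ ≤ K := by simpa using hL 1 (by norm_num)
  have hb : ‖toL2 (press p)‖ ≤ K + K := by
    rw [press_eq, map_add]
    exact (norm_add_le _ _).trans (add_le_add hL1 (hL 3 (by norm_num)))
  have hb' : ‖toL2 (der (press p))‖ ≤ K + K := by
    have := pow_der_press 1 p
    rw [pow_der_one] at this
    rw [this, map_add]
    exact (norm_add_le _ _).trans (add_le_add (hL 2 (by norm_num)) (hL 4 (by norm_num)))
  rw [e, map_neg, norm_neg, map_add, map_smul, map_add, map_add]
  refine (norm_add_le _ _).trans (add_le_add ?_ ((norm_add_le _ _).trans (add_le_add ?_ ?_)))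
  · rw [norm_smul, Real.norm_eq_abs]
    refine mul_le_mul_of_nonneg_left ((norm_add_le _ _).trans (add_le_add ?_ ?_)) (abs_nonneg _)
    · exact (norm_toL2_mul_le' _ _).trans (mul_le_mul hL1 hS0 (norm_nonneg _) hK0)
    · exact (norm_toL2_mul_le' _ _).trans (mul_le_mul hL0 hS1 (norm_nonneg _) hK0)
  · exact (norm_toL2_mul_le _ _).trans (mul_le_mul (norm_toC_der_height_cube_le hS0 hS1) hb
      (norm_nonneg _) (by positivity))
  · exact (norm_toL2_mul_le _ _).trans (mul_le_mul
      (norm_toC_pow_le (norm_toC_height_le hS0) 3) hb' (norm_nonneg _) (by positivity))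

theorem absorb_difference {α k₁ k₂ k₃ Z₀ Z₁ Z₂ : ℝ} (hα : 0 < α) (hk₁ : 0 ≤ k₁) (hk₂ : 0 ≤ k₂)
    (hZ : Z₁ ^ 2 ≤ Z₀ * Z₂) :
    k₁ * (Z₁ * Z₀) + k₂ * Z₁ ^ 2 + k₃ * (Z₁ * Z₂) ≤ α * Z₂ ^ 2 +
      (k₁ / 2 + (k₁ / 2 + k₂ + k₃ ^ 2 / (2 * α)) ^ 2 / (2 * α)) * Z₀ ^ 2 := by
  have young : ∀ κ a b : ℝ, κ * (a * b) ≤ α / 2 * b ^ 2 + κ ^ 2 / (2 * α) * a ^ 2 := by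
    intro κ a b
    have : 0 ≤ (α * b - κ * a) ^ 2 / (2 * α) := by positivity
    have e : (α * b - κ * a) ^ 2 / (2 * α)
        = α / 2 * b ^ 2 + κ ^ 2 / (2 * α) * a ^ 2 - κ * (a * b) := by field_simp; ring
    linarith
  have h1 := young k₃ Z₁ Z₂
  set κ := k₁ / 2 + k₂ + k₃ ^ 2 / (2 * α) with hκ
  have hκ0 : 0 ≤ κ := by positivity
  have h2 := young κ Z₀ Z₂
  have h3 : k₁ * (Z₁ * Z₀) ≤ k₁ / 2 * Z₁ ^ 2 + k₁ / 2 * Z₀ ^ 2 := by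
    nlinarith [mul_nonneg hk₁ (sq_nonneg (Z₁ - Z₀))]
  have h4 := mul_le_mul_of_nonneg_left hZ hκ0
  have h5 : κ * Z₁ ^ 2 = k₁ / 2 * Z₁ ^ 2 + k₂ * Z₁ ^ 2 + k₃ ^ 2 / (2 * α) * Z₁ ^ 2 := by
    rw [hκ]; ring
  rw [add_mul]
  linarith

/-- The flux increment `G(u) - G(v)` tested against `∂(u - v)` is bounded by `‖u - v‖²`, for
`u` of positive height and `u, v` bounded in `H⁴`. -/
theorem exists_difference_bound (c θ m M : ℝ) (hm : 0 < m) :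
    ∃ C : ℝ, 0 ≤ C ∧ ∀ u v : Per, integ u = 0 → integ v = 0 → (∀ x, m ≤ c + u x) →
      ‖toL2 ((der ^ 4) u)‖ ≤ M → ‖toL2 ((der ^ 4) v)‖ ≤ M →
      integ (der (u - v) * (totalFlux c θ u - totalFlux c θ v)) ≤ C * ‖toL2 (u - v)‖ ^ 2 := by
  set K : ℝ := (4 * Real.pi) ^ 4 * |M| with hK
  have hK0 : 0 ≤ K := by positivity
  set H : ℝ := |c| + K with hH
  have hH0 : 0 ≤ H := by positivity
  set k₁ : ℝ := |θ / 2| * (K + K) + (H * H + H * H + H * H) * (K + K) with hk₁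
  refine ⟨k₁ / 2 + (k₁ / 2 + H ^ 3 + (3 * (H * H * K)) ^ 2 / (2 * m ^ 3)) ^ 2 / (2 * m ^ 3),
    by positivity, ?_⟩
  intro u v hu hv hpos hMu hMv
  obtain ⟨-, hSu⟩ := sobolevBound_of_top hu (hMu.trans (le_abs_self M))
  obtain ⟨-, hSv⟩ := sobolevBound_of_top hv (hMv.trans (le_abs_self M))
  rw [← hK] at hSu hSv
  have hu0 : ‖toC u‖ ≤ K := hSu 0 (by norm_num)
  have hu1 : ‖toC (der u)‖ ≤ K := by simpa using hSu 1 (by norm_num)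
  have hv0 : ‖toC v‖ ≤ K := hSv 0 (by norm_num)
  have hbv : ‖toC (press v)‖ ≤ K + K := by
    rw [press_eq, map_add]
    refine (norm_add_le _ _).trans (add_le_add ?_ (hSv 3 (by norm_num)))
    simpa using hSv 1 (by norm_num)
  have hhu := norm_toC_height_le (c := c) hu0
  have hhv := norm_toC_height_le (c := c) hv0
  rw [← hH] at hhu hhv
  set z := u - v with hz
  set a := height c u ^ 3 with ha
  set q := height c u * height c u + height c u * height c v + height c v * height c v with hq
  have hqs : ‖toC q‖ ≤ H * H + H * H + H * H := by
    rw [hq, map_add, map_add]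
    exact (norm_add_le _ _).trans (add_le_add ((norm_add_le _ _).trans (add_le_add
      (norm_toC_mul_le hhu hhu) (norm_toC_mul_le hhu hhv))) (norm_toC_mul_le hhv hhv))
  have hdec : totalFlux c θ u - totalFlux c θ v = ((θ / 2) • (u + v)) * z +
      (a * der z + (a * der (der (der z)) + (q * press v) * z)) := by
    have h1 : press u = der z + der (der (der z)) + press v := by
      rw [← sub_eq_iff_eq_add, ← map_sub, press_eq, pow_der_succ, pow_der_succ, pow_der_one]
    have h2 : height c v ^ 3 = a - q * z := by
      rw [ha, hq, hz, height, height]; ring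
    rw [totalFlux, totalFlux, h1, h2, hz, smul_mul_assoc, add_sub_add_comm, ← smul_sub]
    congr 1
    · congr 1; ring
    · ring
  rw [hdec, mul_add, mul_add, mul_add, map_add, map_add, map_add]
  set Z₀ := ‖toL2 z‖ with hZ₀
  set Z₁ := ‖toL2 (der z)‖ with hZ₁
  set Z₂ := ‖toL2 (der (der z))‖ with hZ₂
  have n0 : 0 ≤ Z₀ := norm_nonneg _
  have n1 : 0 ≤ Z₁ := norm_nonneg _
  have n2 : 0 ≤ Z₂ := norm_nonneg _
  have t1 := (le_abs_self _).trans (integ_mul_mul_le (der z) ((θ / 2) • (u + v)) z)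
  have t1' : Z₁ * (‖toC ((θ / 2) • (u + v))‖ * Z₀) ≤ Z₁ * ((|θ / 2| * (K + K)) * Z₀) := by
    gcongr
    rw [map_smul, norm_smul, Real.norm_eq_abs, map_add]
    gcongr
    exact (norm_add_le _ _).trans (add_le_add hu0 hv0)
  have t2 := (le_abs_self _).trans (integ_mul_mul_le (der z) a (der z))
  have t2' : Z₁ * (‖toC a‖ * Z₁) ≤ Z₁ * (H ^ 3 * Z₁) := by
    gcongr
    exact norm_toC_pow_le hhu 3
  have t3 : integ (der z * (a * der (der (der z)))) = -integ (der (der z) * (a * der (der z))) -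
      integ (der z * (der a * der (der z))) := by
    rw [← mul_assoc, integ_mul_der, der_mul, add_mul, map_add, mul_assoc, mul_assoc]
    ring
  have t3' := integ_coercive (a := a) (q := der (der z)) (le_height_cube hm hpos)
  have t3'' := (neg_le_abs _).trans (integ_mul_mul_le (der z) (der a) (der (der z)))
  have t3''' : Z₁ * (‖toC (der a)‖ * Z₂) ≤ Z₁ * ((3 * (H * H * K)) * Z₂) := by
    gcongr
    exact norm_toC_der_height_cube_le hu0 hu1
  have t4 := (le_abs_self _).trans (integ_mul_mul_le (der z) (q * press v) z)
  have t4' : Z₁ * (‖toC (q * press v)‖ * Z₀) ≤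
      Z₁ * (((H * H + H * H + H * H) * (K + K)) * Z₀) := by
    gcongr
    exact norm_toC_mul_le hqs hbv
  have hab := absorb_difference (k₁ := k₁) (k₂ := H ^ 3) (k₃ := 3 * (H * H * K)) (pow_pos hm 3)
    (by positivity) (by positivity) (norm_toL2_der_sq_le z)
  have e : k₁ * (Z₁ * Z₀) = Z₁ * ((|θ / 2| * (K + K)) * Z₀) +
      Z₁ * (((H * H + H * H + H * H) * (K + K)) * Z₀) := by rw [hk₁]; ring
  rw [← hZ₀, ← hZ₁, ← hZ₂] at hab
  rw [t3]
  linarith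

theorem integ_mul_vf_sub (c θ : ℝ) (z u v : Per) :
    integ (z * (vf c θ u - vf c θ v)) = integ (der z * (totalFlux c θ u - totalFlux c θ v)) := by
  rw [vf, vf, neg_sub_neg, ← map_sub, integ_mul_der, ← map_neg, ← mul_neg, neg_sub]

/-- Conservation of mass and positivity of the height bound `p` in `L²` by its supremum. -/
theorem norm_toL2_sq_le_toC {c : ℝ} {p : Per} (hp : integ p = 0)
    (hpos : ∀ x, 0 ≤ c + p x) : ‖toL2 p‖ ^ 2 ≤ 4 * Real.pi * c * ‖toC p‖ := by
  have h : integ (p * p) ≤ integ (‖toC p‖ • (p + algebraMap ℝ Per (2 * c))) := by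
    refine integ_mono fun x => ?_
    simp only [mul_apply, smul_apply, add_apply, algebraMap_apply]
    have h1 := abs_apply_le p x
    have h2 := hpos x
    have hc : |p x| ≤ p x + 2 * c := by
      have : 0 ≤ integ (height c p) := integ_nonneg hpos
      rw [height, map_add, hp, integ_algebraMap, add_zero] at this
      have hc0 : 0 ≤ c := by
        by_contra! hneg
        have := mul_neg_of_pos_of_neg Real.two_pi_pos hneg
        linarith
      rw [abs_le]
      constructor <;> linarith
    rw [← abs_mul_abs_self (p x)]
    exact mul_le_mul h1 hc (abs_nonneg _) (norm_nonneg _)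
  rw [norm_toL2_sq]
  refine h.trans (le_of_eq ?_)
  rw [map_smul, map_add, hp, integ_algebraMap, smul_eq_mul]
  ring

theorem norm_toC_cube_le {c : ℝ} {p : Per} (hp : integ p = 0) (hpos : ∀ x, 0 ≤ c + p x) :
    ‖toC p‖ ^ 3 ≤ 16 * Real.pi * c * ‖toL2 (der p)‖ ^ 2 := by
  have h1 := norm_toC_sq_le hp
  have h2 := norm_toL2_sq_le_toC hp hpos
  set S := ‖toC p‖
  have hS : 0 ≤ S := norm_nonneg _
  rcases eq_or_lt_of_le hS with h0 | h0
  · rw [← h0]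
    have : 0 ≤ integ (height c p) := integ_nonneg hpos
    rw [height, map_add, hp, integ_algebraMap, add_zero] at this
    nlinarith [mul_nonneg this (sq_nonneg ‖toL2 (der p)‖)]
  · have h3 : S ^ 4 ≤ 4 * (‖toL2 p‖ ^ 2 * ‖toL2 (der p)‖ ^ 2) := by
      have := pow_le_pow_left₀ (by positivity) h1 2
      calc S ^ 4 = (S ^ 2) ^ 2 := by ring
        _ ≤ _ := this
        _ = _ := by ring
    have h4 := mul_le_mul_of_nonneg_right h2 (sq_nonneg ‖toL2 (der p)‖)
    have h5 : S * S ^ 3 ≤ S * (16 * Real.pi * c * ‖toL2 (der p)‖ ^ 2) := by nlinarith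
    exact le_of_mul_le_mul_left h5 h0

/-- Coercivity of the energy `½ ∫ (∂p)² - p²` for films of nonnegative height. -/
theorem norm_toL2_sq_le_quarter {c : ℝ} (hc : 0 < c) {p : Per} (hp : integ p = 0)
    (hpos : ∀ x, 0 ≤ c + p x) :
    ‖toL2 p‖ ^ 2 ≤ (8 * Real.pi * c) ^ 2 + 1 / 4 * ‖toL2 (der p)‖ ^ 2 := by
  have h2 := norm_toL2_sq_le_toC hp hpos
  have h3 := norm_toC_cube_le hp hpos
  set S := ‖toC p‖
  have hS : 0 ≤ S := norm_nonneg _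
  set P := Real.pi * c with hP
  have hP0 : 0 < P := mul_pos Real.pi_pos hc
  have h2' : ‖toL2 p‖ ^ 2 ≤ 4 * P * S := by rw [hP]; linarith
  have h3' : S ^ 3 ≤ 16 * P * ‖toL2 (der p)‖ ^ 2 := by rw [hP]; linarith
  have e : (8 * Real.pi * c) ^ 2 = 64 * P ^ 2 := by rw [hP]; ring
  rw [e]
  rcases le_total S (16 * P) with h | h
  · nlinarith [sq_nonneg ‖toL2 (der p)‖]
  · have h4 : (16 * P) ^ 2 * S ≤ S ^ 3 := by
      have := pow_le_pow_left₀ (by positivity) h 2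
      nlinarith
    have h5 : P * (16 * P * S) ≤ P * ‖toL2 (der p)‖ ^ 2 := by nlinarith
    have h6 := le_of_mul_le_mul_left h5 hP0
    nlinarith [sq_nonneg P]

/-- Dissipation of the energy `½ ∫ (∂p)² - p²`, up to the contribution of the quadratic
transport term. -/
theorem first_energy_le {c θ m : ℝ} (hm : 0 < m) {p : Per} (hp : integ p = 0)
    (hpos : ∀ x, m ≤ c + p x) :
    integ (der p * der (vf c θ p)) - integ (p * vf c θ p) ≤
      (θ / 2) ^ 2 / (4 * m ^ 3) * (64 * Real.pi ^ 2 * c ^ 2) * ‖toL2 (der p)‖ ^ 2 := by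
  have hpos0 : ∀ x, 0 ≤ c + p x := fun x => hm.le.trans (hpos x)
  have h0 : integ (height c p) = 2 * Real.pi * c := by
    rw [height, map_add, hp, integ_algebraMap, add_zero]
  have hc : 0 ≤ c := by
    have : 0 ≤ integ (height c p) := integ_nonneg hpos0
    rw [h0] at this
    by_contra! hneg
    have := mul_neg_of_pos_of_neg Real.two_pi_pos hneg
    linarith
  have e : integ (der p * der (vf c θ p)) - integ (p * vf c θ p) =
      -integ (press p * totalFlux c θ p) := by
    have h1 : integ (der p * der (vf c θ p)) = -integ ((der ^ 3) p * totalFlux c θ p) := by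
      rw [integ_mul_der, vf, mul_neg, map_neg, neg_neg, integ_mul_der, pow_der_succ, pow_der_succ,
        pow_der_one]
    have h2 : integ (p * vf c θ p) = integ (der p * totalFlux c θ p) := by
      rw [vf, mul_neg, map_neg, integ_mul_der, neg_neg]
    rw [h1, h2, press_eq, add_mul, map_add]
    ring
  rw [e, totalFlux, mul_add, map_add]
  have t1 := integ_coercive (a := height c p ^ 3) (q := press p) (le_height_cube hm hpos)
  have t2 := (neg_le_abs _).trans (abs_integ_mul_le (press p) ((θ / 2) • (p * p)))
  rw [map_smul, norm_smul, Real.norm_eq_abs] at t2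
  have t3 : ‖toL2 (p * p)‖ ^ 2 ≤ 64 * Real.pi ^ 2 * c ^ 2 * ‖toL2 (der p)‖ ^ 2 := by
    have h1 := pow_le_pow_left₀ (norm_nonneg _) (norm_toL2_mul_le p p) 2
    have h2 := norm_toL2_sq_le_toC hp hpos0
    have h3 := norm_toC_cube_le hp hpos0
    rw [mul_pow] at h1
    refine h1.trans ?_
    calc ‖toC p‖ ^ 2 * ‖toL2 p‖ ^ 2 ≤ ‖toC p‖ ^ 2 * (4 * Real.pi * c * ‖toC p‖) := by gcongr
      _ = 4 * Real.pi * c * ‖toC p‖ ^ 3 := by ring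
      _ ≤ 4 * Real.pi * c * (16 * Real.pi * c * ‖toL2 (der p)‖ ^ 2) := by gcongr
      _ = _ := by ring
  set B := ‖toL2 (press p)‖
  set q := ‖toL2 (p * p)‖
  have t4 : B * (|θ / 2| * q) ≤ m ^ 3 * B ^ 2 + (θ / 2) ^ 2 / (4 * m ^ 3) * q ^ 2 := by
    have hα : 0 < m ^ 3 := pow_pos hm 3
    have : 0 ≤ (2 * m ^ 3 * B - |θ / 2| * q) ^ 2 / (4 * m ^ 3) := by positivity
    have e2 : (2 * m ^ 3 * B - |θ / 2| * q) ^ 2 / (4 * m ^ 3) =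
        m ^ 3 * B ^ 2 + |θ / 2| ^ 2 / (4 * m ^ 3) * q ^ 2 - B * (|θ / 2| * q) := by
      field_simp; ring
    rw [sq_abs] at e2
    linarith
  have t5 : (θ / 2) ^ 2 / (4 * m ^ 3) * q ^ 2 ≤ (θ / 2) ^ 2 / (4 * m ^ 3) *
      (64 * Real.pi ^ 2 * c ^ 2 * ‖toL2 (der p)‖ ^ 2) := by gcongr
  rw [← mul_assoc] at t5
  linarith

/-! ### The Hartley basis -/

/-- The Hartley functions `x ↦ (cos kx + sin kx) / √(2π)`, `k ∈ ℤ`. -/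
def hart (k : ℤ) : Per :=
  ⟨fun x => (Real.cos (k * x) + Real.sin (k * x)) / Real.sqrt (2 * Real.pi),
    ((Real.contDiff_cos.comp (contDiff_const.mul contDiff_id)).add
      (Real.contDiff_sin.comp (contDiff_const.mul contDiff_id))).div_const _, fun x => by
    have : (k : ℝ) * (x + 2 * Real.pi) = k * x + k * (2 * Real.pi) := by ring
    simp only [this, Real.cos_add_int_mul_two_pi, Real.sin_add_int_mul_two_pi]⟩

theorem hart_apply (k : ℤ) (x : ℝ) :
    hart k x = (Real.cos (k * x) + Real.sin (k * x)) / Real.sqrt (2 * Real.pi) := rfl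

theorem der_hart (k : ℤ) : der (hart k) = (k : ℝ) • hart (-k) := by
  refine der_eq fun x => ?_
  have h0 : HasDerivAt (fun y : ℝ => (k : ℝ) * y) (k : ℝ) x := by
    simpa using (hasDerivAt_id x).const_mul (k : ℝ)
  refine (((Real.hasDerivAt_cos _).comp x h0).add
    ((Real.hasDerivAt_sin _).comp x h0)).div_const _ |>.congr_deriv ?_
  simp only [smul_apply, hart_apply, Int.cast_neg, neg_mul, Real.cos_neg, Real.sin_neg]
  ring

theorem integ_hart {k : ℤ} (hk : k ≠ 0) : integ (hart k) = 0 := by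
  have h := integ_der (hart (-k))
  rw [der_hart, map_smul, neg_neg, smul_eq_mul] at h
  have hk' : ((-k : ℤ) : ℝ) ≠ 0 := by exact_mod_cast neg_ne_zero.2 hk
  exact (mul_eq_zero.1 h).resolve_left hk'

theorem integ_hart_mul_hart (k l : ℤ) : integ (hart k * hart l) = if k = l then 1 else 0 := by
  have hs : Real.sqrt (2 * Real.pi) ≠ 0 := (Real.sqrt_pos.2 Real.two_pi_pos).ne'
  have hs2 : Real.sqrt (2 * Real.pi) * Real.sqrt (2 * Real.pi) = 2 * Real.pi :=
    Real.mul_self_sqrt Real.two_pi_pos.le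
  have e : ∀ j : ℤ, ∀ x, Real.cos (j * x) = Real.sqrt (2 * Real.pi) / 2 * (hart j x + hart (-j) x)
      ∧ Real.sin (j * x) = Real.sqrt (2 * Real.pi) / 2 * (hart j x - hart (-j) x) := by
    intro j x
    simp only [hart_apply, Int.cast_neg, neg_mul, Real.cos_neg, Real.sin_neg]
    constructor <;> · field_simp; ring
  have key : hart k * hart l = (1 / (2 * Real.sqrt (2 * Real.pi))) •
      ((hart (k - l) + hart (-(k - l))) + (hart (k + l) - hart (-(k + l)))) := by
    ext x
    have h1 := (e (k - l) x).1
    have h2 := (e (k + l) x).2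
    simp only [mul_apply, smul_apply, add_apply, sub_apply]
    have h3 : hart k x * hart l x =
        (Real.cos ((k - l : ℤ) * x) + Real.sin ((k + l : ℤ) * x)) / (2 * Real.pi) := by
      rw [hart_apply, hart_apply, div_mul_div_comm, hs2]
      push_cast
      rw [sub_mul (k : ℝ), add_mul (k : ℝ), Real.cos_sub, Real.sin_add]
      ring
    rw [h3, h1, h2]
    generalize Real.sqrt (2 * Real.pi) = σ at hs hs2
    rw [← hs2]
    field_simp
  rw [key, map_smul, map_add, map_add, map_sub]
  have hz : integ (hart (k + l)) - integ (hart (-(k + l))) = 0 := by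
    by_cases h : k + l = 0
    · rw [h, neg_zero, sub_self]
    · rw [integ_hart h, integ_hart (neg_ne_zero.2 h), sub_self]
  rw [hz, add_zero]
  by_cases h : k = l
  · have h0 : hart 0 = algebraMap ℝ Per (1 / Real.sqrt (2 * Real.pi)) := by
      ext x
      simp [hart_apply]
    rw [if_pos h, h, sub_self, neg_zero, h0, integ_algebraMap, smul_eq_mul]
    generalize Real.sqrt (2 * Real.pi) = σ at hs hs2
    rw [← hs2]
    field_simp
    norm_num
  · have h' : k - l ≠ 0 := sub_ne_zero.2 h
    rw [if_neg h, integ_hart h', integ_hart (neg_ne_zero.2 h')]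
    simp

theorem orthonormal_hart : Orthonormal ℝ fun k => toL2 (hart k) := by
  rw [orthonormal_iff_ite]
  intro i j
  rw [inner_toL2, integ_hart_mul_hart]

theorem inner_toL2_eq_integral (p : Per) (f : L2) :
    inner ℝ (toL2 p) f = ∫ x, f x * toC p x := by
  rw [MeasureTheory.L2.inner_def]
  refine integral_congr_ae ?_
  filter_upwards [coeFn_toL2 p] with x hx
  rw [hx]
  simp

/-- The Hartley functions are total in `L²(𝕋)`. -/
theorem eq_zero_of_inner_hart {f : L2} (h : ∀ k, inner ℝ (toL2 (hart k)) f = 0) : f = 0 := by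
  have hmem : MemLp (fun x => ((f x : ℝ) : ℂ)) 2 (AddCircle.haarAddCircle (T := 2 * Real.pi)) :=
    memLp_haarAddCircle_iff.2 (Lp.memLp f).ofReal
  have hcoef : ∀ k : ℤ, fourierCoeff (T := 2 * Real.pi) (fun x => ((f x : ℝ) : ℂ)) k = 0 := by
    intro k
    have hs : Real.sqrt (2 * Real.pi) ≠ 0 := (Real.sqrt_pos.2 Real.two_pi_pos).ne'
    have hpt : ∀ x : Circ, fourier (-k) x • ((f x : ℝ) : ℂ) =
        ((Real.sqrt (2 * Real.pi) / 2 : ℝ) : ℂ) * (1 - Complex.I) *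
          ((f x * toC (hart k) x : ℝ) : ℂ) +
        ((Real.sqrt (2 * Real.pi) / 2 : ℝ) : ℂ) * (1 + Complex.I) *
          ((f x * toC (hart (-k)) x : ℝ) : ℂ) := by
      intro x
      induction x using QuotientAddGroup.induction_on with
      | H x =>
        have e1 : (fourier (-k) ((x : ℝ) : Circ) : ℂ) =
            (Real.cos (k * x) : ℂ) - (Real.sin (k * x) : ℂ) * Complex.I := by
          rw [fourier_coe_apply]
          have : 2 * (Real.pi : ℂ) * Complex.I * ((-k : ℤ) : ℂ) * (x : ℂ) / ((2 * Real.pi : ℝ) : ℂ)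
              = ((-(k * x) : ℝ) : ℂ) * Complex.I := by
            have hpi : (Real.pi : ℂ) ≠ 0 := by exact_mod_cast Real.pi_ne_zero
            push_cast
            field_simp
          rw [this, Complex.exp_mul_I, ← Complex.ofReal_cos, ← Complex.ofReal_sin, Real.cos_neg,
            Real.sin_neg]
          push_cast
          ring
        rw [e1]
        simp only [toC_coe, hart_apply, Int.cast_neg, neg_mul, Real.cos_neg, Real.sin_neg,
          smul_eq_mul]
        have hs' : ((Real.sqrt (2 * Real.pi) : ℝ) : ℂ) ≠ 0 := by exact_mod_cast hs
        push_cast at hs' ⊢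
        field_simp
        ring
    have hint : ∀ p : Per, Integrable fun x : Circ => ((f x * toC p x : ℝ) : ℂ) := fun p =>
      (integrable_mul_continuousMap (L2.integrable f) (toC p)).ofReal
    have hz : ∀ k : ℤ, ∫ x : Circ, ((f x * toC (hart k) x : ℝ) : ℂ) = 0 := fun k => by
      rw [integral_complex_ofReal, ← inner_toL2_eq_integral, h k, Complex.ofReal_zero]
    rw [fourierCoeff, AddCircle.integral_haarAddCircle, integral_congr_ae (ae_of_all _ hpt),
      integral_add ((hint _).const_mul _) ((hint _).const_mul _), integral_const_mul,
      integral_const_mul, hz, hz]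
    simp
  have hrepr : (fourierBasis (T := 2 * Real.pi)).repr (hmem.toLp _) = 0 := by
    ext k
    rw [fourierBasis_repr, fourierCoeff_congr_ae hmem.coeFn_toLp, hcoef k]
    rfl
  have h0 : hmem.toLp _ = 0 := by simpa using hrepr
  have h1 : (fun x => ((f x : ℝ) : ℂ)) =ᵐ[AddCircle.haarAddCircle (T := 2 * Real.pi)] 0 := by
    refine hmem.coeFn_toLp.symm.trans ?_
    rw [h0]
    exact Lp.coeFn_zero _ _ _
  have h2 : (fun x => ((f x : ℝ) : ℂ)) =ᵐ[volume] 0 := by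
    have hac : (volume : Measure Circ) ≪ AddCircle.haarAddCircle (T := 2 * Real.pi) := by
      rw [AddCircle.volume_eq_smul_haarAddCircle]
      exact Measure.smul_absolutelyContinuous
    exact hac.ae_eq h1
  rw [Lp.eq_zero_iff_ae_eq_zero]
  filter_upwards [h2] with x hx
  exact Complex.ofReal_eq_zero.1 hx

/-- The Hartley functions as a Hilbert basis of `L²(𝕋)`. -/
def hartBasis : HilbertBasis ℤ ℝ L2 :=
  HilbertBasis.mkOfOrthogonalEqBot orthonormal_hart <| by
    rw [Submodule.eq_bot_iff]
    intro f hf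
    refine eq_zero_of_inner_hart fun k => ?_
    exact (Submodule.mem_orthogonal _ _).1 hf _ (Submodule.subset_span ⟨k, rfl⟩)

theorem eq_of_inner_toL2 {f g : L2} (h : ∀ p : Per, inner ℝ (toL2 p) f = inner ℝ (toL2 p) g) :
    f = g := by
  rw [← sub_eq_zero]
  exact eq_zero_of_inner_hart fun k => by rw [inner_sub_right, h, sub_self]

/-- The nonzero frequencies of modulus at most `n`. -/
def modes (n : ℕ) : Finset ℤ := (Finset.Icc (-(n : ℤ)) n).erase 0

theorem mem_modes {n : ℕ} {k : ℤ} : k ∈ modes n ↔ k ≠ 0 ∧ |k| ≤ n := by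
  simp [modes, abs_le]

theorem modes_mono {m n : ℕ} (h : m ≤ n) : modes m ⊆ modes n := fun k hk => by
  rw [mem_modes] at hk ⊢
  exact ⟨hk.1, hk.2.trans (by exact_mod_cast h)⟩

/-- The trigonometric polynomial with coefficients `y k`, `k ∈ s`. -/
def synth (s : Finset ℤ) (y : ℤ → ℝ) : Per := ∑ k ∈ s, y k • hart k

theorem integ_synth (n : ℕ) (y : ℤ → ℝ) : integ (synth (modes n) y) = 0 := by
  rw [synth, map_sum]
  refine Finset.sum_eq_zero fun k hk => ?_
  rw [map_smul, integ_hart (mem_modes.1 hk).1, smul_zero]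

theorem der_synth (n : ℕ) (y : ℤ → ℝ) :
    der (synth (modes n) y) = synth (modes n) fun k => -(k : ℝ) * y (-k) := by
  rw [synth, map_sum, synth]
  refine Finset.sum_bij' (fun k _ => -k) (fun k _ => -k) ?_ ?_ ?_ ?_ ?_
  · intro k hk; rw [mem_modes] at hk ⊢; simpa using hk
  · intro k hk; rw [mem_modes] at hk ⊢; simpa using hk
  · intro k _; simp
  · intro k _; simp
  · intro k _
    rw [map_smul, der_hart, smul_smul]
    congr 1
    push_cast
    rw [neg_neg, neg_neg]
    ring

theorem integ_mul_synth (p : Per) (s : Finset ℤ) (y : ℤ → ℝ) :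
    integ (p * synth s y) = ∑ k ∈ s, y k * integ (hart k * p) := by
  rw [synth, Finset.mul_sum, map_sum]
  refine Finset.sum_congr rfl fun k _ => ?_
  rw [mul_smul_comm, map_smul, smul_eq_mul, mul_comm p]

theorem integ_hart_mul_synth {s : Finset ℤ} {k : ℤ} (hk : k ∈ s) (y : ℤ → ℝ) :
    integ (hart k * synth s y) = y k := by
  rw [integ_mul_synth, Finset.sum_eq_single k]
  · rw [integ_hart_mul_hart, if_pos rfl, mul_one]
  · intro l _ hl
    rw [integ_hart_mul_hart, if_neg hl, mul_zero]
  · exact fun h => absurd hk h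

/-- Parseval's identity for trigonometric polynomials. -/
theorem norm_toL2_synth_sq (s : Finset ℤ) (y : ℤ → ℝ) :
    ‖toL2 (synth s y)‖ ^ 2 = ∑ k ∈ s, y k ^ 2 := by
  rw [norm_toL2_sq, integ_mul_synth]
  exact Finset.sum_congr rfl fun k hk => by rw [integ_hart_mul_synth hk, sq]

/-- The partial sums of the Hartley expansion of a mean-zero function converge in `L²`. -/
theorem tendsto_toL2_synth {f : L2} (h0 : inner ℝ (toL2 (hart 0)) f = 0) :
    Filter.Tendsto (fun n => toL2 (synth (modes n) fun k => inner ℝ (toL2 (hart k)) f))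
      Filter.atTop (nhds f) := by
  have h := hartBasis.hasSum_repr f
  have hb : ∀ k, hartBasis k = toL2 (hart k) := fun k =>
    congrFun (HilbertBasis.coe_mkOfOrthogonalEqBot _ _) k
  have hI : Filter.Tendsto (fun n : ℕ => Finset.Icc (-(n : ℤ)) n) Filter.atTop Filter.atTop := by
    refine Filter.tendsto_atTop_finset_of_monotone ?_ ?_
    · intro m n h
      exact Finset.Icc_subset_Icc (by simpa using h) (by exact_mod_cast h)
    · intro k
      exact ⟨k.natAbs, by rw [Finset.mem_Icc]; omega⟩
  refine Filter.Tendsto.congr (fun n => ?_) (Filter.Tendsto.comp h hI)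
  have hk : ∀ k, hartBasis.repr f k • hartBasis k =
      inner ℝ (toL2 (hart k)) f • toL2 (hart k) := fun k => by
    rw [hartBasis.repr_apply_apply f k, hb]
  rw [Function.comp_apply, Finset.sum_congr rfl fun k _ => hk k, synth, modes, map_sum,
    ← Finset.sum_erase (a := (0 : ℤ)) _ (by rw [h0, zero_smul])]
  exact Finset.sum_congr rfl fun k _ => (map_smul _ _ _).symm

end Per

open Per Filter Topology

/-! ### Weak derivatives and the space `Ḣ⁴` -/

theorem hasWeakDeriv_iff {f g : Circ → ℝ} (hf : Integrable f) (hg : Integrable g) :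
    HasWeakDeriv f g ↔ ∀ p : Per, ∫ x, f x * toC (der p) x = -∫ x, g x * toC p x := by
  refine ⟨fun h p => h.2.2 (toC p) (toC (der p)) p.contDiff p.hasDerivAt, fun h => ⟨hf, hg, ?_⟩⟩
  intro φ ψ hφ hψ
  let p : Per := ⟨fun y : ℝ => φ (y : Circ), hφ, fun x => by simp⟩
  have h1 : toC p = φ := by
    ext x; induction x using QuotientAddGroup.induction_on; rfl
  have h2 : toC (der p) = ψ := by
    ext x
    induction x using QuotientAddGroup.induction_on with
    | H x => exact (hψ x).deriv
  have := h p
  rwa [h1, h2] at this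

theorem hasWeakDeriv_L2_iff {f g : L2} :
    HasWeakDeriv f g ↔ ∀ p : Per, inner ℝ (toL2 (der p)) f = -inner ℝ (toL2 p) g := by
  rw [hasWeakDeriv_iff (L2.integrable f) (L2.integrable g)]
  simp only [inner_toL2_eq_integral]

theorem hasWeakDeriv_toC (p : Per) : HasWeakDeriv (toC p) (toC (der p)) := by
  have hint : ∀ q : Per, Integrable (toC q : Circ → ℝ) := fun q =>
    (L2.integrable (toL2 q)).congr (coeFn_toL2 q)
  rw [hasWeakDeriv_iff (hint _) (hint _)]
  intro q
  have h1 : ∀ a b : Per, ∫ x, toC a x * toC b x = integ (a * b) := fun a b => by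
    rw [← integral_toC, map_mul]; rfl
  rw [h1, h1, integ_mul_der]

theorem isClosed_HDot : IsClosed (HDot 4 : Set (PiLp 2 (fun _ : Fin 5 => L2))) := by
  have hc : ∀ i : Fin 5, Continuous fun v : PiLp 2 (fun _ : Fin 5 => L2) => v i := fun i =>
    PiLp.continuous_apply 2 _ i
  have : (HDot 4 : Set (PiLp 2 (fun _ : Fin 5 => L2))) =
      {v | (∀ (i : Fin 4) (p : Per), inner ℝ (toL2 (der p)) (v i.castSucc) =
        -inner ℝ (toL2 p) (v i.succ)) ∧ inner ℝ (toL2 1) (v 0) = 0} := by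
    ext v
    refine and_congr (forall_congr' fun i => hasWeakDeriv_L2_iff) ?_
    rw [inner_toL2_eq_integral]
    simp
  rw [this, Set.ofPred_and]
  refine IsClosed.inter ?_ ?_
  · simp only [Set.ofPred_forall]
    exact isClosed_iInter fun i => isClosed_iInter fun p =>
      isClosed_eq (continuous_const.inner (hc _)) (continuous_const.inner (hc _)).neg
  · exact isClosed_eq (continuous_const.inner (hc _)) continuous_const

instance : CompleteSpace (HDot 4) := isClosed_HDot.completeSpace_coe

/-- `D i` as a continuous linear map. -/
def DL (i : Fin 5) : HDot 4 →L[ℝ] L2 :=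
  (PiLp.proj 2 (fun _ : Fin 5 => L2) i : PiLp 2 (fun _ : Fin 5 => L2) →L[ℝ] L2).comp (HDot 4).subtypeL

theorem D_eq (i : Fin 5) (v : HDot 4) : D i v = DL i v := rfl

theorem D_sub (i : Fin 5) (u v : HDot 4) : D i (u - v) = D i u - D i v := rfl

theorem norm_sq_eq (v : HDot 4) : ‖v‖ ^ 2 = ∑ i, ‖D i v‖ ^ 2 :=
  PiLp.norm_sq_eq_of_L2 _ (v : PiLp 2 (fun _ : Fin 5 => L2))

theorem norm_D_le (i : Fin 5) (v : HDot 4) : ‖D i v‖ ≤ ‖v‖ := by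
  refine abs_le_of_sq_le_sq' ?_ (norm_nonneg v) |>.2
  rw [norm_sq_eq]
  exact Finset.single_le_sum (f := fun i => ‖D i v‖ ^ 2) (fun _ _ => sq_nonneg _)
    (Finset.mem_univ i)

theorem inner_der_D (v : HDot 4) (i : Fin 4) (p : Per) :
    inner ℝ (toL2 (der p)) (D i.castSucc v) = -inner ℝ (toL2 p) (D i.succ v) :=
  hasWeakDeriv_L2_iff.1 (v.2.1 i) p

theorem D_ext {u v : HDot 4} (h : D 0 u = D 0 v) : u = v := by
  have hi : ∀ i : Fin 5, D i u = D i v := by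
    intro i
    induction i using Fin.induction with
    | zero => exact h
    | succ i ih =>
      refine eq_of_inner_toL2 fun p => ?_
      rw [← neg_inj, ← inner_der_D, ← inner_der_D, ih]
  exact Subtype.ext (PiLp.ext hi)

/-- Subtraction of the mean value. -/
def center : Per →ₗ[ℝ] Per :=
  LinearMap.id - ((2 * Real.pi)⁻¹ • integ).smulRight 1

theorem center_eq (p : Per) : center p = p - ((2 * Real.pi)⁻¹ * integ p) • 1 := rfl

theorem integ_center (p : Per) : integ (center p) = 0 := by
  have h : integ (1 : Per) = 2 * Real.pi := by
    have := integ_algebraMap 1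
    rwa [map_one, mul_one] at this
  rw [center_eq, map_sub, map_smul, h, smul_eq_mul]
  field_simp
  ring

theorem center_of_integ_eq_zero {p : Per} (h : integ p = 0) : center p = p := by
  rw [center_eq, h, mul_zero, zero_smul, sub_zero]

/-- The embedding of smooth functions into `Ḣ⁴`; the mean value is subtracted, which makes it a
linear map on all of `Per`. -/
def iota : Per →ₗ[ℝ] HDot 4 :=
  ((WithLp.linearEquiv 2 ℝ (Fin 5 → L2)).symm.toLinearMap ∘ₗ
    LinearMap.pi fun i : Fin 5 => toL2 ∘ₗ (der ^ (i : ℕ)) ∘ₗ center).codRestrict (HDot 4) <| by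
    intro p
    refine ⟨fun i => ?_, ?_⟩
    · have h := hasWeakDeriv_toC ((der ^ (i : ℕ)) (center p))
      rw [← pow_der_succ] at h
      exact h.congr (coeFn_toL2 _).symm (coeFn_toL2 _).symm
    · refine (integral_congr_ae (coeFn_toL2 (center p))).trans ?_
      rw [integral_toC, integ_center]

theorem D_iota {p : Per} (hp : integ p = 0) (i : Fin 5) :
    D i (iota p) = toL2 ((der ^ (i : ℕ)) p) := by
  have : D i (iota p) = toL2 ((der ^ (i : ℕ)) (center p)) := rfl
  rw [this, center_of_integ_eq_zero hp]

theorem norm_iota_le {p : Per} (hp : integ p = 0) :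
    ‖iota p‖ ≤ 3 * (4 * Real.pi) ^ 4 * ‖toL2 ((der ^ 4) p)‖ := by
  refine abs_le_of_sq_le_sq' ?_ (by positivity) |>.2
  have h : ∀ i : Fin 5, ‖D i (iota p)‖ ^ 2 ≤ ((4 * Real.pi) ^ 4 * ‖toL2 ((der ^ 4) p)‖) ^ 2 :=
    fun i => by
      rw [D_iota hp]
      exact pow_le_pow_left₀ (norm_nonneg _)
        (norm_toL2_pow_der_le_uniform hp (by omega) le_rfl) 2
  rw [norm_sq_eq]
  refine (Finset.sum_le_sum fun i _ => h i).trans ?_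
  rw [Finset.sum_const, Finset.card_univ, Fintype.card_fin, nsmul_eq_mul]
  push_cast
  nlinarith [sq_nonneg ((4 * Real.pi) ^ 4 * ‖toL2 ((der ^ 4) p)‖)]

/-! ### Truncated Hartley expansions -/

/-- The Hartley coefficients of an element of `Ḣ⁴`. -/
def coef (v : HDot 4) (k : ℤ) : ℝ := inner ℝ (toL2 (hart k)) (D 0 v)

/-- The truncated Hartley expansion. -/
def trunc (n : ℕ) (v : HDot 4) : Per := synth (modes n) (coef v)

@[simp] theorem integ_trunc (n : ℕ) (v : HDot 4) : integ (trunc n v) = 0 := integ_synth _ _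

theorem inner_hart_D_succ (v : HDot 4) (i : Fin 4) (k : ℤ) :
    inner ℝ (toL2 (hart k)) (D i.succ v) =
      -(k : ℝ) * inner ℝ (toL2 (hart (-k))) (D i.castSucc v) := by
  have h := inner_der_D v i (hart k)
  rw [der_hart, map_smul, real_inner_smul_left] at h
  linarith

theorem inner_hart_zero_D (v : HDot 4) (i : Fin 5) : inner ℝ (toL2 (hart 0)) (D i v) = 0 := by
  cases i using Fin.cases with
  | zero =>
    have h0 : hart 0 = (1 / Real.sqrt (2 * Real.pi)) • (1 : Per) := by
      ext x
      simp [hart_apply]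
    rw [h0, map_smul, real_inner_smul_left, inner_toL2_eq_integral]
    have := v.2.2
    simp only [map_one, ContinuousMap.one_apply, mul_one]
    rw [D, this, mul_zero]
  | succ i => rw [inner_hart_D_succ]; simp

theorem pow_der_trunc (n : ℕ) (v : HDot 4) (i : Fin 5) :
    (der ^ (i : ℕ)) (trunc n v) = synth (modes n) fun k => inner ℝ (toL2 (hart k)) (D i v) := by
  induction i using Fin.induction with
  | zero => rfl
  | succ i ih =>
    rw [Fin.val_succ, pow_der_succ]
    rw [Fin.val_castSucc] at ih
    rw [ih, der_synth]
    congr 1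
    funext k
    rw [inner_hart_D_succ]

theorem tendsto_toL2_pow_der_trunc (v : HDot 4) (i : Fin 5) :
    Tendsto (fun n => toL2 ((der ^ (i : ℕ)) (trunc n v))) atTop (𝓝 (D i v)) := by
  simp only [pow_der_trunc]
  exact tendsto_toL2_synth (inner_hart_zero_D v i)

theorem tendsto_iota_trunc (v : HDot 4) : Tendsto (fun n => iota (trunc n v)) atTop (𝓝 v) := by
  rw [tendsto_iff_norm_sub_tendsto_zero]
  have h : Tendsto (fun n => ∑ i, ‖D i (iota (trunc n v) - v)‖ ^ 2) atTop
      (𝓝 (∑ _i : Fin 5, (0 : ℝ) ^ 2)) := by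
    refine tendsto_finsetSum _ fun i _ => Tendsto.pow ?_ 2
    have := tendsto_iff_norm_sub_tendsto_zero.1 (tendsto_toL2_pow_der_trunc v i)
    refine this.congr fun n => ?_
    rw [D_sub, D_iota (integ_trunc n v)]
  simp only [← norm_sq_eq] at h
  have h2 := h.sqrt
  simpa [Real.sqrt_sq (norm_nonneg _)] using h2

theorem norm_le_D_four (v : HDot 4) : ‖v‖ ≤ 3 * (4 * Real.pi) ^ 4 * ‖D 4 v‖ := by
  have h := (continuous_norm.tendsto v).comp (tendsto_iota_trunc v)
  have h' := ((tendsto_toL2_pow_der_trunc v 4).norm).const_mul (3 * (4 * Real.pi) ^ 4)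
  exact le_of_tendsto_of_tendsto' h h' fun n => norm_iota_le (integ_trunc n v)

/-- Elements of `Ḣ⁴` have three continuous derivatives, uniformly approximated by those of the
truncations. -/
theorem exists_tendsto_toC_trunc (v : HDot 4) (i : Fin 4) :
    ∃ U : C(Circ, ℝ), Tendsto (fun n => toC ((der ^ (i : ℕ)) (trunc n v))) atTop (𝓝 U) ∧
      D i.castSucc v = ContinuousMap.toLp (E := ℝ) 2 (volume : Measure Circ) ℝ U := by
  have hc : CauchySeq fun n => toC ((der ^ (i : ℕ)) (trunc n v)) := by
    have h4 := (tendsto_toL2_pow_der_trunc v 4).cauchySeq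
    rw [Metric.cauchySeq_iff] at h4 ⊢
    intro ε hε
    obtain ⟨n₀, hn₀⟩ := h4 (ε / (4 * Real.pi) ^ 4) (by positivity)
    refine ⟨n₀, fun m hm n hn => ?_⟩
    have h1 := hn₀ m hm n hn
    rw [dist_eq_norm, ← map_sub, ← map_sub] at h1 ⊢
    have h2 := norm_toC_pow_der_le_uniform (f := trunc m v - trunc n v) (by simp)
      (j := i) (k := 4) (n := 4) (by omega) le_rfl
    rw [lt_div_iff₀ (by positivity)] at h1
    exact h2.trans_lt ((mul_comm _ _).trans_lt h1)
  obtain ⟨U, hU⟩ := cauchySeq_tendsto_of_complete hc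
  refine ⟨U, hU, ?_⟩
  have h1 := ((ContinuousMap.toLp (E := ℝ) 2 (volume : Measure Circ) ℝ).continuous.tendsto U).comp hU
  have h2 := tendsto_toL2_pow_der_trunc v i.castSucc
  exact tendsto_nhds_unique h2 h1

theorem forall_le_of_ae_le {f : C(Circ, ℝ)} {m : ℝ} (h : ∀ᵐ x, m ≤ f x) (x : Circ) : m ≤ f x := by
  have hd : Dense {x | m ≤ f x} := Measure.dense_of_ae h
  have hcl : IsClosed {x | m ≤ f x} := isClosed_le continuous_const f.continuous
  have := hd.closure_eq
  rw [hcl.closure_eq] at this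
  exact this.symm.subset (mem_univ x)

theorem ae_D_iota {p : Per} (hp : integ p = 0) (i : Fin 5) :
    (D i (iota p) : Circ → ℝ) =ᵐ[volume] toC ((der ^ (i : ℕ)) p) := by
  rw [D_iota hp]
  exact coeFn_toL2 _

theorem le_of_ae_le_iota {c m : ℝ} {p : Per} (hp : integ p = 0)
    (h : ∀ᵐ x, m ≤ c + D 0 (iota p) x) (x : ℝ) : m ≤ c + p x := by
  have h' : ∀ᵐ y, m - c ≤ toC p y := by
    filter_upwards [h, ae_D_iota hp 0] with y hy hy'
    rw [hy'] at hy
    have : toC ((der ^ ((0 : Fin 5) : ℕ)) p) y = toC p y := rfl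
    linarith
  have := forall_le_of_ae_le h' (x : Circ)
  rw [toC_coe] at this
  linarith

theorem ae_le_iota {c m : ℝ} {p : Per} (hp : integ p = 0) (h : ∀ x, m ≤ c + p x) :
    ∀ᵐ x, m ≤ c + D 0 (iota p) x := by
  filter_upwards [ae_D_iota hp 0] with y hy
  rw [hy]
  induction y using QuotientAddGroup.induction_on with
  | H y => exact h y

theorem eventually_le_trunc {c m m' : ℝ} {v : HDot 4} (h : ∀ᵐ x, m ≤ c + D 0 v x)
    (hm : m' < m) : ∀ᶠ n in atTop, ∀ x, m' ≤ c + trunc n v x := by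
  obtain ⟨U, hU, hD⟩ := exists_tendsto_toC_trunc v 0
  have h1 : ∀ᵐ x, m - c ≤ U x := by
    have h2 := ContinuousMap.coeFn_toLp (p := 2) (𝕜 := ℝ) (volume : Measure Circ) U
    rw [← hD] at h2
    filter_upwards [h, h2] with x hx hx'
    have : D (Fin.castSucc 0) v = D 0 v := rfl
    rw [this] at hx'
    rw [hx'] at hx
    linarith
  have h3 := forall_le_of_ae_le h1
  filter_upwards [Metric.tendsto_nhds.1 hU (m - m') (by linarith)] with n hn x
  rw [dist_eq_norm] at hn
  have h4 := (ContinuousMap.norm_coe_le_norm (toC (trunc n v) - U) (x : Circ)).trans hn.le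
  rw [ContinuousMap.sub_apply, Real.norm_eq_abs, toC_coe, abs_le] at h4
  linarith [h3 (x : Circ), h4.1]

/-! ### The nonlinearities in divergence form -/

/-- The total flux `θ v²/2 + h³ (∂v + ∂³v)` of an element of `Ḣ⁴`. -/
def fluxFun (c θ : ℝ) (v : HDot 4) (x : Circ) : ℝ :=
  θ * ((D 0 v x) ^ 2 / 2) + (c + D 0 v x) ^ 3 * (D 1 v x + D 3 v x)

/-- `N` is the nonlinear part of the vector field `-∂ (θ v²/2 + h³ (∂v + ∂³v))`: every value of
`L v + N v` is minus the weak derivative of the total flux, and for smooth `v` there is such a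
value. -/
def IsNonlinearity (c θ : ℝ) (N : HDot 4 → L2 → Prop) : Prop :=
  (∀ v r, N v r → HasWeakDeriv (fluxFun c θ v) (-(opL c v + r) : L2)) ∧
    ∀ p : Per, integ p = 0 → N (iota p) (toL2 (vf c θ p) - opL c (iota p))

theorem hasWeakDeriv_fluxFun {c θ : ℝ} {v : HDot 4} {r₁ r₂ : L2}
    (h₁ : HasWeakDeriv (fun x => θ * ((D 0 v x) ^ 2 / 2)) r₁) (h₂ : HasWeakDeriv (flux c v) r₂) :
    HasWeakDeriv (fluxFun c θ v) (-(opL c v + (-r₁ - r₂)) : L2) := by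
  have h3 := ((v.2.1 1).add (v.2.1 3)).const_smul (c ^ 3)
  refine ((h₁.add h₂).add h3).congr (ae_of_all _ fun x => ?_) ?_
  · simp only [fluxFun, flux, D, Pi.add_apply, Pi.smul_apply, smul_eq_mul]
    show _ = θ * _ + (c + _) ^ 3 * (((v : PiLp 2 (fun _ : Fin 5 => L2)) 1 : L2) x +
      ((v : PiLp 2 (fun _ : Fin 5 => L2)) 3 : L2) x)
    have e1 : (1 : Fin 4).castSucc = (1 : Fin 5) := rfl
    have e3 : (3 : Fin 4).castSucc = (3 : Fin 5) := rfl
    rw [e1, e3]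
    ring
  · have e : (-(opL c v + (-r₁ - r₂)) : L2) = r₁ + r₂ + (c ^ 3) • (D 2 v + D 4 v) := by
      rw [opL, neg_smul]; abel
    rw [e]
    filter_upwards [Lp.coeFn_add (r₁ + r₂) ((c ^ 3) • (D 2 v + D 4 v)), Lp.coeFn_add r₁ r₂,
      Lp.coeFn_smul (c ^ 3) (D 2 v + D 4 v), Lp.coeFn_add (D 2 v) (D 4 v)] with x h1 h2 h3 h4
    simp only [h1, h2, h3, h4, Pi.add_apply, Pi.smul_apply]
    rfl

theorem toL2_vf_sub_opL (c θ : ℝ) {p : Per} (hp : integ p = 0) :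
    toL2 (vf c θ p) - opL c (iota p) = -toL2 (der ((θ / 2) • (p * p))) -
      toL2 (der ((p ^ 3 + (3 * c ^ 2) • p + (3 * c) • p ^ 2) * press p)) := by
  have h : opL c (iota p) = toL2 (-((c ^ 3) • der (press p))) := by
    have := pow_der_press 1 p
    rw [pow_der_one] at this
    rw [opL, D_iota hp, D_iota hp, this, map_neg, map_smul, map_add, neg_smul]
    rfl
  rw [h, ← map_sub, ← map_neg, ← map_sub]
  congr 1
  have e : totalFlux c θ p = (θ / 2) • (p * p) +
      ((p ^ 3 + (3 * c ^ 2) • p + (3 * c) • p ^ 2) * press p + (c ^ 3) • press p) := by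
    ext x
    simp only [totalFlux, add_apply, smul_apply, mul_apply, pow_succ, pow_zero, one_mul,
      height_apply]
    ring
  rw [vf, e, map_add, map_add, map_smul (der) (c ^ 3)]
  ring

theorem exists_isNonlinearity {c : ℝ} {N : HDot 4 → L2 → Prop}
    (hN : N = IsR c ∨ N = IsRbar c) : ∃ θ, IsNonlinearity c θ N := by
  have hsq : ∀ p : Per, integ p = 0 → ∀ θ : ℝ, HasWeakDeriv
      (fun x => θ * ((D 0 (iota p) x) ^ 2 / 2)) (toL2 (der ((θ / 2) • (p * p)))) := by
    intro p hp θ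
    refine (hasWeakDeriv_toC ((θ / 2) • (p * p))).congr ?_ (coeFn_toL2 _).symm
    filter_upwards [ae_D_iota hp 0] with x hx
    rw [hx, map_smul, map_mul]
    simp only [ContinuousMap.smul_apply, ContinuousMap.mul_apply, smul_eq_mul]
    show _ = θ * (toC p x ^ 2 / 2)
    ring
  have hflux : ∀ p : Per, integ p = 0 → HasWeakDeriv (flux c (iota p))
      (toL2 (der ((p ^ 3 + (3 * c ^ 2) • p + (3 * c) • p ^ 2) * press p))) := by
    intro p hp
    refine (hasWeakDeriv_toC _).congr ?_ (coeFn_toL2 _).symm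
    filter_upwards [ae_D_iota hp 0, ae_D_iota hp 1, ae_D_iota hp 3] with x h0 h1 h3
    rw [flux, h0, h1, h3]
    simp only [map_mul, map_add, map_pow, map_smul, press_eq, ContinuousMap.smul_apply,
      ContinuousMap.mul_apply, ContinuousMap.add_apply, ContinuousMap.pow_apply, smul_eq_mul]
    show _ = (toC p x ^ 3 + 3 * c ^ 2 * toC p x + 3 * c * toC p x ^ 2) *
      (toC ((der ^ 1) p) x + toC ((der ^ 3) p) x)
    rw [pow_der_one]
  rcases hN with rfl | rfl
  · refine ⟨1, ?_, fun p hp => ?_⟩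
    · rintro v r ⟨r₁, r₂, h₁, h₂, rfl⟩
      exact hasWeakDeriv_fluxFun (by simpa using h₁) h₂
    · exact ⟨_, _, by simpa using hsq p hp 1, hflux p hp, toL2_vf_sub_opL c 1 hp⟩
  · refine ⟨0, ?_, fun p hp => ?_⟩
    · rintro v r ⟨r₂, h₂, rfl⟩
      have := hasWeakDeriv_fluxFun (c := c) (θ := 0) (v := v) (r₁ := 0) (r₂ := r₂)
        (HasWeakDeriv.zero.congr (ae_of_all _ fun x => by simp) (Lp.coeFn_zero ℝ 2 _).symm) h₂
      rwa [neg_zero, zero_sub] at this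
    · refine ⟨_, hflux p hp, ?_⟩
      rw [toL2_vf_sub_opL c 0 hp]
      simp

theorem IsNonlinearity.inner_toL2 {c θ : ℝ} {N : HDot 4 → L2 → Prop}
    (hN : IsNonlinearity c θ N) {v : HDot 4} {r : L2} (h : N v r) (p : Per) :
    inner ℝ (toL2 p) (opL c v + r) = ∫ x, fluxFun c θ v x * toC (der p) x := by
  have h1 := hN.1 v r h
  rw [(hasWeakDeriv_iff h1.1 h1.2.1).1 h1 p, ← inner_toL2_eq_integral, inner_neg_right, neg_neg]

/-- The total flux of an element of `Ḣ⁴` is continuous and the uniform limit of the fluxes of its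
truncations. -/
theorem exists_tendsto_totalFlux_trunc (c θ : ℝ) (v : HDot 4) :
    ∃ U : C(Circ, ℝ), fluxFun c θ v =ᵐ[volume] U ∧
      Tendsto (fun n => toC (totalFlux c θ (trunc n v))) atTop (𝓝 U) := by
  obtain ⟨U₀, h₀, e₀⟩ := exists_tendsto_toC_trunc v 0
  obtain ⟨U₁, h₁, e₁⟩ := exists_tendsto_toC_trunc v 1
  obtain ⟨U₃, h₃, e₃⟩ := exists_tendsto_toC_trunc v 3
  refine ⟨(θ / 2) • (U₀ * U₀) + (algebraMap ℝ C(Circ, ℝ) c + U₀) ^ 3 * (U₁ + U₃), ?_, ?_⟩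
  · have a₀ := ContinuousMap.coeFn_toLp (p := 2) (𝕜 := ℝ) (volume : Measure Circ) U₀
    have a₁ := ContinuousMap.coeFn_toLp (p := 2) (𝕜 := ℝ) (volume : Measure Circ) U₁
    have a₃ := ContinuousMap.coeFn_toLp (p := 2) (𝕜 := ℝ) (volume : Measure Circ) U₃
    rw [← e₀] at a₀
    rw [← e₁] at a₁
    rw [← e₃] at a₃
    filter_upwards [a₀, a₁, a₃] with x h0 h1 h3
    have h0' : D 0 v x = U₀ x := h0
    have h1' : D 1 v x = U₁ x := h1
    have h3' : D 3 v x = U₃ x := h3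
    rw [fluxFun, h0', h1', h3']
    have hc : (algebraMap ℝ C(Circ, ℝ) c) x = c := rfl
    simp only [ContinuousMap.add_apply, ContinuousMap.smul_apply, ContinuousMap.mul_apply,
      ContinuousMap.pow_apply, hc, smul_eq_mul]
    ring
  · have h1' : Tendsto (fun n => toC (der (trunc n v))) atTop (𝓝 U₁) := by
      refine h₁.congr fun n => ?_
      show toC ((der ^ 1) (trunc n v)) = _
      rw [pow_der_one]
    have := ((h₀.mul h₀).const_smul (θ / 2)).add (((h₀.const_add (algebraMap ℝ C(Circ, ℝ) c)).pow
      3).mul (h1'.add h₃))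
    refine this.congr fun n => ?_
    simp only [totalFlux, height, press_eq, map_add, map_mul, map_pow, map_smul, AlgHom.commutes]
    rfl

theorem fluxFun_iota (c θ : ℝ) {p : Per} (hp : integ p = 0) :
    fluxFun c θ (iota p) =ᵐ[volume] toC (totalFlux c θ p) := by
  filter_upwards [ae_D_iota hp 0, ae_D_iota hp 1, ae_D_iota hp 3] with x h0 h1 h3
  rw [fluxFun, h0, h1, h3]
  induction x using QuotientAddGroup.induction_on with
  | H x =>
    show θ * (p x ^ 2 / 2) + (c + p x) ^ 3 * (((der ^ 1) p) x + ((der ^ 3) p) x) =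
      θ / 2 * (p x * p x) + (c + p x) ^ 3 * (der p x + ((der ^ 3) p) x)
    rw [pow_der_one]
    ring

/-- On smooth functions the equation reads `∂ₜ p = -∂ (totalFlux p)`. -/
theorem IsNonlinearity.eq_toL2_vf {c θ : ℝ} {N : HDot 4 → L2 → Prop}
    (hN : IsNonlinearity c θ N) {p : Per} (hp : integ p = 0) {r : L2} (h : N (iota p) r) :
    opL c (iota p) + r = toL2 (vf c θ p) := by
  refine eq_of_inner_toL2 fun q => ?_
  rw [hN.inner_toL2 h, Per.inner_toL2, vf, mul_neg, map_neg, integ_mul_der, neg_neg,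
    ← integral_toC]
  refine integral_congr_ae ?_
  filter_upwards [fluxFun_iota c θ hp] with x hx
  rw [hx, map_mul, ContinuousMap.mul_apply, mul_comm]

/-! ### Uniqueness -/

/-- The one-sided Lipschitz estimate in `L²` for the right-hand side on bounded subsets of `Ḣ⁴` of
films of uniformly positive height. -/
theorem IsNonlinearity.exists_inner_le {c θ : ℝ} {N : HDot 4 → L2 → Prop}
    (hN : IsNonlinearity c θ N) {m : ℝ} (hm : 0 < m) (M : ℝ) :
    ∃ C : ℝ, 0 ≤ C ∧ ∀ (u v : HDot 4) (r s : L2), (∀ᵐ x, m ≤ c + D 0 u x) → ‖u‖ ≤ M → ‖v‖ ≤ M →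
      N u r → N v s →
      inner ℝ (D 0 (u - v)) (opL c u + r - (opL c v + s)) ≤ C * ‖D 0 (u - v)‖ ^ 2 := by
  obtain ⟨C, hC, hb⟩ := exists_difference_bound c θ (m / 2) (M + 1) (by linarith)
  refine ⟨C, hC, fun u v r s hpos hu hv hr hs => ?_⟩
  obtain ⟨U, hU, hU'⟩ := exists_tendsto_totalFlux_trunc c θ u
  obtain ⟨V, hV, hV'⟩ := exists_tendsto_totalFlux_trunc c θ v
  set T := ContinuousMap.toLp (E := ℝ) 2 (volume : Measure Circ) ℝ
  set z : ℕ → Per := fun n => trunc n u - trunc n v with hz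
  have hz0 : Tendsto (fun n => toL2 (z n)) atTop (𝓝 (D 0 (u - v))) := by
    rw [D_sub]
    simp only [hz, map_sub]
    exact (tendsto_toL2_pow_der_trunc u 0).sub (tendsto_toL2_pow_der_trunc v 0)
  have hz1 : Tendsto (fun n => toL2 (der (z n))) atTop (𝓝 (D 1 (u - v))) := by
    rw [D_sub]
    simp only [hz, map_sub]
    have h1 := tendsto_toL2_pow_der_trunc u 1
    have h2 := tendsto_toL2_pow_der_trunc v 1
    simp only [Fin.val_one, pow_der_one] at h1 h2
    exact h1.sub h2
  have hL : Tendsto (fun n => inner ℝ (toL2 (z n)) (opL c u + r - (opL c v + s))) atTop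
      (𝓝 (inner ℝ (D 0 (u - v)) (opL c u + r - (opL c v + s)))) :=
    hz0.inner tendsto_const_nhds
  have hflux : ∀ (w : HDot 4) (t : L2) (W : C(Circ, ℝ)), N w t → fluxFun c θ w =ᵐ[volume] W →
      ∀ p : Per, inner ℝ (toL2 p) (opL c w + t) = inner ℝ (toL2 (der p)) (T W) := by
    intro w t W hw hW p
    rw [hN.inner_toL2 hw, inner_toL2_eq_integral]
    refine integral_congr_ae ?_
    filter_upwards [hW, ContinuousMap.coeFn_toLp (p := 2) (𝕜 := ℝ) (volume : Measure Circ) W]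
      with x h1 h2
    rw [h1, h2]
  have hL' : Tendsto (fun n => inner ℝ (toL2 (der (z n))) (T (U - V))) atTop
      (𝓝 (inner ℝ (D 0 (u - v)) (opL c u + r - (opL c v + s)))) := by
    refine hL.congr fun n => ?_
    rw [inner_sub_right, hflux u r U hr hU, hflux v s V hs hV, map_sub T U V, inner_sub_right]
  have hR : Tendsto (fun n => inner ℝ (toL2 (der (z n)))
      (toL2 (totalFlux c θ (trunc n u) - totalFlux c θ (trunc n v)))) atTop
      (𝓝 (inner ℝ (D 1 (u - v)) (T (U - V)))) := by
    refine hz1.inner ?_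
    have := (T.continuous.tendsto (U - V)).comp (hU'.sub hV')
    refine this.congr fun n => ?_
    rw [Function.comp_apply, ← map_sub]
    rfl
  have hL'' := hz1.inner (𝕜 := ℝ) (tendsto_const_nhds (x := T (U - V)))
  rw [tendsto_nhds_unique hL' hL'']
  refine le_of_tendsto_of_tendsto hR ((hz0.norm.pow 2).const_mul C) ?_
  have hbd : ∀ w : HDot 4, ‖w‖ ≤ M → ∀ᶠ n in atTop, ‖toL2 ((der ^ 4) (trunc n w))‖ ≤ M + 1 := by
    intro w hw
    have := (tendsto_toL2_pow_der_trunc w 4).norm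
    exact (this.eventually_lt_const (by linarith [norm_D_le 4 w] : ‖D 4 w‖ < M + 1)).mono
      fun n hn => hn.le
  filter_upwards [eventually_le_trunc hpos (by linarith : m / 2 < m), hbd u hu, hbd v hv]
    with n h1 h2 h3
  rw [Per.inner_toL2]
  exact hb _ _ (integ_trunc _ _) (integ_trunc _ _) h1 h2 h3

theorem gronwall_le {f f' : ℝ → ℝ} {a b K ε : ℝ} (hK : 0 ≤ K) (hε : 0 ≤ ε)
    (hc : ContinuousOn f (Icc a b)) (hd : ∀ t ∈ Ioo a b, HasDerivAt f (f' t) t)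
    (hb : ∀ t ∈ Ioo a b, f' t ≤ K * f t + ε) {t : ℝ} (ht : t ∈ Icc a b) :
    f t ≤ (f a + ε * (t - a)) * Real.exp (K * (t - a)) := by
  have hder : ∀ t ∈ Ioo a b, HasDerivAt (fun t => Real.exp (-(K * (t - a))) * f t - ε * (t - a))
      (Real.exp (-(K * (t - a))) * (f' t - K * f t) - ε) t := by
    intro t ht
    have h1 : HasDerivAt (fun t => -(K * (t - a))) (-K) t := by
      simpa using (((hasDerivAt_id t).sub_const a).const_mul K).fun_neg
    have h2 : HasDerivAt (fun t => ε * (t - a)) ε t := by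
      simpa using ((hasDerivAt_id t).sub_const a).const_mul ε
    exact ((h1.exp.mul (hd t ht)).sub h2).congr_deriv (by ring)
  have hanti : AntitoneOn (fun t => Real.exp (-(K * (t - a))) * f t - ε * (t - a)) (Icc a b) := by
    refine antitoneOn_of_deriv_nonpos (convex_Icc a b) ?_ ?_ ?_
    · exact ((by fun_prop : Continuous fun t => Real.exp (-(K * (t - a)))).continuousOn.mul hc).sub
        (by fun_prop)
    · rw [interior_Icc]
      exact fun t ht => (hder t ht).differentiableAt.differentiableWithinAt
    · rw [interior_Icc]
      intro t ht
      rw [(hder t ht).deriv]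
      have h1 : Real.exp (-(K * (t - a))) ≤ 1 := by
        rw [Real.exp_le_one_iff, neg_nonpos]
        exact mul_nonneg hK (by linarith [ht.1])
      have h2 := hb t ht
      nlinarith [Real.exp_pos (-(K * (t - a)))]
  have h := hanti ⟨le_rfl, ht.1.trans ht.2⟩ ht ht.1
  simp only [sub_self, mul_zero, neg_zero, Real.exp_zero, one_mul, sub_zero] at h
  have h2 : Real.exp (-(K * (t - a))) * f t ≤ f a + ε * (t - a) := by linarith
  calc f t = Real.exp (-(K * (t - a))) * f t * Real.exp (K * (t - a)) := by
        rw [mul_right_comm, ← Real.exp_add]; simp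
    _ ≤ _ := mul_le_mul_of_nonneg_right h2 (Real.exp_pos _).le

/-- Positive solutions are determined by their initial values. -/
theorem IsNonlinearity.eqOn {c θ : ℝ} {N : HDot 4 → L2 → Prop} (hN : IsNonlinearity c θ N)
    {S : ℝ} {u v : ℝ → HDot 4} (hu : IsSolution c N (Icc 0 S) u)
    (hv : IsSolution c N (Icc 0 S) v) (hpos : FilmPositiveOn c (Icc 0 S) u) (h0 : u 0 = v 0) :
    EqOn u v (Icc 0 S) := by
  obtain ⟨m, hm, hpos⟩ := hpos
  obtain ⟨Mu, hMu⟩ := isCompact_Icc.exists_bound_of_continuousOn hu.1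
  obtain ⟨Mv, hMv⟩ := isCompact_Icc.exists_bound_of_continuousOn hv.1
  obtain ⟨hcu, wu, -, hwu⟩ := hu
  obtain ⟨hcv, wv, -, hwv⟩ := hv
  obtain ⟨C, hC, hb⟩ := hN.exists_inner_le hm (max Mu Mv)
  intro t ht
  have hg := gronwall_le (f := fun t => ‖DL 0 (u t - v t)‖ ^ 2)
    (f' := fun t => 2 * inner ℝ (DL 0 (u t - v t)) (DL 0 (wu t - wv t))) (a := 0) (b := S)
    (K := 2 * C) (ε := 0) (by positivity) le_rfl
    (((DL 0).continuous.comp_continuousOn (hcu.sub hcv)).norm.pow 2) ?_ ?_ ht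
  · rw [h0, sub_self, map_zero, norm_zero] at hg
    have hz : ‖DL 0 (u t - v t)‖ ^ 2 ≤ 0 := hg.trans (by simp)
    have hz' : DL 0 (u t - v t) = 0 := by
      rw [← norm_eq_zero]
      exact pow_eq_zero_iff (two_ne_zero) |>.1 (le_antisymm hz (sq_nonneg _))
    rw [map_sub, sub_eq_zero] at hz'
    exact D_ext hz'
  · intro s hs
    have hs' : s ∈ Icc 0 S \ {0} := ⟨Ioo_subset_Icc_self hs, hs.1.ne'⟩
    have h1 := (hwu s hs').1.hasDerivAt (Icc_mem_nhds hs.1 hs.2)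
    have h2 := (hwv s hs').1.hasDerivAt (Icc_mem_nhds hs.1 hs.2)
    exact ((DL 0).hasFDerivAt.comp_hasDerivAt s (h1.sub h2)).norm_sq
  · intro s hs
    have hs' : s ∈ Icc 0 S \ {0} := ⟨Ioo_subset_Icc_self hs, hs.1.ne'⟩
    obtain ⟨-, r, hr, er⟩ := hwu s hs'
    obtain ⟨-, q, hq, eq⟩ := hwv s hs'
    have := hb (u s) (v s) r q (hpos s hs'.1) ((hMu s hs'.1).trans (le_max_left _ _))
      ((hMv s hs'.1).trans (le_max_right _ _)) hr hq
    rw [← er, ← eq, ← D_sub] at this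
    rw [D_eq, D_eq] at this
    linarith

/-! ### Galerkin approximations -/

/-- A finite combination of fixed smooth functions with coefficients that are continuously
differentiable in a parameter. -/
def IsC1Family {E : Type} [NormedAddCommGroup E] [NormedSpace ℝ E] (g : E → Per) : Prop :=
  ∃ (ι : Type) (_ : Fintype ι) (a : ι → E → ℝ) (p : ι → Per),
    (∀ i, ContDiff ℝ 1 (a i)) ∧ ∀ y, g y = ∑ i, a i y • p i

namespace IsC1Family

variable {E : Type} [NormedAddCommGroup E] [NormedSpace ℝ E] {g g' : E → Per}

theorem const (p : Per) : IsC1Family fun _ : E => p :=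
  ⟨Unit, inferInstance, fun _ _ => 1, fun _ => p, fun _ => contDiff_const, fun _ => by simp⟩

theorem add (h : IsC1Family g) (h' : IsC1Family g') : IsC1Family fun y => g y + g' y := by
  obtain ⟨ι, _, a, p, ha, e⟩ := h
  obtain ⟨ι', _, a', p', ha', e'⟩ := h'
  refine ⟨ι ⊕ ι', inferInstance, Sum.elim a a', Sum.elim p p', ?_, fun y => ?_⟩
  · rintro (i | i)
    · exact ha i
    · exact ha' i
  · simp only [e, e', Fintype.sum_sum_type]; rfl

theorem mul (h : IsC1Family g) (h' : IsC1Family g') : IsC1Family fun y => g y * g' y := by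
  obtain ⟨ι, _, a, p, ha, e⟩ := h
  obtain ⟨ι', _, a', p', ha', e'⟩ := h'
  refine ⟨ι × ι', inferInstance, fun i y => a i.1 y * a' i.2 y, fun i => p i.1 * p' i.2,
    fun i => (ha _).mul (ha' _), fun y => ?_⟩
  simp only [e, e', Finset.sum_mul_sum, Fintype.sum_prod_type]
  exact Finset.sum_congr rfl fun i _ => Finset.sum_congr rfl fun j _ => by
    rw [smul_mul_smul_comm]

theorem linear (h : IsC1Family g) (L : Module.End ℝ Per) : IsC1Family fun y => L (g y) := by
  obtain ⟨ι, _, a, p, ha, e⟩ := h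
  refine ⟨ι, inferInstance, a, fun i => L (p i), ha, fun y => ?_⟩
  simp only [e, map_sum]
  exact Finset.sum_congr rfl fun i _ => map_smul _ _ _

theorem contDiff_integ (h : IsC1Family g) : ContDiff ℝ 1 fun y => integ (g y) := by
  obtain ⟨ι, _, a, p, ha, e⟩ := h
  have : (fun y => integ (g y)) = fun y => ∑ i, a i y * integ (p i) := by
    funext y
    rw [e, map_sum]
    exact Finset.sum_congr rfl fun i _ => by rw [map_smul, smul_eq_mul]
  rw [this]
  exact ContDiff.sum fun i _ => (ha i).mul contDiff_const

theorem vf (h : IsC1Family g) (c θ : ℝ) : IsC1Family fun y => vf c θ (g y) := by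
  have hh : IsC1Family fun y => height c (g y) := (const _).add h
  have hG : IsC1Family fun y => totalFlux c θ (g y) := by
    have h1 := (h.mul h).linear ((θ / 2) • LinearMap.id)
    have h2 := ((hh.mul hh).mul hh).mul (h.linear press)
    have := h1.add h2
    simpa [totalFlux, pow_succ] using this
  exact hG.linear (-der)

end IsC1Family

/-- Extension by zero of coefficients given on a finite set of frequencies. -/
def extend (s : Finset ℤ) (y : s → ℝ) (k : ℤ) : ℝ := if h : k ∈ s then y ⟨k, h⟩ else 0

theorem isC1Family_synth (s : Finset ℤ) : IsC1Family fun y : s → ℝ => synth s (extend s y) := by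
  refine ⟨s, inferInstance, fun k y => y k, fun k => hart k, fun k => contDiff_apply ℝ ℝ k,
    fun y => ?_⟩
  simp only [synth]
  rw [← Finset.sum_coe_sort]
  exact Finset.sum_congr rfl fun k _ => by simp [extend]

theorem exists_global_ode {E : Type*} [NormedAddCommGroup E] [NormedSpace ℝ E]
    [FiniteDimensional ℝ E] {G : E → E} (hG : ContDiff ℝ 1 G) (hs : HasCompactSupport G) (x₀ : E) :
    ∃ y : ℝ → E, y 0 = x₀ ∧ ∀ t ∈ Icc (0 : ℝ) 1, HasDerivAt y (G (y t)) t := by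
  have : CompleteSpace E := FiniteDimensional.complete ℝ E
  obtain ⟨K, hK⟩ := hG.lipschitzWith_of_hasCompactSupport hs one_ne_zero
  obtain ⟨L, hL⟩ := hG.continuous.bounded_above_of_compact_support hs
  lift L to NNReal using (norm_nonneg _).trans (hL x₀)
  have hpl : IsPicardLindelof (fun _ => G) (tmin := -2) (tmax := 2) ⟨0, by norm_num⟩ x₀
      (2 * L) 0 L K := by
    refine IsPicardLindelof.of_time_independent (fun x _ => hL x) hK.lipschitzOnWith ?_
    simp [mul_comm]
  obtain ⟨y, hy0, hy⟩ := hpl.exists_eq_forall_mem_Icc_hasDerivWithinAt₀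
  refine ⟨y, hy0, fun t ht => (hy t ⟨by linarith [ht.1], by linarith [ht.2]⟩).hasDerivAt ?_⟩
  exact Icc_mem_nhds (by linarith [ht.1]) (by linarith [ht.2])

/-- The Galerkin system with a cutoff `χ` that switches the vector field off once the solution has
moved by more than a fixed amount in `H³`. The cutoff makes the system globally solvable, and makes
the energy inequalities hold without any restriction on time. -/
theorem exists_cutoff_galerkin (c θ : ℝ) (n : ℕ) (y₀ : ℤ → ℝ) {ε : ℝ} (hε : 0 < ε) :
    ∃ (y : ℝ → ℤ → ℝ) (χ : ℝ → ℝ), (∀ k ∈ modes n, y 0 k = y₀ k) ∧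
      (∀ t, 0 ≤ χ t ∧ χ t ≤ 1) ∧
      (∀ t ∈ Icc (0 : ℝ) 1, ∀ k ∈ modes n, HasDerivAt (fun t => y t k)
        (χ t * integ (hart k * vf c θ (synth (modes n) (y t)))) t) ∧
      (∀ t, χ t ≠ 0 →
        ‖toL2 ((der ^ 3) (synth (modes n) (y t) - synth (modes n) y₀))‖ ^ 2 ≤ 2 * ε ^ 2) ∧
      ∀ t, ‖toL2 ((der ^ 3) (synth (modes n) (y t) - synth (modes n) y₀))‖ ^ 2 ≤ ε ^ 2 →
        χ t = 1 := by
  set s := modes n with hs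
  set p₀ := synth s y₀ with hp₀
  let Φ : (s → ℝ) → Per := fun y => synth s (extend s y)
  have hΦ : IsC1Family Φ := isC1Family_synth s
  let q : (s → ℝ) → ℝ := fun y => ‖toL2 ((der ^ 3) (Φ y - p₀))‖ ^ 2
  have hq : ContDiff ℝ 1 q := by
    have h1 : IsC1Family fun y => (der ^ 3) (Φ y + -p₀) := (hΦ.add (IsC1Family.const _)).linear _
    have := (h1.mul h1).contDiff_integ
    convert this using 2 with y
    show ‖toL2 ((der ^ 3) (Φ y - p₀))‖ ^ 2 = _
    rw [norm_toL2_sq, sub_eq_add_neg]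
  let χ : (s → ℝ) → ℝ := fun y => Real.smoothTransition (2 - q y / ε ^ 2)
  have hχ : ContDiff ℝ 1 χ :=
    (Real.smoothTransition.contDiff (n := 1)).comp (contDiff_const.sub (hq.div_const _))
  let G : (s → ℝ) → (s → ℝ) := fun y k => χ y * integ (hart k * vf c θ (Φ y))
  have hG : ContDiff ℝ 1 G := contDiff_pi.2 fun k =>
    hχ.mul (((IsC1Family.const _).mul (hΦ.vf c θ)).contDiff_integ)
  have hχq : ∀ y, χ y ≠ 0 → q y ≤ 2 * ε ^ 2 := by
    intro y hy
    by_contra! hlt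
    refine hy (Real.smoothTransition.zero_of_nonpos ?_)
    have : 2 ≤ q y / ε ^ 2 := by rw [le_div_iff₀ (by positivity)]; exact hlt.le
    linarith
  have hsupp : HasCompactSupport G := by
    refine HasCompactSupport.of_support_subset_isCompact
      (isCompact_closedBall (fun k : s => y₀ k) ((4 * Real.pi) ^ 3 * (2 * ε))) fun y hy => ?_
    have hy' : χ y ≠ 0 := by
      intro h0
      refine hy (funext fun k => ?_)
      show χ y * _ = 0
      rw [h0, zero_mul]
    have h1 := hχq y hy'
    have hsub : Φ y - p₀ = synth s fun k => extend s y k - y₀ k := by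
      simp only [Φ, hp₀, synth, ← Finset.sum_sub_distrib, sub_smul]
    have hint : integ (Φ y - p₀) = 0 := by rw [map_sub, integ_synth, integ_synth, sub_zero]
    have h2 := norm_toL2_pow_der_le_uniform hint (j := 0) (k := 3) (n := 3) (by norm_num) le_rfl
    have h3 : ‖toL2 ((der ^ 3) (Φ y - p₀))‖ ≤ 2 * ε := by
      refine abs_le_of_sq_le_sq' ?_ (by positivity) |>.2
      refine h1.trans ?_
      nlinarith [sq_nonneg ε]
    have h4 : ‖toL2 (Φ y - p₀)‖ ≤ (4 * Real.pi) ^ 3 * (2 * ε) :=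
      h2.trans (mul_le_mul_of_nonneg_left h3 (by positivity))
    rw [Metric.mem_closedBall, dist_pi_le_iff (by positivity)]
    intro k
    refine le_trans ?_ h4
    rw [Real.dist_eq]
    refine abs_le_of_sq_le_sq' ?_ (norm_nonneg _) |>.2
    rw [hsub, norm_toL2_synth_sq, sq_abs]
    have h5 := Finset.single_le_sum (f := fun k => (extend s y k - y₀ k) ^ 2)
      (fun _ _ => sq_nonneg _) k.2
    simpa [extend] using h5
  obtain ⟨y, hy0, hy⟩ := exists_global_ode hG hsupp fun k => y₀ k
  refine ⟨fun t => extend s (y t), fun t => χ (y t), ?_, ?_, ?_, fun t => hχq (y t), ?_⟩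
  · intro k hk
    simp [extend, hk, hy0]
  · exact fun t => ⟨Real.smoothTransition.nonneg _, Real.smoothTransition.le_one _⟩
  · intro t ht k hk
    have h1 := hasDerivAt_pi.1 (hy t ht) ⟨k, hk⟩
    simpa only [extend, hk, dif_pos] using h1
  · intro t ht
    refine Real.smoothTransition.one_of_one_le ?_
    have : q (y t) / ε ^ 2 ≤ 1 := by rw [div_le_one (by positivity)]; exact ht
    linarith

/-- Iterated interpolation: a function that is small in `L²` and bounded in `H^{j+1}` is small in
`Hʲ`. -/
theorem norm_pow_der_interpolate {f : Per} {B : ℝ} (j : ℕ)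
    (hB : ∀ i ≤ j + 1, ‖toL2 ((der ^ i) f)‖ ≤ B) :
    ‖toL2 ((der ^ j) f)‖ ^ 2 ^ j ≤ ‖toL2 f‖ * B ^ (2 ^ j - 1) := by
  have hB0 : 0 ≤ B := (norm_nonneg _).trans (hB 0 (Nat.zero_le _))
  induction j with
  | zero => simp
  | succ j ih =>
    have h1 := norm_toL2_der_sq_le ((der ^ j) f)
    rw [← pow_der_succ, ← pow_der_succ] at h1
    have h2 : ‖toL2 ((der ^ (j + 1)) f)‖ ^ 2 ≤ ‖toL2 ((der ^ j) f)‖ * B :=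
      h1.trans (mul_le_mul_of_nonneg_left (hB _ (by omega)) (norm_nonneg _))
    have h3 := pow_le_pow_left₀ (sq_nonneg _) h2 (2 ^ j)
    rw [← pow_mul, mul_pow, ← pow_succ'] at h3
    have h4 := mul_le_mul_of_nonneg_right (ih fun i hi => hB i (by omega))
      (pow_nonneg hB0 (2 ^ j))
    refine h3.trans (h4.trans (le_of_eq ?_))
    rw [mul_assoc, ← pow_add]
    congr 2
    have : 1 ≤ 2 ^ j := Nat.one_le_two_pow
    rw [pow_succ]
    omega

theorem hasDerivAt_toL2_synth {s : Finset ℤ} {y : ℝ → ℤ → ℝ} {y' : ℤ → ℝ} {t : ℝ}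
    (A : Module.End ℝ Per) (h : ∀ k ∈ s, HasDerivAt (fun t => y t k) (y' k) t) :
    HasDerivAt (fun t => toL2 (A (synth s (y t)))) (toL2 (A (synth s y'))) t := by
  simp only [synth, map_sum, map_smul]
  exact HasDerivAt.fun_sum fun k hk => (h k hk).smul_const _

theorem hasDerivAt_norm_sq_synth {s : Finset ℤ} {y : ℝ → ℤ → ℝ} {y' : ℤ → ℝ} {t : ℝ}
    (A : Module.End ℝ Per) (q : Per) (h : ∀ k ∈ s, HasDerivAt (fun t => y t k) (y' k) t) :
    HasDerivAt (fun t => ‖toL2 (A (synth s (y t)) - q)‖ ^ 2)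
      (2 * integ ((A (synth s (y t)) - q) * A (synth s y'))) t := by
  simp only [map_sub toL2]
  have := ((hasDerivAt_toL2_synth A h).sub_const (toL2 q)).norm_sq
  rwa [← map_sub, Per.inner_toL2] at this

/-- Trigonometric polynomials of degree at most `n` and mean zero. -/
def IsTrig (n : ℕ) (p : Per) : Prop := ∃ y, p = synth (modes n) y

theorem isTrig_synth (n : ℕ) (y : ℤ → ℝ) : IsTrig n (synth (modes n) y) := ⟨y, rfl⟩

theorem synth_sub (s : Finset ℤ) (y z : ℤ → ℝ) : synth s y - synth s z = synth s (y - z) := by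
  simp only [synth, ← Finset.sum_sub_distrib, ← sub_smul, Pi.sub_apply]

theorem IsTrig.sub {n : ℕ} {p q : Per} (hp : IsTrig n p) (hq : IsTrig n q) :
    IsTrig n (p - q) := by
  obtain ⟨y, rfl⟩ := hp
  obtain ⟨z, rfl⟩ := hq
  exact ⟨_, synth_sub _ _ _⟩

theorem IsTrig.pow_der {n : ℕ} {p : Per} (hp : IsTrig n p) (k : ℕ) : IsTrig n ((der ^ k) p) := by
  induction k with
  | zero => exact hp
  | succ k ih =>
    obtain ⟨y, hy⟩ := ih
    rw [pow_der_succ, hy]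
    exact ⟨_, der_synth n y⟩

/-- Pairing with a trigonometric polynomial does not see the Galerkin projection. -/
theorem IsTrig.integ_mul_synth {n : ℕ} {z : Per} (hz : IsTrig n z) (χ : ℝ) (V : Per) :
    integ (z * synth (modes n) fun k => χ * integ (hart k * V)) = χ * integ (z * V) := by
  obtain ⟨w, rfl⟩ := hz
  rw [Per.integ_mul_synth, mul_comm _ V, Per.integ_mul_synth, Finset.mul_sum]
  refine Finset.sum_congr rfl fun k hk => ?_
  rw [integ_hart_mul_synth hk]
  ring

theorem integ_pow_der_mul_pow_der (k : ℕ) (p q : Per) :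
    integ ((der ^ k) p * (der ^ k) q) = (-1) ^ k * integ ((der ^ (2 * k)) p * q) := by
  rw [integ_mul_pow_der, ← pow_der_add, two_mul]

/-- Time derivative of the Sobolev norms along the (cut off) Galerkin system. -/
theorem hasDerivAt_galerkin_energy {c θ : ℝ} {n : ℕ} {y : ℝ → ℤ → ℝ} {χ t : ℝ}
    (h : ∀ k ∈ modes n, HasDerivAt (fun t => y t k)
      (χ * integ (hart k * vf c θ (synth (modes n) (y t)))) t) (k : ℕ) :
    HasDerivAt (fun t => ‖toL2 ((der ^ k) (synth (modes n) (y t)))‖ ^ 2)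
      (2 * (χ * ((-1) ^ k * integ ((der ^ (2 * k)) (synth (modes n) (y t)) *
        vf c θ (synth (modes n) (y t)))))) t := by
  have h1 := hasDerivAt_norm_sq_synth (der ^ k) 0 h
  simp only [sub_zero] at h1
  rw [integ_pow_der_mul_pow_der,
    ((isTrig_synth n (y t)).pow_der (2 * k)).integ_mul_synth] at h1
  exact h1.congr_deriv (by ring)

theorem hasDerivAt_galerkin_sub {c θ : ℝ} {n : ℕ} {y : ℝ → ℤ → ℝ} {χ t : ℝ} {q : Per}
    (hq : IsTrig n q)
    (h : ∀ k ∈ modes n, HasDerivAt (fun t => y t k)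
      (χ * integ (hart k * vf c θ (synth (modes n) (y t)))) t) :
    HasDerivAt (fun t => ‖toL2 (synth (modes n) (y t) - q)‖ ^ 2)
      (2 * (χ * integ ((synth (modes n) (y t) - q) * vf c θ (synth (modes n) (y t))))) t := by
  have h1 := hasDerivAt_norm_sq_synth LinearMap.id q h
  simp only [LinearMap.id_apply] at h1
  rwa [((isTrig_synth n (y t)).sub hq).integ_mul_synth] at h1

/-- `y` is the coefficient vector of a solution of the Galerkin system of degree `n` on `[0, T]`. -/
def IsGalerkin (c θ : ℝ) (n : ℕ) (T : ℝ) (y : ℝ → ℤ → ℝ) : Prop :=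
  ∀ t ∈ Icc 0 T, ∀ k ∈ modes n,
    HasDerivAt (fun t => y t k) (integ (hart k * vf c θ (synth (modes n) (y t)))) t

/-- Galerkin solutions exist on a time interval that depends only on a bound in `H⁴` and on a lower
bound of the height of the initial value, with uniform bounds. -/
theorem exists_galerkin (c θ m M : ℝ) (hm : 0 < m) :
    ∃ T C L : ℝ, 0 < T ∧ T < 1 ∧ 0 ≤ C ∧ 0 ≤ L ∧ ∀ (n : ℕ) (y₀ : ℤ → ℝ),
      (∀ x, m ≤ c + synth (modes n) y₀ x) → ‖toL2 ((der ^ 4) (synth (modes n) y₀))‖ ≤ M →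
      ∃ y : ℝ → ℤ → ℝ, (∀ k ∈ modes n, y 0 k = y₀ k) ∧ IsGalerkin c θ n T y ∧
        ∀ t ∈ Icc 0 T, (∀ x, m / 2 ≤ c + synth (modes n) (y t) x) ∧
          ‖toL2 ((der ^ 4) (synth (modes n) (y t)))‖ ^ 2 ≤
            ‖toL2 ((der ^ 4) (synth (modes n) y₀))‖ ^ 2 * Real.exp (C * t) ∧
          ‖toL2 (synth (modes n) (y t) - synth (modes n) y₀)‖ ^ 2 ≤ L * t := by
  set Q : ℝ := (4 * Real.pi) ^ 4 with hQ
  have hQ0 : 0 < Q := by positivity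
  -- a displacement of `2 ε` in `H³` keeps the height above `m / 2`
  set ε : ℝ := m / (4 * Q) with hε
  have hε0 : 0 < ε := by positivity
  obtain ⟨C₀, hC₀, hen⟩ := exists_energy_bound c θ (m / 2) (2 * ε + 4 * Real.pi * M) (by linarith) 2
  set M₄ : ℝ := |M| * Real.exp (2 * C₀) with hM₄
  obtain ⟨C₁, hC₁, hvf⟩ := exists_norm_vf_le c θ M₄
  set B : ℝ := Q * (M₄ + M₄) with hB
  have hM₄0 : 0 ≤ M₄ := by positivity
  have hB0 : 0 ≤ B := by positivity
  set L : ℝ := C₁ ^ 2 * Real.exp 1 with hL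
  have hL0 : 0 ≤ L := by positivity
  set T : ℝ := min (1 / 2) (ε ^ 16 / (L * B ^ 14 + 1)) with hT
  have hT0 : 0 < T := lt_min (by norm_num) (by positivity)
  have hT1 : T < 1 := (min_le_left _ _).trans_lt (by norm_num)
  refine ⟨T, 2 * C₀, L, hT0, hT1, by positivity, hL0, fun n y₀ hpos hM => ?_⟩
  obtain ⟨y, χ, hy0, hχ, hy, hχ0, hχ1⟩ := exists_cutoff_galerkin c θ n y₀ hε0
  set p₀ := synth (modes n) y₀ with hp₀
  set p : ℝ → Per := fun t => synth (modes n) (y t) with hp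
  have hp0 : p 0 = p₀ := Finset.sum_congr rfl fun k hk => by rw [hy0 k hk]
  have hint : ∀ t, integ (p t) = 0 := fun t => integ_synth _ _
  have hint0 : integ p₀ = 0 := integ_synth _ _
  have hintz : ∀ t, integ (p t - p₀) = 0 := fun t => by rw [map_sub, hint, hint0, sub_zero]
  have hsub3 : ∀ t, χ t ≠ 0 → ‖toL2 ((der ^ 3) (p t - p₀))‖ ≤ 2 * ε := fun t ht => by
    refine abs_le_of_sq_le_sq' ?_ (by positivity) |>.2
    refine (hχ0 t ht).trans ?_
    nlinarith [sq_nonneg ε]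
  have hheight : ∀ t, ‖toL2 ((der ^ 3) (p t - p₀))‖ ≤ 2 * ε → ∀ x, m / 2 ≤ c + p t x := by
    intro t ht x
    have h1 := norm_toC_pow_der_le_uniform (hintz t) (j := 0) (k := 3) (n := 4) (by norm_num)
      (by norm_num)
    have h2 : Q * ‖toL2 ((der ^ 3) (p t - p₀))‖ ≤ Q * (2 * ε) :=
      mul_le_mul_of_nonneg_left ht hQ0.le
    have h3 : Q * (2 * ε) = m / 2 := by rw [hε]; field_simp; norm_num
    have h4 := (abs_apply_le (p t - p₀) x).trans ((h1.trans h2).trans h3.le)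
    rw [sub_apply, abs_le] at h4
    linarith [hpos x, h4.1]
  have hf : ∀ t ∈ Icc (0 : ℝ) 1, ‖toL2 ((der ^ 4) (p t))‖ ^ 2 ≤
      ‖toL2 ((der ^ 4) p₀)‖ ^ 2 * Real.exp (2 * C₀ * t) := by
    intro t ht
    have hd := fun t ht => hasDerivAt_galerkin_energy (hy t ht) 4
    have := gronwall_le (f := fun t => ‖toL2 ((der ^ 4) (p t))‖ ^ 2) (K := 2 * C₀) (ε := 0)
      (by positivity) le_rfl (fun t ht => (hd t ht).continuousAt.continuousWithinAt)
      (fun t ht => hd t (Ioo_subset_Icc_self ht)) ?_ ht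
    · simpa [hp0] using this
    · intro t ht
      rw [add_zero]
      rcases eq_or_ne (χ t) 0 with h0 | h0
      · rw [h0, zero_mul, mul_zero]; positivity
      · have h3 : ‖toL2 ((der ^ 3) (p t))‖ ≤ 2 * ε + 4 * Real.pi * M := by
          have e : (der ^ 3) (p t) = (der ^ 3) (p t - p₀) + (der ^ 3) p₀ := by
            rw [← map_add, sub_add_cancel]
          rw [e, map_add]
          refine (norm_add_le _ _).trans (add_le_add (hsub3 t h0) ?_)
          have := norm_toL2_pow_der_le hint0 (j := 3) (k := 4) (by norm_num)
          norm_num at this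
          exact this.trans (mul_le_mul_of_nonneg_left hM (by positivity))
        have h4 := hen (p t) (hint t) (hheight t (hsub3 t h0)) h3
        have h5 := hχ t
        have h6 : 0 ≤ C₀ * ‖toL2 ((der ^ 4) (p t))‖ ^ 2 := by positivity
        have h7 : (-1) ^ 4 * integ ((der ^ (2 * 4)) (p t) * vf c θ (p t)) ≤
            C₀ * ‖toL2 ((der ^ 4) (p t))‖ ^ 2 := by
          refine h4.trans ?_
          have : 0 ≤ (m / 2) ^ 3 / 2 * ‖toL2 ((der ^ (2 + 4)) (p t))‖ ^ 2 := by positivity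
          linarith
        have h8 := mul_le_mul_of_nonneg_left h7 h5.1
        have h9 := mul_le_mul_of_nonneg_right h5.2 h6
        linarith
  have hM₄b : ∀ t ∈ Icc (0 : ℝ) 1, ‖toL2 ((der ^ 4) (p t))‖ ≤ M₄ := by
    intro t ht
    refine abs_le_of_sq_le_sq' ?_ hM₄0 |>.2
    refine (hf t ht).trans ?_
    rw [hM₄, mul_pow, sq_abs, ← Real.exp_nat_mul]
    refine mul_le_mul (pow_le_pow_left₀ (norm_nonneg _) hM 2) (Real.exp_le_exp.2 ?_)
      (Real.exp_pos _).le (sq_nonneg _)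
    push_cast
    nlinarith [ht.2, ht.1]
  have hg : ∀ t ∈ Icc (0 : ℝ) 1, ‖toL2 (p t - p₀)‖ ^ 2 ≤ L * t := by
    intro t ht
    have hd := fun t ht => hasDerivAt_galerkin_sub (isTrig_synth n y₀) (hy t ht)
    have := gronwall_le (f := fun t => ‖toL2 (p t - p₀)‖ ^ 2) (K := 1) (ε := C₁ ^ 2)
      (by positivity) (sq_nonneg _) (fun t ht => (hd t ht).continuousAt.continuousWithinAt)
      (fun t ht => hd t (Ioo_subset_Icc_self ht)) ?_ ht
    · simp only [hp0, sub_self, map_zero, norm_zero, sub_zero, one_mul] at this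
      refine this.trans ?_
      have h1 : Real.exp t ≤ Real.exp 1 := Real.exp_le_exp.2 ht.2
      have h2 := mul_le_mul_of_nonneg_left h1 (mul_nonneg (sq_nonneg C₁) ht.1)
      rw [hL]
      linarith
    · intro t ht
      have h1 := integ_mul_le (p t - p₀) (vf c θ (p t))
      have h2 := hvf (p t) (hint t) (hM₄b t (Ioo_subset_Icc_self ht))
      have h3 := mul_le_mul_of_nonneg_left h2 (norm_nonneg (toL2 (p t - p₀)))
      have h4 := two_mul_le_add_sq ‖toL2 (p t - p₀)‖ C₁
      have h5 := hχ t
      have h6 : 0 ≤ ‖toL2 (p t - p₀)‖ * C₁ := by positivity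
      have h7 := mul_le_mul_of_nonneg_left (h1.trans h3) h5.1
      have h8 := mul_le_mul_of_nonneg_right h5.2 h6
      linarith
  have hTt : ∀ t ∈ Icc 0 T, t ∈ Icc (0 : ℝ) 1 := fun t ht => ⟨ht.1, ht.2.trans hT1.le⟩
  have h3 : ∀ t ∈ Icc 0 T, ‖toL2 ((der ^ 3) (p t - p₀))‖ ≤ ε := by
    intro t ht
    have h4 : ‖toL2 ((der ^ 4) (p t - p₀))‖ ≤ M₄ + M₄ := by
      rw [map_sub, map_sub]
      refine (norm_sub_le _ _).trans (add_le_add (hM₄b t (hTt t ht)) ?_)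
      rw [← hp0]
      exact hM₄b 0 ⟨le_rfl, zero_le_one⟩
    have h5 := norm_pow_der_interpolate (f := p t - p₀) (B := B) 3 fun i hi =>
      (norm_toL2_pow_der_le_uniform (hintz t) hi le_rfl).trans
        (mul_le_mul_of_nonneg_left h4 hQ0.le)
    norm_num at h5
    have h6 : ‖toL2 ((der ^ 3) (p t - p₀))‖ ^ 16 ≤ ε ^ 16 := by
      calc ‖toL2 ((der ^ 3) (p t - p₀))‖ ^ 16 = (‖toL2 ((der ^ 3) (p t - p₀))‖ ^ 8) ^ 2 := by ring
        _ ≤ (‖toL2 (p t - p₀)‖ * B ^ 7) ^ 2 := by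
            refine pow_le_pow_left₀ (by positivity) ?_ 2
            rw [map_sub, map_sub, map_sub]
            exact h5
        _ = ‖toL2 (p t - p₀)‖ ^ 2 * B ^ 14 := by ring
        _ ≤ L * t * B ^ 14 := by
            have := hg t (hTt t ht)
            gcongr
        _ ≤ (L * B ^ 14 + 1) * t := by nlinarith [ht.1]
        _ ≤ (L * B ^ 14 + 1) * (ε ^ 16 / (L * B ^ 14 + 1)) := by
            have := ht.2.trans (min_le_right _ _)
            gcongr
        _ = ε ^ 16 := by field_simp
    exact le_of_pow_le_pow_left₀ (by norm_num) hε0.le h6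
  refine ⟨y, hy0, fun t ht k hk => ?_, fun t ht => ⟨?_, hf t (hTt t ht), hg t (hTt t ht)⟩⟩
  · have h1 := hy t (hTt t ht) k hk
    rwa [hχ1 t (pow_le_pow_left₀ (norm_nonneg _) (h3 t ht) 2), one_mul] at h1
  · exact hheight t ((h3 t ht).trans (by linarith))

/-! ### Smoothing and convergence of the Galerkin approximations -/

/-- The a priori information on a Galerkin solution that all its further bounds depend on. -/
structure IsBoundedGalerkin (c θ m M T : ℝ) (n : ℕ) (y : ℝ → ℤ → ℝ) : Prop where
  galerkin : IsGalerkin c θ n T y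
  pos : ∀ t ∈ Icc 0 T, ∀ x, m ≤ c + synth (modes n) (y t) x
  bound : ∀ t ∈ Icc 0 T, ‖toL2 ((der ^ 4) (synth (modes n) (y t)))‖ ≤ M

theorem IsBoundedGalerkin.hasDerivAt_energy {c θ m M T : ℝ} {n : ℕ} {y : ℝ → ℤ → ℝ}
    (h : IsBoundedGalerkin c θ m M T n y) {t : ℝ} (ht : t ∈ Icc 0 T) (k : ℕ) :
    HasDerivAt (fun t => ‖toL2 ((der ^ k) (synth (modes n) (y t)))‖ ^ 2)
      (2 * ((-1) ^ k * integ ((der ^ (2 * k)) (synth (modes n) (y t)) *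
        vf c θ (synth (modes n) (y t))))) t := by
  have := hasDerivAt_galerkin_energy (c := c) (θ := θ) (n := n) (y := y) (χ := 1) (t := t)
    (fun k hk => by rw [one_mul]; exact h.galerkin t ht k hk) k
  rwa [one_mul] at this

/-- Parabolic smoothing: Galerkin solutions are bounded in every `Hᵏ` for positive times, uniformly
in the degree. A bound in `Hᵏ` is improved to `Hᵏ⁺¹` through the functional
`λ ‖∂ᵏp‖² + (t - σ) ‖∂ᵏ⁺¹p‖²`, whose growth is absorbed by the dissipation at level `k`. -/
theorem exists_smoothing_bound (c θ m M T : ℝ) (hm : 0 < m) (hT : 0 < T) (k : ℕ) :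
    ∀ τ, 0 < τ → ∃ B : ℝ, ∀ (n : ℕ) (y : ℝ → ℤ → ℝ), IsBoundedGalerkin c θ m M T n y →
      ∀ t ∈ Icc τ T, ‖toL2 ((der ^ (k + 4)) (synth (modes n) (y t)))‖ ≤ B := by
  induction k with
  | zero =>
    intro τ hτ
    exact ⟨M, fun n y h t ht => by
      rw [zero_add]
      exact h.bound t ⟨hτ.le.trans ht.1, ht.2⟩⟩
  | succ k ih =>
    intro τ hτ
    obtain ⟨B, hB⟩ := ih (τ / 2) (by linarith)
    obtain ⟨C, hC, hen⟩ := exists_energy_bound c θ m (4 * Real.pi * B) hm (k + 2)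
    obtain ⟨C', hC', hen'⟩ := exists_energy_bound c θ m B hm (k + 3)
    set lam : ℝ := (4 * Real.pi) ^ 2 * (1 + 2 * C' * T) / m ^ 3 with hlam
    have hlam0 : 0 ≤ lam := by positivity
    have hm3 : 0 < m ^ 3 := pow_pos hm 3
    set R : ℝ := lam * B ^ 2 + 2 * lam * C * B ^ 2 * T with hR
    have hR0 : 0 ≤ R := by positivity
    refine ⟨Real.sqrt (R / (τ / 2)), fun n y h t ht => ?_⟩
    refine Real.le_sqrt_of_sq_le ?_
    rw [le_div_iff₀ (by linarith)]
    set p : ℝ → Per := fun t => synth (modes n) (y t) with hp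
    have hint : ∀ t, integ (p t) = 0 := fun t => integ_synth _ _
    have hIcc : ∀ s ∈ Icc (τ / 2) T, s ∈ Icc 0 T := fun s hs => ⟨by linarith [hs.1], hs.2⟩
    have hd : ∀ s ∈ Icc (τ / 2) T, HasDerivAt
        (fun s => lam * ‖toL2 ((der ^ (k + 4)) (p s))‖ ^ 2 +
          (s - τ / 2) * ‖toL2 ((der ^ (k + 5)) (p s))‖ ^ 2) _ s := fun s hs =>
      ((h.hasDerivAt_energy (hIcc s hs) (k + 4)).const_mul lam).add
        (((hasDerivAt_id s).sub_const (τ / 2)).mul (h.hasDerivAt_energy (hIcc s hs) (k + 5)))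
    have hts : t ∈ Icc (τ / 2) T := ⟨by linarith [ht.1], ht.2⟩
    have hg := gronwall_le (K := 0) (ε := 2 * lam * C * B ^ 2) le_rfl (by positivity)
      (fun s hs => (hd s hs).continuousAt.continuousWithinAt)
      (fun s hs => hd s (Ioo_subset_Icc_self hs)) ?_ hts
    · simp only [sub_self, zero_mul, Real.exp_zero, mul_one, add_zero] at hg
      have h1 := hB n y h (τ / 2) ⟨le_rfl, hts.1.trans hts.2⟩
      have h2 : lam * ‖toL2 ((der ^ (k + 4)) (p (τ / 2)))‖ ^ 2 ≤ lam * B ^ 2 := by gcongr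
      have h3 : 2 * lam * C * B ^ 2 * (t - τ / 2) ≤ 2 * lam * C * B ^ 2 * T := by
        have : t - τ / 2 ≤ T := by linarith [ht.2]
        gcongr
      have h4 : 0 ≤ lam * ‖toL2 ((der ^ (k + 4)) (p t))‖ ^ 2 := by positivity
      have h5 : τ / 2 * ‖toL2 ((der ^ (k + 5)) (p t))‖ ^ 2 ≤
          (t - τ / 2) * ‖toL2 ((der ^ (k + 5)) (p t))‖ ^ 2 := by
        have : τ / 2 ≤ t - τ / 2 := by linarith [ht.1]
        gcongr
      show ‖toL2 ((der ^ (k + 5)) (p t))‖ ^ 2 * (τ / 2) ≤ R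
      linarith
    · intro s hs
      have hs' := Ioo_subset_Icc_self hs
      have hB4 := hB n y h s hs'
      have hB3 : ‖toL2 ((der ^ (k + 3)) (p s))‖ ≤ 4 * Real.pi * B := by
        have := norm_toL2_pow_der_le (hint s) (j := k + 3) (k := k + 4) (by omega)
        rw [show k + 4 - (k + 3) = 1 by omega, pow_one] at this
        exact this.trans (mul_le_mul_of_nonneg_left hB4 (by positivity))
      have e1 := hen (p s) (hint s) (h.pos s (hIcc s hs')) hB3
      have e2 := hen' (p s) (hint s) (h.pos s (hIcc s hs')) hB4
      have e56 : ‖toL2 ((der ^ (k + 5)) (p s))‖ ^ 2 ≤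
          (4 * Real.pi) ^ 2 * ‖toL2 ((der ^ (k + 6)) (p s))‖ ^ 2 := by
        have := norm_toL2_pow_der_le (hint s) (j := k + 5) (k := k + 6) (by omega)
        rw [show k + 6 - (k + 5) = 1 by omega, pow_one] at this
        rw [← mul_pow]
        exact pow_le_pow_left₀ (norm_nonneg _) this 2
      have e1' : (-1) ^ (k + 4) * integ ((der ^ (2 * (k + 4))) (p s) * vf c θ (p s)) ≤
          -(m ^ 3 / 2) * ‖toL2 ((der ^ (k + 6)) (p s))‖ ^ 2 + C * B ^ 2 := by
        refine e1.trans ?_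
        have : C * ‖toL2 ((der ^ (k + 4)) (p s))‖ ^ 2 ≤ C * B ^ 2 := by gcongr
        show -(m ^ 3 / 2) * ‖toL2 ((der ^ (k + 6)) (p s))‖ ^ 2 +
          C * ‖toL2 ((der ^ (k + 4)) (p s))‖ ^ 2 ≤ _
        linarith
      have e2' : (-1) ^ (k + 5) * integ ((der ^ (2 * (k + 5))) (p s) * vf c θ (p s)) ≤
          C' * ‖toL2 ((der ^ (k + 5)) (p s))‖ ^ 2 := by
        refine e2.trans ?_
        have : 0 ≤ m ^ 3 / 2 * ‖toL2 ((der ^ (k + 3 + 4)) (p s))‖ ^ 2 := by positivity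
        show -(m ^ 3 / 2) * ‖toL2 ((der ^ (k + 3 + 4)) (p s))‖ ^ 2 +
          C' * ‖toL2 ((der ^ (k + 5)) (p s))‖ ^ 2 ≤ _
        linarith
      have t0 : 0 ≤ s - τ / 2 := by linarith [hs.1]
      have t1 : s - τ / 2 ≤ T := by linarith [hs.2]
      have f1 := mul_le_mul_of_nonneg_left e1' hlam0
      have f2 := mul_le_mul_of_nonneg_left e2' t0
      have f3 : (s - τ / 2) * (C' * ‖toL2 ((der ^ (k + 5)) (p s))‖ ^ 2) ≤
          T * (C' * ‖toL2 ((der ^ (k + 5)) (p s))‖ ^ 2) := by gcongr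
      have f4 : (1 + 2 * C' * T) * ‖toL2 ((der ^ (k + 5)) (p s))‖ ^ 2 ≤
          lam * m ^ 3 * ‖toL2 ((der ^ (k + 6)) (p s))‖ ^ 2 := by
        have : lam * m ^ 3 = (4 * Real.pi) ^ 2 * (1 + 2 * C' * T) := by rw [hlam]; field_simp
        rw [this]
        have h0 : 0 ≤ 1 + 2 * C' * T := by positivity
        calc _ ≤ (1 + 2 * C' * T) * ((4 * Real.pi) ^ 2 * ‖toL2 ((der ^ (k + 6)) (p s))‖ ^ 2) := by
              gcongr
          _ = _ := by ring
      rw [zero_mul, zero_add]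
      simp only [id_eq, one_mul]
      linarith

theorem synth_eq_of_subset {s s' : Finset ℤ} (h : s ⊆ s') (y : ℤ → ℝ) :
    synth s y = synth s' fun k => if k ∈ s then y k else 0 := by
  rw [synth, synth, ← Finset.sum_subset h]
  · exact Finset.sum_congr rfl fun k hk => by rw [if_pos hk]
  · intro k _ hk
    rw [if_neg hk, zero_smul]

theorem norm_toL2_der_synth_sq (n : ℕ) (w : ℤ → ℝ) :
    ‖toL2 (der (synth (modes n) w))‖ ^ 2 = ∑ k ∈ modes n, (k : ℝ) ^ 2 * w k ^ 2 := by
  rw [norm_toL2_sq, integ_der_mul, der_synth, der_synth, integ_mul_synth, ← Finset.sum_neg_distrib]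
  refine Finset.sum_congr rfl fun k hk => ?_
  rw [integ_hart_mul_synth hk]
  push_cast
  simp only [neg_neg]
  ring

/-- The part of a trigonometric polynomial of degree above `n₁` is of size `O(1 / n₁)`. -/
theorem norm_toL2_synth_sub_le {n₁ n₂ : ℕ} (h : n₁ ≤ n₂) (w : ℤ → ℝ) :
    (n₁ + 1) * ‖toL2 (synth (modes n₂) w - synth (modes n₁) w)‖ ≤
      ‖toL2 (der (synth (modes n₂) w))‖ := by
  have e : synth (modes n₂) w - synth (modes n₁) w = synth (modes n₂ \ modes n₁) w := by
    rw [synth, synth, synth, ← Finset.sum_sdiff (modes_mono h), add_sub_cancel_right]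
  refine abs_le_of_sq_le_sq' ?_ (norm_nonneg _) |>.2
  rw [mul_pow, e, norm_toL2_synth_sq, norm_toL2_der_synth_sq, Finset.mul_sum]
  refine (Finset.sum_le_sum (g := fun k : ℤ => (k : ℝ) ^ 2 * w k ^ 2) fun k hk => ?_).trans
    (Finset.sum_le_sum_of_subset_of_nonneg Finset.sdiff_subset fun k _ _ => by positivity)
  refine mul_le_mul_of_nonneg_right ?_ (sq_nonneg _)
  rw [Finset.mem_sdiff, mem_modes, mem_modes] at hk
  have h1 : (n₁ : ℤ) + 1 ≤ |k| := by
    by_contra! hlt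
    exact hk.2 ⟨hk.1.1, by omega⟩
  have h2 : (n₁ : ℝ) + 1 ≤ |(k : ℝ)| := by exact_mod_cast h1
  rw [← sq_abs (k : ℝ)]
  exact pow_le_pow_left₀ (by positivity) h2 2

/-- Galerkin solutions of different degrees are close in `L²`. -/
theorem exists_galerkin_difference (c θ m M T : ℝ) (hm : 0 < m) (hT : 0 < T) :
    ∃ K : ℝ, 0 ≤ K ∧ ∀ (n₁ n₂ : ℕ) (y₁ y₂ : ℝ → ℤ → ℝ), n₁ ≤ n₂ →
      IsBoundedGalerkin c θ m M T n₁ y₁ → IsBoundedGalerkin c θ m M T n₂ y₂ →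
      ∀ t ∈ Icc 0 T, ‖toL2 (synth (modes n₂) (y₂ t) - synth (modes n₁) (y₁ t))‖ ^ 2 ≤
        K * (‖toL2 (synth (modes n₂) (y₂ 0) - synth (modes n₁) (y₁ 0))‖ ^ 2 + 1 / (n₁ + 1)) := by
  obtain ⟨C, hC, hdiff⟩ := exists_difference_bound c θ m M hm
  obtain ⟨C₁, hC₁, hvf⟩ := exists_norm_vf_le c θ M
  set Q : ℝ := (4 * Real.pi) ^ 4 with hQ
  set A : ℝ := 2 * (Q * (|M| + |M|)) * C₁ with hA
  have hA0 : 0 ≤ A := by positivity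
  refine ⟨(1 + A * T) * Real.exp (2 * C * T), by positivity, ?_⟩
  intro n₁ n₂ y₁ y₂ hn h₁ h₂ t ht
  set p₁ : ℝ → Per := fun t => synth (modes n₁) (y₁ t) with hp₁
  set p₂ : ℝ → Per := fun t => synth (modes n₂) (y₂ t) with hp₂
  set w : ℝ → ℤ → ℝ := fun t k => y₂ t k - if k ∈ modes n₁ then y₁ t k else 0 with hw
  have hz : ∀ t, p₂ t - p₁ t = synth (modes n₂) (w t) := fun t => by
    rw [hp₂, hp₁]
    simp only
    rw [synth_eq_of_subset (modes_mono hn), synth_sub]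
    rfl
  have hint : ∀ t, integ (p₂ t - p₁ t) = 0 := fun t => by rw [hz, integ_synth]
  have hd : ∀ t ∈ Icc 0 T, HasDerivAt (fun t => ‖toL2 (p₂ t - p₁ t)‖ ^ 2)
      (2 * (integ ((p₂ t - p₁ t) * (vf c θ (p₂ t) - vf c θ (p₁ t))) +
        integ ((p₂ t - p₁ t - synth (modes n₁) (w t)) * vf c θ (p₁ t)))) t := by
    intro t ht
    have h1 : ∀ k ∈ modes n₂, HasDerivAt (fun t => w t k)
        (integ (hart k * vf c θ (p₂ t)) -
          if k ∈ modes n₁ then integ (hart k * vf c θ (p₁ t)) else 0) t := by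
      intro k hk
      refine (h₂.galerkin t ht k hk).sub ?_
      split_ifs with hk'
      · exact h₁.galerkin t ht k hk'
      · exact hasDerivAt_const t 0
    have h2 := hasDerivAt_norm_sq_synth LinearMap.id 0 h1
    simp only [LinearMap.id_apply, sub_zero, ← hz] at h2
    refine h2.congr_deriv ?_
    congr 1
    have h3 := (isTrig_synth n₂ (w t)).integ_mul_synth 1 (vf c θ (p₂ t))
    have h4 := (isTrig_synth n₁ (w t)).integ_mul_synth 1 (vf c θ (p₁ t))
    simp only [one_mul] at h3 h4
    have h5 : integ (synth (modes n₂) (w t) *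
        synth (modes n₁) fun k => integ (hart k * vf c θ (p₁ t))) =
        integ (synth (modes n₁) (w t) *
          synth (modes n₁) fun k => integ (hart k * vf c θ (p₁ t))) := by
      rw [integ_mul_synth, integ_mul_synth]
      refine Finset.sum_congr rfl fun k hk => ?_
      rw [integ_hart_mul_synth (modes_mono hn hk), integ_hart_mul_synth hk]
    have h6 : (synth (modes n₂) fun k => integ (hart k * vf c θ (p₂ t)) -
        if k ∈ modes n₁ then integ (hart k * vf c θ (p₁ t)) else 0) =
        (synth (modes n₂) fun k => integ (hart k * vf c θ (p₂ t))) -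
          synth (modes n₁) fun k => integ (hart k * vf c θ (p₁ t)) := by
      rw [synth_eq_of_subset (modes_mono hn) fun k => integ (hart k * vf c θ (p₁ t)), synth_sub]
      rfl
    rw [h6, mul_sub, map_sub, hz, h3, h5, h4, mul_sub, map_sub, sub_mul, map_sub]
    ring
  have hg := gronwall_le (f := fun t => ‖toL2 (p₂ t - p₁ t)‖ ^ 2) (K := 2 * C)
    (ε := A * (1 / (n₁ + 1))) (by positivity) (by positivity)
    (fun t ht => (hd t ht).continuousAt.continuousWithinAt)
    (fun t ht => hd t (Ioo_subset_Icc_self ht)) ?_ ht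
  · refine hg.trans ?_
    rw [sub_zero]
    set f₀ := ‖toL2 (p₂ 0 - p₁ 0)‖ ^ 2 with hf₀
    have hf₀0 : 0 ≤ f₀ := sq_nonneg _
    have hexp : Real.exp (2 * C * t) ≤ Real.exp (2 * C * T) :=
      Real.exp_le_exp.2 (mul_le_mul_of_nonneg_left ht.2 (by positivity))
    have h1 : f₀ + A * (1 / ((n₁ : ℝ) + 1)) * t ≤ (1 + A * T) * (f₀ + 1 / (n₁ + 1)) := by
      have h2 : A * (1 / ((n₁ : ℝ) + 1)) * t ≤ A * (1 / ((n₁ : ℝ) + 1)) * T :=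
        mul_le_mul_of_nonneg_left ht.2 (by positivity)
      have h3 : 0 ≤ A * T * f₀ + 1 / ((n₁ : ℝ) + 1) := by positivity
      linarith
    have h0 : 0 ≤ f₀ + A * (1 / ((n₁ : ℝ) + 1)) * t := by
      have := ht.1
      positivity
    calc _ ≤ ((1 + A * T) * (f₀ + 1 / (n₁ + 1))) * Real.exp (2 * C * T) :=
          mul_le_mul h1 hexp (Real.exp_pos _).le (h0.trans h1)
      _ = _ := by ring
  · intro s hs
    have hs' := Ioo_subset_Icc_self hs
    have e1 := hdiff (p₂ s) (p₁ s) (integ_synth _ _) (integ_synth _ _) (h₂.pos s hs')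
      (h₂.bound s hs') (h₁.bound s hs')
    rw [← integ_mul_vf_sub] at e1
    have e2 := integ_mul_le (p₂ s - p₁ s - synth (modes n₁) (w s)) (vf c θ (p₁ s))
    have e3 := hvf (p₁ s) (integ_synth _ _) (h₁.bound s hs')
    have e4 := norm_toL2_synth_sub_le hn (w s)
    rw [← hz] at e4
    have e5 : ‖toL2 (der (p₂ s - p₁ s))‖ ≤ Q * (|M| + |M|) := by
      have h1 := norm_toL2_pow_der_le_uniform (hint s) (j := 1) (k := 4) (n := 4) (by norm_num)
        le_rfl
      rw [pow_der_one] at h1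
      refine h1.trans (mul_le_mul_of_nonneg_left ?_ (by positivity))
      rw [map_sub, map_sub]
      exact (norm_sub_le _ _).trans (add_le_add ((h₂.bound s hs').trans (le_abs_self M))
        ((h₁.bound s hs').trans (le_abs_self M)))
    have e6 : ‖toL2 (p₂ s - p₁ s - synth (modes n₁) (w s))‖ ≤
        Q * (|M| + |M|) * (1 / (n₁ + 1)) := by
      rw [mul_one_div, le_div_iff₀ (by positivity)]
      linarith
    have e7 := mul_le_mul e6 e3 (norm_nonneg _) (by positivity)
    have e8 : A * (1 / ((n₁ : ℝ) + 1)) = 2 * (Q * (|M| + |M|) * (1 / (n₁ + 1)) * C₁) := by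
      rw [hA]; ring
    rw [e8]
    linarith

/-! ### Convergence of all derivatives -/

/-- Smooth periodic functions are complete with respect to uniform convergence of all
derivatives. -/
theorem exists_tendsto_of_cauchySeq {p : ℕ → Per}
    (h : ∀ k : ℕ, CauchySeq fun n => toC ((der ^ k) (p n))) :
    ∃ q : Per, ∀ k : ℕ, Tendsto (fun n => toC ((der ^ k) (p n))) atTop
      (𝓝 (toC ((der ^ k) q))) := by
  choose U hU using fun k => cauchySeq_tendsto_of_complete (h k)
  have hunif : ∀ k, TendstoUniformly (fun n (x : ℝ) => ((der ^ k) (p n)) x)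
      (fun x : ℝ => U k (x : Circ)) atTop := by
    intro k
    rw [Metric.tendstoUniformly_iff]
    intro ε hε
    filter_upwards [Metric.tendsto_nhds.1 (hU k) ε hε] with n hn x
    rw [dist_comm]
    exact (ContinuousMap.dist_apply_le_dist (x : Circ)).trans_lt hn
  have hder : ∀ k (x : ℝ), HasDerivAt (fun x : ℝ => U k (x : Circ)) (U (k + 1) (x : Circ)) x := by
    intro k x
    refine hasDerivAt_of_tendstoUniformly (hunif (k + 1)) (Eventually.of_forall fun n x => ?_)
      (fun x => (hunif k).tendsto_at x) x
    rw [pow_der_succ]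
    exact ((der ^ k) (p n)).hasDerivAt x
  have hsmooth : ∀ n k : ℕ, ContDiff ℝ n fun x : ℝ => U k (x : Circ) := by
    intro n
    induction n with
    | zero => exact fun k => contDiff_zero.2 ((U k).continuous.comp (AddCircle.continuous_mk' _))
    | succ n ih =>
      intro k
      push_cast
      rw [contDiff_succ_iff_deriv]
      refine ⟨fun x => (hder k x).differentiableAt, by simp, ?_⟩
      have : deriv (fun x : ℝ => U k (x : Circ)) = fun x : ℝ => U (k + 1) (x : Circ) :=
        funext fun x => (hder k x).deriv
      rw [this]
      exact ih (k + 1)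
  let q : Per := ⟨fun x => U 0 (x : Circ), contDiff_infty.2 fun n => hsmooth n 0, fun x => by simp⟩
  have hq : ∀ k x, ((der ^ k) q) x = U k (x : Circ) := by
    intro k
    induction k with
    | zero => exact fun x => rfl
    | succ k ih =>
      intro x
      rw [pow_der_succ, der_apply]
      have : ((der ^ k) q : ℝ → ℝ) = fun x : ℝ => U k (x : Circ) := funext ih
      rw [this]
      exact (hder k x).deriv
  refine ⟨q, fun k => ?_⟩
  have : toC ((der ^ k) q) = U k := by
    ext x
    induction x using QuotientAddGroup.induction_on with
    | H x => exact hq k x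
  rw [this]
  exact hU k

/-- Locally uniform convergence on `s`, with all space derivatives, of time-dependent smooth
functions to a limit that is continuous in time. -/
def SmoothConv (s : Set ℝ) (p : ℕ → ℝ → Per) (q : ℝ → Per) : Prop :=
  ∀ k : ℕ, TendstoLocallyUniformlyOn (fun n t => toC ((der ^ k) (p n t)))
    (fun t => toC ((der ^ k) (q t))) atTop s ∧ ContinuousOn (fun t => toC ((der ^ k) (q t))) s

namespace SmoothConv

variable {s : Set ℝ} {p p' : ℕ → ℝ → Per} {q q' : ℝ → Per}

theorem const (r : Per) : SmoothConv s (fun _ _ => r) fun _ => r := fun _ =>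
  ⟨fun _ hu _ _ => ⟨s, self_mem_nhdsWithin, Eventually.of_forall fun _ _ _ => refl_mem_uniformity hu⟩,
    continuousOn_const⟩

theorem add (h : SmoothConv s p q) (h' : SmoothConv s p' q') :
    SmoothConv s (fun n t => p n t + p' n t) fun t => q t + q' t := fun k => by
  simp only [map_add]
  exact ⟨(h k).1.fun_add (h' k).1, (h k).2.add (h' k).2⟩

theorem pow_der (h : SmoothConv s p q) (j : ℕ) :
    SmoothConv s (fun n t => (der ^ j) (p n t)) fun t => (der ^ j) (q t) := fun k => by
  simp only [← pow_der_add]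
  exact h (k + j)

theorem der (h : SmoothConv s p q) :
    SmoothConv s (fun n t => der (p n t)) fun t => Per.der (q t) := by
  have := h.pow_der 1
  simpa only [pow_der_one] using this

theorem mul (h : SmoothConv s p q) (h' : SmoothConv s p' q') :
    SmoothConv s (fun n t => p n t * p' n t) fun t => q t * q' t := by
  intro k
  induction k generalizing p p' q q' with
  | zero =>
    have h0 := h 0
    have h0' := h' 0
    simp only [pow_der_zero, map_mul] at h0 h0' ⊢
    exact ⟨h0.1.fun_mul₀ h0'.1 h0.2 h0'.2, h0.2.mul h0'.2⟩
  | succ k ih =>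
    have h1 := ih h.der h'
    have h2 := ih h h'.der
    simp only [pow_der_succ', der_mul, map_add]
    exact ⟨h1.1.fun_add h2.1, h1.2.add h2.2⟩

theorem vf (h : SmoothConv s p q) (c θ : ℝ) :
    SmoothConv s (fun n t => vf c θ (p n t)) fun t => vf c θ (q t) := by
  have hh : SmoothConv s (fun n t => height c (p n t)) fun t => height c (q t) :=
    (const _).add h
  have h1 := (const (algebraMap ℝ Per (θ / 2))).mul (h.mul h)
  have h2 := ((hh.mul hh).mul hh).mul (h.der.add (h.pow_der 3))
  have h3 := (const (-1)).mul (h1.add h2).der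
  simpa only [Per.vf, totalFlux, press_eq, pow_succ, pow_zero, one_mul, neg_one_mul,
    Algebra.smul_def] using h3

theorem tendsto (h : SmoothConv s p q) (k : ℕ) {t : ℝ} (ht : t ∈ s) :
    Tendsto (fun n => toC ((Per.der ^ k) (p n t))) atTop (𝓝 (toC ((Per.der ^ k) (q t)))) :=
  (h k).1.tendsto_at ht

theorem tendsto_toL2 (h : SmoothConv s p q) (k : ℕ) {t : ℝ} (ht : t ∈ s) :
    Tendsto (fun n => toL2 ((Per.der ^ k) (p n t))) atTop (𝓝 (toL2 ((Per.der ^ k) (q t)))) :=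
  ((ContinuousMap.toLp (E := ℝ) 2 (volume : Measure Circ) ℝ).continuous.tendsto _).comp
    (h.tendsto k ht)

theorem tendsto_apply (h : SmoothConv s p q) {t : ℝ} (ht : t ∈ s) (x : ℝ) :
    Tendsto (fun n => p n t x) atTop (𝓝 (q t x)) :=
  ((continuous_eval_const (x : Circ)).tendsto _).comp (h.tendsto 0 ht)

end SmoothConv

/-- A sequence that is Cauchy in `L²` uniformly in time, and bounded in every `Hᵏ` away from time
zero, converges with all derivatives, locally uniformly for positive times. -/
theorem exists_smoothConv {T : ℝ} {p : ℕ → ℝ → Per} (hint : ∀ n t, integ (p n t) = 0)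
    (hbd : ∀ k : ℕ, ∀ τ, 0 < τ → ∃ B : ℝ, ∀ n, ∀ t ∈ Icc τ T, ‖toL2 ((der ^ k) (p n t))‖ ≤ B)
    (hcauchy : ∀ ε > 0, ∃ n₀, ∀ i ≥ n₀, ∀ j ≥ n₀, ∀ t ∈ Icc 0 T, ‖toL2 (p i t - p j t)‖ ≤ ε)
    (hcont : ∀ n k, ContinuousOn (fun t => toC ((der ^ k) (p n t))) (Ioo 0 T)) :
    ∃ q : ℝ → Per, SmoothConv (Ioo 0 T) p q ∧ ∀ t ∈ Ioo 0 T, integ (q t) = 0 := by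
  have hunif : ∀ (k : ℕ) (τ : ℝ), 0 < τ →
      UniformCauchySeqOn (fun n t => toC ((der ^ k) (p n t))) atTop (Icc τ T) := by
    intro k τ hτ
    obtain ⟨B, hB⟩ := hbd (k + 2) τ hτ
    set B' : ℝ := (4 * Real.pi) ^ (k + 2) * (|B| + |B|) with hB'
    have hB'0 : 0 ≤ B' := by positivity
    rw [Metric.uniformCauchySeqOn_iff]
    intro ε hε
    set δ : ℝ := (ε / (8 * Real.pi)) ^ 2 ^ (k + 1) / (B' ^ (2 ^ (k + 1) - 1) + 1) with hδ
    have hδ0 : 0 < δ := by positivity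
    obtain ⟨n₀, hn₀⟩ := hcauchy δ hδ0
    refine ⟨n₀, fun i hi j hj t ht => ?_⟩
    have hz : integ (p i t - p j t) = 0 := by rw [map_sub, hint, hint, sub_zero]
    have h1 := norm_pow_der_interpolate (f := p i t - p j t) (B := B') (k + 1) fun l hl => by
      refine (norm_toL2_pow_der_le_uniform hz (k := k + 2) hl le_rfl).trans
        (mul_le_mul_of_nonneg_left ?_ (by positivity))
      rw [map_sub, map_sub]
      exact (norm_sub_le _ _).trans (add_le_add ((hB i t ht).trans (le_abs_self B))
        ((hB j t ht).trans (le_abs_self B)))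
    have h2 := hn₀ i hi j hj t ⟨hτ.le.trans ht.1, ht.2⟩
    have h3 : ‖toL2 ((der ^ (k + 1)) (p i t - p j t))‖ ^ 2 ^ (k + 1) ≤
        (ε / (8 * Real.pi)) ^ 2 ^ (k + 1) := by
      refine h1.trans ((mul_le_mul_of_nonneg_right h2 (by positivity)).trans ?_)
      rw [hδ, div_mul_eq_mul_div, div_le_iff₀ (by positivity)]
      exact mul_le_mul_of_nonneg_left (by linarith) (by positivity)
    have h4 := le_of_pow_le_pow_left₀ (by positivity) (by positivity) h3
    have h5 := norm_toC_pow_der_le hz (j := k) (k := k + 1) le_rfl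
    rw [show k + 1 - k = 1 by omega, pow_one] at h5
    rw [dist_eq_norm, ← map_sub, ← map_sub]
    refine (h5.trans (mul_le_mul_of_nonneg_left h4 (by positivity))).trans_lt ?_
    rw [show 4 * Real.pi * (ε / (8 * Real.pi)) = ε / 2 by field_simp; norm_num]
    linarith
  have hlim : ∀ t, ∃ q : Per, t ∈ Ioo 0 T → ∀ k : ℕ,
      Tendsto (fun n => toC ((der ^ k) (p n t))) atTop (𝓝 (toC ((der ^ k) q))) := by
    intro t
    by_cases ht : t ∈ Ioo 0 T
    · obtain ⟨q, hq⟩ := exists_tendsto_of_cauchySeq (p := fun n => p n t) fun k =>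
        (hunif k t ht.1).cauchySeq ⟨le_rfl, ht.2.le⟩
      exact ⟨q, fun _ => hq⟩
    · exact ⟨0, fun h => absurd h ht⟩
  choose q hq using hlim
  have hloc : ∀ k : ℕ, TendstoLocallyUniformlyOn (fun n t => toC ((der ^ k) (p n t)))
      (fun t => toC ((der ^ k) (q t))) atTop (Ioo 0 T) := by
    intro k u hu x hx
    have h1 : TendstoUniformlyOn (fun n t => toC ((der ^ k) (p n t)))
        (fun t => toC ((der ^ k) (q t))) atTop (Ioo (x / 2) T) := by
      refine ((hunif k (x / 2) (by linarith [hx.1])).mono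
        Ioo_subset_Icc_self).tendstoUniformlyOn_of_tendsto fun t ht => ?_
      exact hq t ⟨by linarith [ht.1, hx.1], ht.2⟩ k
    exact ⟨Ioo (x / 2) T, mem_nhdsWithin_of_mem_nhds
      (Ioo_mem_nhds (by linarith [hx.1]) hx.2), h1 u hu⟩
  refine ⟨q, fun k => ⟨hloc k, (hloc k).continuousOn (Frequently.of_forall fun n => hcont n k)⟩,
    fun t ht => ?_⟩
  have h1 : Tendsto (fun n => inner ℝ (toL2 1) (toL2 (p n t))) atTop
      (𝓝 (inner ℝ (toL2 1) (toL2 (q t)))) :=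
    tendsto_const_nhds.inner
      (((ContinuousMap.toLp (E := ℝ) 2 (volume : Measure Circ) ℝ).continuous.tendsto _).comp
        (hq t ht 0))
  simp only [Per.inner_toL2, one_mul, hint] at h1
  exact (tendsto_nhds_unique h1 tendsto_const_nhds)

theorem continuousOn_toC_synth {s : Finset ℤ} {y : ℝ → ℤ → ℝ} {I : Set ℝ}
    (h : ∀ k ∈ s, ContinuousOn (fun t => y t k) I) (j : ℕ) :
    ContinuousOn (fun t => toC ((der ^ j) (synth s (y t)))) I := by
  simp only [synth, map_sum, map_smul]
  exact continuousOn_finsetSum _ fun k hk => (h k hk).smul continuousOn_const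

theorem norm_iota_le_toC {p : Per} (hp : integ p = 0) :
    ‖iota p‖ ≤ 3 * (4 * Real.pi) ^ 4 * (2 * Real.pi * ‖toC ((der ^ 4) p)‖) := by
  refine (norm_iota_le hp).trans (mul_le_mul_of_nonneg_left ?_ (by positivity))
  refine abs_le_of_sq_le_sq' ?_ (by positivity) |>.2
  refine (norm_toL2_le_toC _).trans ?_
  have := Real.pi_gt_three
  rw [mul_pow]
  refine mul_le_mul_of_nonneg_right ?_ (sq_nonneg _)
  nlinarith

theorem continuousOn_iota {I : Set ℝ} {r : ℝ → Per} (h0 : ∀ t ∈ I, integ (r t) = 0)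
    (h : ContinuousOn (fun t => toC ((der ^ 4) (r t))) I) :
    ContinuousOn (fun t => iota (r t)) I := by
  intro t ht
  have h1 := tendsto_iff_norm_sub_tendsto_zero.1 (h t ht)
  have h2 := (h1.const_mul (2 * Real.pi)).const_mul (3 * (4 * Real.pi) ^ 4)
  rw [mul_zero, mul_zero] at h2
  refine tendsto_iff_norm_sub_tendsto_zero.2 (squeeze_zero' (Eventually.of_forall fun _ =>
    norm_nonneg _) ?_ h2)
  filter_upwards [self_mem_nhdsWithin] with s hs
  rw [← map_sub, ← map_sub, ← map_sub]
  exact norm_iota_le_toC (by rw [map_sub, h0 s hs, h0 t ht, sub_zero])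

/-- An identity `∂ₜ v = W` can be checked on Hartley coefficients. -/
theorem hasDerivAt_of_coef {a b : ℝ} {v W : ℝ → HDot 4} (hW : ContinuousOn W (Ioo a b))
    (h : ∀ k, ∀ t ∈ Ioo a b, HasDerivAt (fun t => coef (v t) k) (coef (W t) k) t) {t : ℝ}
    (ht : t ∈ Ioo a b) : HasDerivAt v (W t) t := by
  have hint : ∀ s ∈ Ioo a b, HasDerivAt (fun s => ∫ r in t..s, W r) (W s) s := by
    intro s hs
    refine intervalIntegral.integral_hasDerivAt_right ?_ ?_ (hW.continuousAt (isOpen_Ioo.mem_nhds hs))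
    · exact (hW.mono ((convex_Ioo a b).ordConnected.uIcc_subset ht hs)).intervalIntegrable
    · have : SecondCountableTopologyEither ℝ (HDot 4) := secondCountableTopologyEither_of_left ℝ _
      exact hW.stronglyMeasurableAtFilter isOpen_Ioo s hs
  have hcoef : ∀ k, ∀ u : HDot 4, coef u k = (innerSL ℝ (toL2 (hart k))) (DL 0 u) :=
    fun k u => rfl
  have heq : ∀ s ∈ Ioo a b, v s = v t + ∫ r in t..s, W r := by
    intro s hs
    rw [← sub_eq_zero]
    refine D_ext ?_
    have hz : D 0 (0 : HDot 4) = 0 := (DL 0).map_zero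
    rw [hz]
    refine eq_zero_of_inner_hart fun k => ?_
    have hd : ∀ s ∈ Ioo a b, HasDerivAt
        (fun s => coef (v s) k - innerSL ℝ (toL2 (hart k)) (DL 0 (∫ r in t..s, W r))) 0 s := by
      intro s hs
      have h1 := ((innerSL ℝ (toL2 (hart k))).comp (DL 0)).hasFDerivAt.comp_hasDerivAt s (hint s hs)
      exact ((h k s hs).sub h1).congr_deriv (sub_self _)
    have hc := isOpen_Ioo.is_const_of_deriv_eq_zero isPreconnected_Ioo
      (fun s hs => (hd s hs).differentiableAt.differentiableWithinAt)
      (fun s hs => (hd s hs).deriv) hs ht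
    simp only [intervalIntegral.integral_same, map_zero, sub_zero] at hc
    show coef (v s - (v t + ∫ r in t..s, W r)) k = 0
    rw [hcoef, map_sub, map_sub, map_add, map_add, ← hcoef, ← hcoef]
    linarith
  refine ((hint t ht).const_add (v t)).congr_of_eventuallyEq ?_
  filter_upwards [isOpen_Ioo.mem_nhds ht] with s hs
  exact heq s hs

/-! ### Local existence -/

theorem inner_pow_der_D_four (z : HDot 4) (p : Per) :
    inner ℝ (toL2 ((der ^ 4) p)) (D 4 z) = inner ℝ (toL2 ((der ^ 8) p)) (D 0 z) := by
  have h0 := inner_der_D z 0 ((der ^ 7) p)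
  have h1 := inner_der_D z 1 ((der ^ 6) p)
  have h2 := inner_der_D z 2 ((der ^ 5) p)
  have h3 := inner_der_D z 3 ((der ^ 4) p)
  simp only [← pow_der_succ] at h0 h1 h2 h3
  change _ = -inner ℝ _ (D 1 z) at h0
  change inner ℝ _ (D 1 z) = -inner ℝ _ (D 2 z) at h1
  change inner ℝ _ (D 2 z) = -inner ℝ _ (D 3 z) at h2
  change inner ℝ _ (D 3 z) = -inner ℝ _ (D 4 z) at h3
  change inner ℝ (toL2 ((der ^ 8) p)) (D 0 z) = _ at h0
  linarith

/-- Convergence in `L²` is convergence in `Ḣ⁴` if the `Ḣ⁴` norm does not jump up in the limit: the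
fourth derivatives then converge weakly, and their norms do not exceed that of the limit. -/
theorem tendsto_of_norm_D_four_le {v : ℝ → HDot 4} {v₀ : HDot 4} {C L : ℝ} {l : Filter ℝ}
    (hl : l ≤ 𝓝 0) (h4 : ∀ᶠ t in l, ‖D 4 (v t)‖ ^ 2 ≤ ‖D 4 v₀‖ ^ 2 * Real.exp (C * t))
    (h0 : ∀ᶠ t in l, ‖D 0 (v t - v₀)‖ ^ 2 ≤ L * t) : Tendsto v l (𝓝 v₀) := by
  set A : ℝ := ‖D 4 v₀‖ with hA
  have hA0 : 0 ≤ A := norm_nonneg _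
  have hsq : Tendsto (fun t => ‖D 4 (v t - v₀)‖ ^ 2) l (𝓝 0) := by
    rw [Metric.tendsto_nhds]
    intro ε hε
    obtain ⟨n, hn⟩ := ((tendsto_iff_norm_sub_tendsto_zero.1 (tendsto_toL2_pow_der_trunc v₀ 4)).eventually
      (gt_mem_nhds (show 0 < ε / (4 * (3 * A + 1)) by positivity))).exists
    set φ : Per := trunc n v₀ with hφ
    have hn' : ‖D 4 v₀ - toL2 ((der ^ 4) φ)‖ ≤ ε / (4 * (3 * A + 1)) := by
      rw [norm_sub_rev]; exact hn.le
    have hlim : Tendsto (fun t : ℝ => A ^ 2 * (Real.exp (C * t) - 1) +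
        2 * (‖toL2 ((der ^ 8) φ)‖ * Real.sqrt (L * t))) l (𝓝 0) := by
      have hc : Continuous (fun t : ℝ => A ^ 2 * (Real.exp (C * t) - 1) +
        2 * (‖toL2 ((der ^ 8) φ)‖ * Real.sqrt (L * t))) := by fun_prop
      have := (hc.tendsto 0).mono_left hl
      simpa using this
    have hexp : Tendsto (fun t : ℝ => Real.exp (C * t)) l (𝓝 1) := by
      have hc : Continuous (fun t : ℝ => Real.exp (C * t)) := by fun_prop
      have := (hc.tendsto 0).mono_left hl
      simpa using this
    filter_upwards [h4, h0, hlim.eventually (gt_mem_nhds (show 0 < ε / 2 by positivity)),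
      hexp.eventually (gt_mem_nhds (show (1 : ℝ) < 4 by norm_num))] with t h4t h0t hεt het
    set z := v t - v₀ with hz
    have hv : D 4 (v t) = D 4 v₀ + D 4 z := by rw [hz, D_sub]; abel
    have hz4 : ‖D 4 z‖ ≤ 3 * A := by
      have h1 : ‖D 4 (v t)‖ ≤ 2 * A := by
        refine abs_le_of_sq_le_sq' (h4t.trans ?_) (by positivity) |>.2
        nlinarith [sq_nonneg A]
      rw [hz, D_sub]
      exact (norm_sub_le _ _).trans (by linarith)
    have hid : ‖D 4 z‖ ^ 2 = ‖D 4 (v t)‖ ^ 2 - A ^ 2 - 2 * inner ℝ (D 4 v₀) (D 4 z) := by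
      rw [hv, norm_add_sq_real]; ring
    have hinner : inner ℝ (D 4 v₀) (D 4 z) = inner ℝ (D 4 v₀ - toL2 ((der ^ 4) φ)) (D 4 z) +
        inner ℝ (toL2 ((der ^ 8) φ)) (D 0 z) := by
      rw [inner_sub_left, inner_pow_der_D_four]; ring
    have e1 : |inner ℝ (D 4 v₀ - toL2 ((der ^ 4) φ)) (D 4 z)| ≤ ε / 4 := by
      refine (abs_real_inner_le_norm _ _).trans ((mul_le_mul hn' hz4 (norm_nonneg _)
        (by positivity)).trans ?_)
      rw [div_mul_eq_mul_div, div_le_div_iff₀ (by positivity) (by norm_num)]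
      nlinarith
    have e2 : |inner ℝ (toL2 ((der ^ 8) φ)) (D 0 z)| ≤
        ‖toL2 ((der ^ 8) φ)‖ * Real.sqrt (L * t) := by
      refine (abs_real_inner_le_norm _ _).trans (mul_le_mul_of_nonneg_left ?_ (norm_nonneg _))
      exact Real.le_sqrt_of_sq_le h0t
    rw [Real.dist_eq, sub_zero, abs_of_nonneg (sq_nonneg _), hid, hinner]
    rw [abs_le] at e1 e2
    linarith [e1.1, e2.1]
  have h4' : Tendsto (fun t => ‖D 4 (v t - v₀)‖) l (𝓝 0) := by
    have := hsq.sqrt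
    simpa [Real.sqrt_sq (norm_nonneg _)] using this
  rw [tendsto_iff_norm_sub_tendsto_zero]
  have h5 := h4'.const_mul (3 * (4 * Real.pi) ^ 4)
  rw [mul_zero] at h5
  exact squeeze_zero (fun _ => norm_nonneg _) (fun t => norm_le_D_four _) h5

theorem coef_iota {p : Per} (hp : integ p = 0) (k : ℤ) : coef (iota p) k = integ (hart k * p) := by
  rw [coef, D_iota hp]
  exact Per.inner_toL2 _ _

/-- A smooth limit of Galerkin solutions solves the equation. -/
theorem SmoothConv.hasDerivAt_iota {c θ T : ℝ} {d : ℕ → ℕ} {y : ℕ → ℝ → ℤ → ℝ} {q : ℝ → Per}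
    (hd : Tendsto d atTop atTop) (hy : ∀ n, IsGalerkin c θ (d n) T (y n))
    (hq : SmoothConv (Ioo 0 T) (fun n t => synth (modes (d n)) (y n t)) q)
    (hq0 : ∀ t ∈ Ioo 0 T, integ (q t) = 0) :
    ContinuousOn (fun t => iota (Per.vf c θ (q t))) (Ioo 0 T) ∧
      ∀ t ∈ Ioo 0 T, HasDerivAt (fun t => iota (q t)) (iota (Per.vf c θ (q t))) t := by
  have hW : ContinuousOn (fun t => iota (Per.vf c θ (q t))) (Ioo 0 T) :=
    continuousOn_iota (fun t _ => integ_vf _ _ _) ((hq.vf c θ) 4).2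
  refine ⟨hW, fun t ht => hasDerivAt_of_coef hW (fun k t ht => ?_) ht⟩
  have hev : (fun t => coef (iota (q t)) k) =ᶠ[𝓝 t] fun t => integ (hart k * q t) := by
    filter_upwards [isOpen_Ioo.mem_nhds ht] with s hs
    exact coef_iota (hq0 s hs) k
  rw [coef_iota (integ_vf _ _ _)]
  refine HasDerivAt.congr_of_eventuallyEq ?_ hev
  rcases eq_or_ne k 0 with rfl | hk
  · have h0 : ∀ p : Per, integ p = 0 → integ (hart 0 * p) = 0 := fun p hp => by
      rw [← coef_iota hp]; exact inner_hart_zero_D _ 0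
    rw [h0 _ (integ_vf _ _ _)]
    refine (hasDerivAt_const t (0 : ℝ)).congr_of_eventuallyEq ?_
    filter_upwards [isOpen_Ioo.mem_nhds ht] with s hs
    exact h0 _ (hq0 s hs)
  · let ℓ : C(Circ, ℝ) →L[ℝ] ℝ := (innerSL ℝ (toL2 (hart k))).comp
      (ContinuousMap.toLp (E := ℝ) 2 (volume : Measure Circ) ℝ)
    have hℓ : ∀ p : Per, ℓ (toC p) = integ (hart k * p) := fun p => Per.inner_toL2 _ _
    have hU := ℓ.uniformContinuous.comp_tendstoLocallyUniformlyOn ((hq.vf c θ) 0).1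
    have hmem : ∀ᶠ n in atTop, k ∈ modes (d n) := by
      filter_upwards [hd.eventually_ge_atTop k.natAbs] with n hn
      rw [mem_modes]
      exact ⟨hk, by rw [Int.abs_eq_natAbs]; exact_mod_cast hn⟩
    refine hasDerivAt_of_tendstoLocallyUniformlyOn (l := atTop) isOpen_Ioo
      (f := fun n t => integ (hart k * synth (modes (d n)) (y n t)))
      (f' := fun n t => integ (hart k * Per.vf c θ (synth (modes (d n)) (y n t))))
      (g' := fun t => integ (hart k * Per.vf c θ (q t))) ?_ ?_ ?_ ht
    · simp only [← hℓ]
      exact hU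
    · filter_upwards [hmem] with n hn s hs
      refine (hy n s (Ioo_subset_Icc_self hs) k hn).congr_of_eventuallyEq
        (Eventually.of_forall fun r => ?_)
      exact integ_hart_mul_synth hn _
    · intro s hs
      simp only [← hℓ]
      exact (ℓ.continuous.tendsto _).comp (hq.tendsto 0 hs)

/-- Galerkin solutions for the truncations of `v₀` have a smooth limit for positive times, which
inherits their bounds. -/
theorem exists_galerkin_limit (c θ m M : ℝ) (hm : 0 < m) :
    ∃ T C L : ℝ, 0 < T ∧ T < 1 ∧ 0 ≤ C ∧ 0 ≤ L ∧ ∀ v₀ : HDot 4, ‖v₀‖ ≤ M →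
      (∀ᵐ x, m ≤ c + D 0 v₀ x) → ∃ q : ℝ → Per,
        ContinuousOn (fun t => iota (Per.vf c θ (q t))) (Ioo 0 T) ∧
        ∀ t ∈ Ioo 0 T, integ (q t) = 0 ∧
          HasDerivAt (fun t => iota (q t)) (iota (Per.vf c θ (q t))) t ∧
          (∀ x, m / 4 ≤ c + q t x) ∧
          ‖D 4 (iota (q t))‖ ^ 2 ≤ ‖D 4 v₀‖ ^ 2 * Real.exp (C * t) ∧
          ‖D 0 (iota (q t) - v₀)‖ ^ 2 ≤ L * t := by
  obtain ⟨T, C, L, hT, hT1, hC, hL, hG⟩ := exists_galerkin c θ (m / 2) (|M| + 1) (by linarith)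
  refine ⟨T, C, L, hT, hT1, hC, hL, fun v₀ hv₀ hpos => ?_⟩
  set M₄ : ℝ := (|M| + 1) * Real.exp C with hM₄
  obtain ⟨K, hK, hdiff⟩ := exists_galerkin_difference c θ (m / 4) M₄ T (by linarith) hT
  have hlt : ‖D 4 v₀‖ < |M| + 1 := by
    linarith [norm_D_le 4 v₀, le_abs_self M]
  -- from degree `n₀` on, the truncations of `v₀` are admissible initial values
  obtain ⟨n₀, hn₀⟩ := eventually_atTop.1 ((eventually_le_trunc hpos
    (show m / 2 < m by linarith)).and ((tendsto_toL2_pow_der_trunc v₀ 4).norm.eventually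
      (gt_mem_nhds hlt)))
  have hd : Tendsto (fun n => n + n₀) atTop atTop := tendsto_add_atTop_nat n₀
  choose y hy0 hyG hyb using fun n : ℕ => hG (n + n₀) (coef v₀) (hn₀ _ (Nat.le_add_left _ _)).1
    (hn₀ _ (Nat.le_add_left _ _)).2.le
  set p : ℕ → ℝ → Per := fun n t => synth (modes (n + n₀)) (y n t) with hp
  have hp0 : ∀ n, p n 0 = trunc (n + n₀) v₀ := fun n =>
    Finset.sum_congr rfl fun k hk => by rw [hy0 n k hk]
  have hB : ∀ n, IsBoundedGalerkin c θ (m / 4) M₄ T (n + n₀) (y n) := fun n => by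
    refine ⟨hyG n, fun t ht x => ?_, fun t ht => ?_⟩
    · have := (hyb n t ht).1 x
      linarith
    · refine abs_le_of_sq_le_sq' ((hyb n t ht).2.1.trans ?_) (by positivity) |>.2
      have h1 : ‖toL2 ((der ^ 4) (synth (modes (n + n₀)) (coef v₀)))‖ ≤ |M| + 1 :=
        (hn₀ _ (Nat.le_add_left _ _)).2.le
      have h2 : Real.exp (C * t) ≤ Real.exp C ^ 2 := by
        rw [← Real.exp_nat_mul]
        refine Real.exp_le_exp.2 ?_
        push_cast
        nlinarith [ht.1, ht.2]
      rw [hM₄, mul_pow]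
      gcongr
  obtain ⟨q, hq, hq0⟩ : ∃ q : ℝ → Per, SmoothConv (Ioo 0 T) p q ∧
      ∀ t ∈ Ioo 0 T, integ (q t) = 0 := by
    refine exists_smoothConv (fun n t => integ_synth _ _) (fun k τ hτ => ?_) (fun ε hε => ?_)
      (fun n k => ?_)
    · obtain ⟨B, hB'⟩ := exists_smoothing_bound c θ (m / 4) M₄ T (by linarith) hT k τ hτ
      refine ⟨(4 * Real.pi) ^ 4 * B, fun n t ht => ?_⟩
      have h1 := norm_toL2_pow_der_le (integ_synth (n + n₀) (y n t)) (Nat.le_add_right k 4)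
      rw [Nat.add_sub_cancel_left] at h1
      exact h1.trans (mul_le_mul_of_nonneg_left (hB' _ _ (hB n) t ht) (by positivity))
    · set η : ℝ := ε ^ 2 / (2 * (K + 1)) with hη
      have hη0 : 0 < η := by positivity
      have hc1 := ((tendsto_toL2_pow_der_trunc v₀ 0).cauchySeq).comp_tendsto hd
      obtain ⟨n₁, hn₁⟩ := Metric.cauchySeq_iff.1 hc1 (Real.sqrt η) (Real.sqrt_pos.2 hη0)
      obtain ⟨n₂, hn₂⟩ := exists_nat_one_div_lt hη0
      have key : ∀ i ≥ max n₁ n₂, ∀ j ≥ max n₁ n₂, i ≤ j → ∀ t ∈ Icc 0 T,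
          ‖toL2 (p j t - p i t)‖ ≤ ε := by
        intro i hi j hj hij t ht
        have h1 := hdiff (i + n₀) (j + n₀) (y i) (y j) (by omega) (hB i) (hB j) t ht
        refine abs_le_of_sq_le_sq' (h1.trans ?_) hε.le |>.2
        have h2 : ‖toL2 (p j 0 - p i 0)‖ ^ 2 ≤ η := by
          have := hn₁ j (le_of_max_le_left hj) i (le_of_max_le_left hi)
          rw [dist_eq_norm] at this
          have h3 : ‖toL2 (p j 0 - p i 0)‖ ≤ Real.sqrt η := by
            rw [hp0, hp0, map_sub]
            exact this.le
          calc _ ≤ Real.sqrt η ^ 2 := by gcongr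
            _ = η := Real.sq_sqrt hη0.le
        have h3 : 1 / (((i + n₀ : ℕ) : ℝ) + 1) ≤ η := by
          refine le_trans ?_ hn₂.le
          have : (n₂ : ℝ) ≤ ((i + n₀ : ℕ) : ℝ) := by
            exact_mod_cast (le_of_max_le_right hi).trans (Nat.le_add_right _ _)
          gcongr
        calc _ ≤ K * (η + η) := mul_le_mul_of_nonneg_left (add_le_add h2 h3) hK
          _ ≤ (K + 1) * (η + η) := by nlinarith
          _ = ε ^ 2 := by rw [hη]; field_simp; ring
      refine ⟨max n₁ n₂, fun i hi j hj t ht => ?_⟩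
      rcases le_total i j with hij | hij
      · rw [← norm_neg, ← map_neg, neg_sub]
        exact key i hi j hj hij t ht
      · exact key j hj i hi hij t ht
    · exact continuousOn_toC_synth (fun j hj t ht =>
        (hyG n t (Ioo_subset_Icc_self ht) j hj).continuousAt.continuousWithinAt) k
  obtain ⟨hW, hder⟩ := SmoothConv.hasDerivAt_iota hd hyG hq hq0
  refine ⟨q, hW, fun t ht => ⟨hq0 t ht, hder t ht, fun x => ?_, ?_, ?_⟩⟩
  · exact ge_of_tendsto' ((hq.tendsto_apply ht x).const_add c) fun n =>
      (hB n).pos t (Ioo_subset_Icc_self ht) x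
  · rw [D_iota (hq0 t ht)]
    refine le_of_tendsto_of_tendsto' ((hq.tendsto_toL2 4 ht).norm.pow 2)
      ((((tendsto_toL2_pow_der_trunc v₀ 4).comp hd).norm.pow 2).mul_const _) fun n =>
        (hyb n t (Ioo_subset_Icc_self ht)).2.1
  · rw [D_sub, D_iota (hq0 t ht)]
    refine le_of_tendsto' (((hq.tendsto_toL2 0 ht).sub
      ((tendsto_toL2_pow_der_trunc v₀ 0).comp hd)).norm.pow 2) fun n => ?_
    have := (hyb n t (Ioo_subset_Icc_self ht)).2.2
    rw [map_sub] at this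
    exact this

/-- Local existence, on a time interval that depends only on a bound for the initial value in `Ḣ⁴`
and on a lower bound for the initial height; the solution is smooth for positive times. -/
theorem IsNonlinearity.exists_local {c θ : ℝ} {N : HDot 4 → L2 → Prop}
    (hN : IsNonlinearity c θ N) {m : ℝ} (hm : 0 < m) (M : ℝ) :
    ∃ T C : ℝ, 0 < T ∧ T < 1 ∧ ∀ v₀ : HDot 4, ‖v₀‖ ≤ M → (∀ᵐ x, m ≤ c + D 0 v₀ x) →
      ∃ v : ℝ → HDot 4, v 0 = v₀ ∧ IsSolution c N (Icc 0 T) v ∧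
        (∀ t ∈ Icc 0 T, ∀ᵐ x, m / 4 ≤ c + D 0 (v t) x) ∧ (∀ t ∈ Icc 0 T, ‖v t‖ ≤ C * ‖v₀‖) ∧
        ∀ t ∈ Ioc 0 T, ∃ p, integ p = 0 ∧ v t = iota p := by
  obtain ⟨T, C, L, hT, hT1, hC, hL, hG⟩ := exists_galerkin_limit c θ m M hm
  refine ⟨T / 2, 3 * (4 * Real.pi) ^ 4 * Real.exp C, by linarith, by linarith,
    fun v₀ hv₀ hpos => ?_⟩
  obtain ⟨q, hW, hq⟩ := hG v₀ hv₀ hpos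
  set v : ℝ → HDot 4 := fun t => if t ≤ 0 then v₀ else iota (q t) with hv
  have hv0 : v 0 = v₀ := if_pos le_rfl
  have hvt : ∀ t, 0 < t → v t = iota (q t) := fun t ht => if_neg ht.not_ge
  have hIoo : ∀ t ∈ Ioc 0 (T / 2), t ∈ Ioo 0 T := fun t ht => ⟨ht.1, by linarith [ht.2]⟩
  have hcases : ∀ t ∈ Icc 0 (T / 2), t = 0 ∨ t ∈ Ioc 0 (T / 2) := fun t ht =>
    ht.1.eq_or_lt.imp Eq.symm fun h => ⟨h, ht.2⟩
  have hder : ∀ t ∈ Ioo 0 T, HasDerivAt v (iota (Per.vf c θ (q t))) t := fun t ht =>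
    (hq t ht).2.1.congr_of_eventuallyEq (by
      filter_upwards [isOpen_Ioo.mem_nhds ht] with s hs
      exact hvt s hs.1)
  have hb4 : ∀ t ∈ Icc 0 (T / 2), ‖D 4 (v t)‖ ^ 2 ≤ ‖D 4 v₀‖ ^ 2 * Real.exp (C * t) := by
    intro t ht
    rcases hcases t ht with rfl | h
    · simp [hv0]
    · rw [hvt t h.1]; exact (hq t (hIoo t h)).2.2.2.1
  have hb0 : ∀ t ∈ Icc 0 (T / 2), ‖D 0 (v t - v₀)‖ ^ 2 ≤ L * t := by
    intro t ht
    rcases hcases t ht with rfl | h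
    · rw [hv0, D_sub]; simp
    · rw [hvt t h.1]; exact (hq t (hIoo t h)).2.2.2.2
  refine ⟨v, hv0, ⟨fun t ht => ?_, fun t => iota (Per.vf c θ (q t)), ?_, fun t ht => ?_⟩,
    fun t ht => ?_, fun t ht => ?_, fun t ht => ⟨q t, (hq t (hIoo t ht)).1, hvt t ht.1⟩⟩
  · rcases hcases t ht with rfl | h
    · rw [ContinuousWithinAt, hv0]
      exact tendsto_of_norm_D_four_le nhdsWithin_le_nhds
        (eventually_nhdsWithin_of_forall hb4) (eventually_nhdsWithin_of_forall hb0)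
    · exact (hder t (hIoo t h)).continuousAt.continuousWithinAt
  · exact hW.mono fun t ht => hIoo t ((hcases t ht.1).resolve_left ht.2)
  · have h := hIoo t ((hcases t ht.1).resolve_left ht.2)
    refine ⟨(hder t h).hasDerivWithinAt, toL2 (Per.vf c θ (q t)) - opL c (iota (q t)), ?_, ?_⟩
    · rw [hvt t h.1]
      exact hN.2 _ (hq t h).1
    · rw [hvt t h.1, add_sub_cancel, D_iota (integ_vf _ _ _)]
      rfl
  · rcases hcases t ht with rfl | h
    · rw [hv0]
      filter_upwards [hpos] with x hx
      linarith
    · rw [hvt t h.1]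
      exact ae_le_iota (hq t (hIoo t h)).1 (hq t (hIoo t h)).2.2.1
  · have h1 : ‖D 4 (v t)‖ ≤ ‖v₀‖ * Real.exp C := by
      refine abs_le_of_sq_le_sq' ((hb4 t ht).trans ?_) (by positivity) |>.2
      have h2 : Real.exp (C * t) ≤ Real.exp C ^ 2 := by
        rw [← Real.exp_nat_mul]
        refine Real.exp_le_exp.2 ?_
        push_cast
        nlinarith [ht.1, ht.2]
      rw [mul_pow]
      have := norm_D_le 4 v₀
      gcongr
    refine (norm_le_D_four (v t)).trans ((mul_le_mul_of_nonneg_left h1 (by positivity)).trans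
      (le_of_eq ?_))
    ring

/-! ### Smoothness and a priori bounds of positive solutions -/

/-- Translation in time and restriction; only the origin of the new time interval may correspond to
the exceptional time zero. -/
theorem IsSolution.comp_add {c : ℝ} {N : HDot 4 → L2 → Prop} {I J : Set ℝ} {v : ℝ → HDot 4}
    (h : IsSolution c N I v) {a : ℝ} (hJ : ∀ t ∈ J, t + a ∈ I) (h0 : ∀ t ∈ J, t ≠ 0 → t + a ≠ 0) :
    IsSolution c N J fun t => v (t + a) := by
  obtain ⟨hc, w, hw, hd⟩ := h
  have hadd : Continuous fun t : ℝ => t + a := continuous_id.add continuous_const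
  refine ⟨hc.comp hadd.continuousOn hJ, fun t => w (t + a),
    hw.comp hadd.continuousOn fun t ht => ⟨hJ t ht.1, h0 t ht.1 ht.2⟩, fun t ht => ?_⟩
  obtain ⟨h1, h2⟩ := hd (t + a) ⟨hJ t ht.1, h0 t ht.1 ht.2⟩
  refine ⟨?_, h2⟩
  have := h1.scomp t (h := fun t => t + a) ((hasDerivWithinAt_id t J).add_const a) hJ
  rwa [one_smul] at this

/-- Positive solutions are smooth for positive times: near such a time, they coincide with the
smooth solutions started slightly earlier. -/
theorem IsNonlinearity.exists_eq_iota {c θ : ℝ} {N : HDot 4 → L2 → Prop}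
    (hN : IsNonlinearity c θ N) {S : ℝ} {v : ℝ → HDot 4} (hv : IsSolution c N (Ico 0 S) v)
    (hpos : FilmPositiveOn c (Ico 0 S) v) {t : ℝ} (ht : t ∈ Ioo 0 S) :
    ∃ p, integ p = 0 ∧ v t = iota p := by
  obtain ⟨m, hm, hpos⟩ := hpos
  have hsub : Icc 0 t ⊆ Ico 0 S := fun s hs => ⟨hs.1, hs.2.trans_lt ht.2⟩
  obtain ⟨M, hM⟩ := isCompact_Icc.exists_bound_of_continuousOn (hv.1.mono hsub)
  obtain ⟨T, C, hT, -, hloc⟩ := hN.exists_local hm M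
  set r : ℝ := min T t with hr
  have hr0 : 0 < r := lt_min hT ht.1
  have hrt : r ≤ t := min_le_right _ _
  have ha : t - r ∈ Icc 0 t := ⟨by linarith, by linarith⟩
  obtain ⟨u, hu0, hu, -, -, husm⟩ := hloc (v (t - r)) (hM _ ha) (hpos _ (hsub ha))
  have hmem : ∀ s ∈ Icc 0 r, s + (t - r) ∈ Ico 0 S := fun s hs =>
    hsub ⟨by linarith [hs.1, ha.1], by linarith [hs.2]⟩
  have h1 : IsSolution c N (Icc 0 r) fun s => v (s + (t - r)) := by
    refine hv.comp_add hmem fun s hs hs0 => ?_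
    have : 0 < s := lt_of_le_of_ne hs.1 (Ne.symm hs0)
    linarith [ha.1]
  have h2 : IsSolution c N (Icc 0 r) u := by
    have := hu.comp_add (J := Icc 0 r) (a := 0)
      (fun s hs => ⟨by linarith [hs.1], by linarith [hs.2, min_le_left T t]⟩)
      (fun s _ hs0 => by rwa [add_zero])
    simpa only [add_zero] using this
  have heq := hN.eqOn h1 h2 ⟨m, hm, fun s hs => hpos _ (hmem s hs)⟩ (by simp [hu0])
    (right_mem_Icc.2 hr0.le)
  simp only [add_sub_cancel] at heq
  rw [heq]
  exact husm r ⟨hr0, min_le_left _ _⟩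

theorem IsNonlinearity.exists_smooth {c θ : ℝ} {N : HDot 4 → L2 → Prop}
    (hN : IsNonlinearity c θ N) {S : ℝ} {v : ℝ → HDot 4} (hv : IsSolution c N (Ico 0 S) v)
    (hpos : FilmPositiveOn c (Ico 0 S) v) :
    ∃ q : ℝ → Per, ∀ t ∈ Ioo 0 S, integ (q t) = 0 ∧ v t = iota (q t) ∧
      HasDerivAt v (iota (vf c θ (q t))) t := by
  choose! q hq0 hq using fun (t : ℝ) (ht : t ∈ Ioo 0 S) => hN.exists_eq_iota hv hpos ht
  refine ⟨q, fun t ht => ⟨hq0 t ht, hq t ht, ?_⟩⟩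
  obtain ⟨-, w, -, hw⟩ := hv
  obtain ⟨hd, r, hr, hwr⟩ := hw t ⟨⟨ht.1.le, ht.2⟩, ht.1.ne'⟩
  have hwt : w t = iota (vf c θ (q t)) := by
    refine D_ext ?_
    rw [hq t ht] at hr hwr
    rw [hwr, hN.eq_toL2_vf (hq0 t ht) hr, D_iota (integ_vf _ _ _)]
    rfl
  rw [← hwt]
  exact hd.hasDerivAt (Ico_mem_nhds ht.1 ht.2)

theorem hasDerivAt_norm_D_sq {v : ℝ → HDot 4} {p V : Per} {t : ℝ} (hp : integ p = 0)
    (hV : integ V = 0) (hv : v t = iota p) (h : HasDerivAt v (iota V) t) (i : Fin 5) :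
    HasDerivAt (fun t => ‖D i (v t)‖ ^ 2)
      (2 * integ ((der ^ (i : ℕ)) p * (der ^ (i : ℕ)) V)) t := by
  have h1 := ((DL i).hasFDerivAt.comp_hasDerivAt t h).norm_sq
  refine h1.congr_deriv ?_
  rw [← Per.inner_toL2, ← D_iota hp, ← D_iota hV, ← hv]
  rfl

theorem exists_bound_of_deriv_le {f f' : ℝ → ℝ} {a b K ε : ℝ} (hK : 0 ≤ K) (hε : 0 ≤ ε)
    (hd : ∀ t ∈ Ico a b, HasDerivAt f (f' t) t) (hb : ∀ t ∈ Ico a b, f' t ≤ K * f t + ε) :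
    ∃ B, ∀ t ∈ Ico a b, f t ≤ B := by
  refine ⟨(|f a| + ε * (b - a)) * Real.exp (K * (b - a)), fun t ht => ?_⟩
  have hsub : Icc a t ⊆ Ico a b := fun s hs => ⟨hs.1, hs.2.trans_lt ht.2⟩
  have h0 : 0 ≤ b - a := by linarith [ht.1, ht.2]
  refine (gronwall_le hK hε (fun s hs => (hd s (hsub hs)).continuousAt.continuousWithinAt)
    (fun s hs => hd s (hsub (Ioo_subset_Icc_self hs)))
    (fun s hs => hb s (hsub (Ioo_subset_Icc_self hs))) (right_mem_Icc.2 ht.1)).trans ?_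
  have h1 : f a ≤ |f a| := le_abs_self _
  have h2 : t - a ≤ b - a := by linarith [ht.2]
  have h3 : 0 ≤ |f a| + ε * (b - a) := by positivity
  have h4 : f a + ε * (t - a) ≤ |f a| + ε * (b - a) := by gcongr
  exact (mul_le_mul_of_nonneg_right h4 (Real.exp_pos _).le).trans
    (mul_le_mul_of_nonneg_left (Real.exp_le_exp.2 (mul_le_mul_of_nonneg_left h2 hK)) h3)

/-- The energy `‖∂v‖² - ‖v‖²` grows at most exponentially and, by mass conservation and positivity
of the height, controls `‖∂v‖²`. -/
theorem exists_bound_D_one {c θ m a S : ℝ} (hc : 0 < c) (hm : 0 < m) {v : ℝ → HDot 4}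
    {q : ℝ → Per} (hq0 : ∀ t ∈ Ico a S, integ (q t) = 0) (hq : ∀ t ∈ Ico a S, v t = iota (q t))
    (hd : ∀ t ∈ Ico a S, HasDerivAt v (iota (vf c θ (q t))) t)
    (hpos : ∀ t ∈ Ico a S, ∀ x, m ≤ c + q t x) :
    ∃ M, ∀ t ∈ Ico a S, ‖D 1 (v t)‖ ≤ M := by
  set K : ℝ := (θ / 2) ^ 2 / (4 * m ^ 3) * (64 * Real.pi ^ 2 * c ^ 2) with hK
  set A : ℝ := (8 * Real.pi * c) ^ 2 with hA
  have hK0 : 0 ≤ K := by positivity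
  have hA0 : 0 ≤ A := by positivity
  have hcoer : ∀ t ∈ Ico a S, ‖D 0 (v t)‖ ^ 2 ≤ A + 1 / 4 * ‖D 1 (v t)‖ ^ 2 := by
    intro t ht
    have h := norm_toL2_sq_le_quarter hc (hq0 t ht) fun x => hm.le.trans (hpos t ht x)
    rw [hq t ht, D_iota (hq0 t ht), D_iota (hq0 t ht)]
    simpa using h
  obtain ⟨B, hB⟩ := exists_bound_of_deriv_le (f := fun t => ‖D 1 (v t)‖ ^ 2 - ‖D 0 (v t)‖ ^ 2)
    (f' := fun t => 2 * integ ((der ^ ((1 : Fin 5) : ℕ)) (q t) *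
        (der ^ ((1 : Fin 5) : ℕ)) (vf c θ (q t))) -
      2 * integ ((der ^ ((0 : Fin 5) : ℕ)) (q t) * (der ^ ((0 : Fin 5) : ℕ)) (vf c θ (q t))))
    (K := 4 * K) (ε := 4 * K * A) (a := a) (b := S) (by positivity) (by positivity)
    (fun t ht => (hasDerivAt_norm_D_sq (hq0 t ht) (integ_vf _ _ _) (hq t ht) (hd t ht) 1).sub
      (hasDerivAt_norm_D_sq (hq0 t ht) (integ_vf _ _ _) (hq t ht) (hd t ht) 0))
    (fun t ht => by
      have h1 := first_energy_le (θ := θ) hm (hq0 t ht) (hpos t ht)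
      have h2 := hcoer t ht
      have h3 : ‖toL2 (der (q t))‖ ^ 2 = ‖D 1 (v t)‖ ^ 2 := by
        rw [hq t ht, D_iota (hq0 t ht)]; simp
      rw [h3, ← hK] at h1
      have h4 : ‖D 1 (v t)‖ ^ 2 ≤ 2 * (‖D 1 (v t)‖ ^ 2 - ‖D 0 (v t)‖ ^ 2) + 2 * A := by
        nlinarith [sq_nonneg ‖D 1 (v t)‖]
      have h5 := mul_le_mul_of_nonneg_left h4 hK0
      simp only [Fin.val_one, Fin.val_zero, pow_der_one, pow_der_zero]
      linarith)
  refine ⟨Real.sqrt (2 * B + 2 * A), fun t ht => Real.le_sqrt_of_sq_le ?_⟩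
  have h1 := hB t ht
  have h2 := hcoer t ht
  nlinarith [sq_nonneg ‖D 1 (v t)‖]

/-- For `k ≥ 2`, a bound for the derivative of order `k - 1` propagates to the one of order `k`. -/
theorem exists_bound_D_succ {c θ m a S : ℝ} (hm : 0 < m) {v : ℝ → HDot 4}
    {q : ℝ → Per} (hq0 : ∀ t ∈ Ico a S, integ (q t) = 0) (hq : ∀ t ∈ Ico a S, v t = iota (q t))
    (hd : ∀ t ∈ Ico a S, HasDerivAt v (iota (vf c θ (q t))) t)
    (hpos : ∀ t ∈ Ico a S, ∀ x, m ≤ c + q t x) {i j : Fin 5} (hi : i ≠ 0) (hj : (j : ℕ) = i + 1)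
    {M : ℝ} (hM : ∀ t ∈ Ico a S, ‖D i (v t)‖ ≤ M) :
    ∃ M', ∀ t ∈ Ico a S, ‖D j (v t)‖ ≤ M' := by
  obtain ⟨l, hl⟩ : ∃ l : ℕ, (i : ℕ) = l + 1 :=
    Nat.exists_eq_succ_of_ne_zero fun h => hi (Fin.ext h)
  rw [hl] at hj
  obtain ⟨C, hC, hen⟩ := exists_energy_bound c θ m M hm l
  obtain ⟨B, hB⟩ := exists_bound_of_deriv_le (f := fun t => ‖D j (v t)‖ ^ 2)
    (f' := fun t => 2 * integ ((der ^ (j : ℕ)) (q t) * (der ^ (j : ℕ)) (vf c θ (q t))))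
    (K := 2 * C) (ε := 0) (a := a) (b := S) (by positivity) le_rfl
    (fun t ht => hasDerivAt_norm_D_sq (hq0 t ht) (integ_vf _ _ _) (hq t ht) (hd t ht) j)
    (fun t ht => by
      have h1 := hM t ht
      rw [hq t ht, D_iota (hq0 t ht), hl] at h1
      have h2 := hen (q t) (hq0 t ht) (hpos t ht) h1
      rw [hq t ht, D_iota (hq0 t ht), hj, integ_pow_der_mul_pow_der]
      have h3 : 0 ≤ m ^ 3 / 2 * ‖toL2 ((der ^ (l + 4)) (q t))‖ ^ 2 := by positivity
      linarith)
  exact ⟨Real.sqrt B, fun t ht => Real.le_sqrt_of_sq_le (hB t ht)⟩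

/-- A positive solution stays bounded in `Ḣ⁴` up to the end of its interval of existence. -/
theorem IsNonlinearity.exists_bound {c θ : ℝ} {N : HDot 4 → L2 → Prop}
    (hN : IsNonlinearity c θ N) (hc : 0 < c) {S a : ℝ} (ha : 0 < a) {v : ℝ → HDot 4}
    (hv : IsSolution c N (Ico 0 S) v) (hpos : FilmPositiveOn c (Ico 0 S) v) :
    ∃ M, ∀ t ∈ Ico a S, ‖v t‖ ≤ M := by
  obtain ⟨q, hq⟩ := hN.exists_smooth hv hpos
  obtain ⟨m, hm, hpos⟩ := hpos
  have hIoo : ∀ t ∈ Ico a S, t ∈ Ioo 0 S := fun t ht => ⟨ha.trans_le ht.1, ht.2⟩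
  have hq0 : ∀ t ∈ Ico a S, integ (q t) = 0 := fun t ht => (hq t (hIoo t ht)).1
  have hqv : ∀ t ∈ Ico a S, v t = iota (q t) := fun t ht => (hq t (hIoo t ht)).2.1
  have hd : ∀ t ∈ Ico a S, HasDerivAt v (iota (vf c θ (q t))) t := fun t ht =>
    (hq t (hIoo t ht)).2.2
  have hqm : ∀ t ∈ Ico a S, ∀ x, m ≤ c + q t x := fun t ht x => by
    have := hpos t (Ioo_subset_Ico_self (hIoo t ht))
    rw [hqv t ht] at this
    exact le_of_ae_le_iota (hq0 t ht) this x
  obtain ⟨M₁, h1⟩ := exists_bound_D_one hc hm hq0 hqv hd hqm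
  obtain ⟨M₂, h2⟩ := exists_bound_D_succ (i := 1) (j := 2) hm hq0 hqv hd hqm (by decide) rfl h1
  obtain ⟨M₃, h3⟩ := exists_bound_D_succ (i := 2) (j := 3) hm hq0 hqv hd hqm (by decide) rfl h2
  obtain ⟨M₄, h4⟩ := exists_bound_D_succ (i := 3) (j := 4) hm hq0 hqv hd hqm (by decide) rfl h3
  exact ⟨3 * (4 * Real.pi) ^ 4 * M₄, fun t ht => (norm_le_D_four _).trans
    (mul_le_mul_of_nonneg_left (h4 t ht) (by positivity))⟩

/-! ### Continuation -/

/-- Two solutions that agree on an overlap `(a, S)` combine to a solution. -/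
theorem IsSolution.glue {c : ℝ} {N : HDot 4 → L2 → Prop} {a S S' : ℝ} (ha : 0 ≤ a)
    (hS' : S < S') {v u : ℝ → HDot 4} (hv : IsSolution c N (Ico 0 S) v)
    (hu : IsSolution c N (Icc 0 (S' - a)) u) (heq : ∀ t ∈ Ioo a S, v t = u (t - a))
    (haS : a < S) : IsSolution c N (Icc 0 S') fun t => if t < S then v t else u (t - a) := by
  set U : ℝ → HDot 4 := fun t => if t < S then v t else u (t - a) with hU
  obtain ⟨hvc, w, hwc, hw⟩ := hv
  obtain ⟨huc, z, hzc, hz⟩ := hu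
  have hUv : ∀ t ∈ Ico 0 S, U t = v t := fun t ht => if_pos ht.2
  have hUu : ∀ t ∈ Ioc a S', U t = u (t - a) := fun t ht => by
    by_cases h : t < S
    · rw [hU]; simp only [if_pos h]; exact heq t ⟨ht.1, h⟩
    · exact if_neg h
  have hsub : ∀ t ∈ Ioc a S', t - a ∈ Icc 0 (S' - a) \ {0} := fun t ht =>
    ⟨⟨by linarith [ht.1], by linarith [ht.2]⟩, by
      have : 0 < t - a := by linarith [ht.1]
      exact this.ne'⟩
  have hUw : ∀ t ∈ Ico 0 S, t ≠ 0 → HasDerivWithinAt U (w t) (Ico 0 S) t := fun t ht h0 =>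
    (hw t ⟨ht, h0⟩).1.congr hUv (hUv t ht)
  have hUz : ∀ t ∈ Ioc a S', HasDerivWithinAt U (z (t - a)) (Ioc a S') t := fun t ht => by
    have h1 := (hz (t - a) (hsub t ht)).1.scomp t (h := fun t => t - a) (s := Ioc a S')
      ((hasDerivWithinAt_id t _).sub_const a) fun s hs => (hsub s hs).1
    rw [one_smul] at h1
    exact h1.congr hUu (hUu t ht)
  set W : ℝ → HDot 4 := fun t => if t < S then w t else z (t - a) with hW
  have hWw : ∀ t ∈ Ico 0 S, W t = w t := fun t ht => if_pos ht.2
  have hWz : ∀ t ∈ Ioc a S', W t = z (t - a) := fun t ht => by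
    by_cases h : t < S
    · rw [hW]
      simp only [if_pos h]
      have h0 : 0 < t := ha.trans_lt ht.1
      exact ((hUw t ⟨h0.le, h⟩ h0.ne').hasDerivAt (Ico_mem_nhds h0 h)).unique
        ((hUz t ht).hasDerivAt (Ioc_mem_nhds ht.1 (h.trans hS')))
    · exact if_neg h
  have hcases : ∀ t ∈ Icc 0 S', t ∈ Ico 0 S ∨ t ∈ Ioc a S' := fun t ht =>
    (lt_or_ge t S).imp (fun h => ⟨ht.1, h⟩) fun h => ⟨haS.trans_le h, ht.2⟩
  have hn1 : ∀ t ∈ Ico 0 S, ∀ s : Set ℝ, Ico 0 S ∩ s ∈ 𝓝[Icc 0 S' ∩ s] t := fun t ht s =>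
    mem_nhdsWithin.2 ⟨Iio S, isOpen_Iio, ht.2, fun x hx => ⟨⟨hx.2.1.1, hx.1⟩, hx.2.2⟩⟩
  have hn2 : ∀ t ∈ Ioc a S', ∀ s : Set ℝ, Ioc a S' ∩ s ∈ 𝓝[Icc 0 S' ∩ s] t := fun t ht s =>
    mem_nhdsWithin.2 ⟨Ioi a, isOpen_Ioi, ht.1, fun x hx => ⟨⟨hx.1, hx.2.1.2⟩, hx.2.2⟩⟩
  have hshift : Continuous fun t : ℝ => t - a := continuous_id.sub continuous_const
  refine ⟨fun t ht => ?_, W, fun t ht => ?_, fun t ht => ?_⟩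
  · rcases hcases t ht with h | h
    · have := hn1 t h univ
      rw [inter_univ, inter_univ] at this
      exact ((hvc t h).congr hUv (hUv t h)).mono_of_mem_nhdsWithin this
    · have := hn2 t h univ
      rw [inter_univ, inter_univ] at this
      have h1 := huc.comp (s := Ioc a S') hshift.continuousOn fun s hs => (hsub s hs).1
      exact ((h1 t h).congr hUu (hUu t h)).mono_of_mem_nhdsWithin this
  · rcases hcases t ht.1 with h | h
    · exact ((hwc t ⟨h, ht.2⟩).congr (fun s hs => hWw s hs.1)
        (hWw t h)).mono_of_mem_nhdsWithin (hn1 t h {0}ᶜ)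
    · have h1 := hzc.comp (s := Ioc a S') hshift.continuousOn fun s hs => hsub s hs
      exact (((h1 t h).congr hWz (hWz t h)).mono inter_subset_left).mono_of_mem_nhdsWithin
        (hn2 t h {0}ᶜ)
  · rcases hcases t ht.1 with h | h
    · have := hn1 t h univ
      rw [inter_univ, inter_univ] at this
      rw [hWw t h, hUv t h]
      exact ⟨(hUw t h ht.2).mono_of_mem_nhdsWithin this, (hw t ⟨h, ht.2⟩).2⟩
    · have := hn2 t h univ
      rw [inter_univ, inter_univ] at this
      rw [hWz t h, hUu t h]
      exact ⟨(hUz t h).mono_of_mem_nhdsWithin this, (hz _ (hsub t h)).2⟩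

/-- A positive solution on `[0, S)` extends beyond `S`. -/
theorem IsNonlinearity.exists_continuation {c θ : ℝ} {N : HDot 4 → L2 → Prop}
    (hN : IsNonlinearity c θ N) (hc : 0 < c) {S : ℝ} (hS : 0 < S) {v : ℝ → HDot 4}
    (hv : IsSolution c N (Ico 0 S) v) (hpos : FilmPositiveOn c (Ico 0 S) v) :
    ∃ (S' : ℝ) (u : ℝ → HDot 4), S < S' ∧ IsSolution c N (Icc 0 S') u ∧
      FilmPositiveOn c (Icc 0 S') u ∧ EqOn u v (Ico 0 S) := by
  obtain ⟨M, hM⟩ := hN.exists_bound hc (half_pos hS) hv hpos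
  obtain ⟨m, hm, hpos⟩ := hpos
  obtain ⟨T, C, hT, -, hloc⟩ := hN.exists_local hm M
  -- the restart time precedes `S` by less than the guaranteed time of existence
  set a : ℝ := max (S / 2) (S - T / 2) with ha
  have ha1 : S / 2 ≤ a := le_max_left _ _
  have ha2 : S - T / 2 ≤ a := le_max_right _ _
  have haS : a < S := max_lt (by linarith) (by linarith)
  have ha0 : 0 ≤ a := by linarith
  obtain ⟨u, hu0, hu, hupos, -, -⟩ := hloc (v a) (hM a ⟨ha1, haS⟩) (hpos a ⟨ha0, haS⟩)
  have hmem : ∀ r < S, ∀ s ∈ Icc 0 (r - a), s + a ∈ Ico 0 S := fun r hr s hs =>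
    ⟨by linarith [hs.1], by linarith [hs.2]⟩
  have heq : ∀ t ∈ Ioo a S, v t = u (t - a) := by
    intro t ht
    have h1 : IsSolution c N (Icc 0 (t - a)) fun s => v (s + a) := by
      refine hv.comp_add (hmem t ht.2) fun s hs hs0 => ?_
      have : 0 < s := lt_of_le_of_ne hs.1 (Ne.symm hs0)
      linarith
    have h2 : IsSolution c N (Icc 0 (t - a)) u := by
      have := hu.comp_add (J := Icc 0 (t - a)) (a := 0)
        (fun s hs => ⟨by linarith [hs.1], by linarith [hs.2, ht.2]⟩)
        (fun s _ hs0 => by rwa [add_zero])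
      simpa only [add_zero] using this
    have := hN.eqOn h1 h2 ⟨m, hm, fun s hs => hpos _ (hmem t ht.2 s hs)⟩ (by simp [hu0])
      (right_mem_Icc.2 (by linarith [ht.1]))
    simpa using this
  have hS' : S < a + T := by linarith
  refine ⟨a + T, _, hS', hv.glue ha0 hS' (by rwa [add_sub_cancel_left]) heq haS,
    ⟨m / 4, by positivity, fun t ht => ?_⟩, fun t ht => if_pos ht.2⟩
  by_cases h : t < S
  · simp only [if_pos h]
    filter_upwards [hpos t ⟨ht.1, h⟩] with x hx
    linarith
  · simp only [if_neg h]
    exact hupos (t - a) ⟨by linarith, by linarith [ht.2]⟩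

theorem ae_abs_D_zero_le (v : HDot 4) : ∀ᵐ x, |D 0 v x| ≤ (4 * Real.pi) ^ 4 * ‖v‖ := by
  obtain ⟨U, hU, hD⟩ := exists_tendsto_toC_trunc v 0
  have hle : ‖U‖ ≤ (4 * Real.pi) ^ 4 * ‖v‖ := by
    refine (le_of_tendsto_of_tendsto' hU.norm
      ((tendsto_toL2_pow_der_trunc v 4).norm.const_mul ((4 * Real.pi) ^ 4)) fun n =>
        norm_toC_pow_der_le_uniform (integ_trunc n v) (by decide) le_rfl).trans ?_
    exact mul_le_mul_of_nonneg_left (norm_D_le 4 v) (by positivity)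
  have h2 := ContinuousMap.coeFn_toLp (p := 2) (𝕜 := ℝ) (volume : Measure Circ) U
  rw [← hD] at h2
  filter_upwards [h2] with x hx
  change D 0 v x = U x at hx
  rw [hx]
  exact (U.norm_coe_le_norm x).trans hle

end ThinFilm

end

open ThinFilm
theorem mainTheorem7 (c : ℝ) (hc : 0 < c) (N : HDot 4 → L2 → Prop)
    (hN : N = IsR c ∨ N = IsRbar c) :
    (∃ δ₀ T C : ℝ, 0 < δ₀ ∧ 0 < T ∧ T < 1 ∧ ∀ vin : HDot 4, ‖vin‖ ≤ δ₀ →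
      (∃ v : ℝ → HDot 4, IsSolution c N (Set.Icc 0 T) v ∧ v 0 = vin ∧
        FilmPositiveOn c (Set.Icc 0 T) v ∧ ∀ t ∈ Set.Icc 0 T, ‖v t‖ ≤ C * ‖vin‖) ∧
      (∀ (S : ℝ) (v : ℝ → HDot 4), 0 < S → IsSolution c N (Set.Ico 0 S) v → v 0 = vin →
        FilmPositiveOn c (Set.Ico 0 S) v →
        ∃ (S' : ℝ) (u : ℝ → HDot 4), S < S' ∧ IsSolution c N (Set.Icc 0 S') u ∧
          FilmPositiveOn c (Set.Icc 0 S') u ∧ Set.EqOn u v (Set.Ico 0 S))) ∧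
    (∀ (S : ℝ) (u v : ℝ → HDot 4), 0 < S →
      IsSolution c N (Set.Icc 0 S) u → IsSolution c N (Set.Icc 0 S) v →
      FilmPositiveOn c (Set.Icc 0 S) u → FilmPositiveOn c (Set.Icc 0 S) v →
      u 0 = v 0 → Set.EqOn u v (Set.Icc 0 S)) := by
  obtain ⟨θ, hN⟩ := exists_isNonlinearity hN
  -- smallness in `Ḣ⁴` makes `|v| ≤ c / 2`, hence the initial height at least `c / 2`
  set δ : ℝ := c / (2 * (4 * Real.pi) ^ 4) with hδ
  have hδ0 : 0 < δ := by positivity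
  obtain ⟨T, C, hT, hT1, hloc⟩ := hN.exists_local (half_pos hc) δ
  refine ⟨⟨δ, T, C, hδ0, hT, hT1, fun vin hvin => ⟨?_, fun S v hS hv _ hpos =>
    hN.exists_continuation hc hS hv hpos⟩⟩, fun S u v _ hu hv hpos _ h0 => hN.eqOn hu hv hpos h0⟩
  have hin : ∀ᵐ x, c / 2 ≤ c + D 0 vin x := by
    filter_upwards [ae_abs_D_zero_le vin] with x hx
    have h1 : (4 * Real.pi) ^ 4 * ‖vin‖ ≤ c / 2 := by
      refine (mul_le_mul_of_nonneg_left hvin (by positivity)).trans (le_of_eq ?_)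
      rw [hδ]
      field_simp
    linarith [(abs_le.1 (hx.trans h1)).1]
  obtain ⟨v, hv0, hv, hpos, hb, -⟩ := hloc vin hvin hin
  exact ⟨v, hv, hv0, ⟨c / 2 / 4, by positivity, hpos⟩, hb⟩
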